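/- Let $N\ge 1$, and let $2^*=\frac{2N}{N-2}$ if $N\ge 3$. Let $V\in L^\infty(\mathbb{R}^N)$ be real valued and $1$-periodic in all coordinates. Let $f\in C^1(\mathbb{R})$ satisfy $f(0)=f'(0)=0$ and $$\lim_{|s|\to\infty}\frac{f'(s)}{|s|^{2^*-2}}=0\ \text{ if } N\ge 3,\qquad \lim_{|s|\to\infty}\frac{f'(s)}{|s|^{p-2}}=0\ \text{ for some } p>2\ \text{ if } N\in\{1,2\}.$$ Put $F(s)=\int_0^s f$ and define, on the real Sobolev space $H^1=H^1(\mathbb{R}^N)$ with its standard norm, $$\Phi(u)=\frac12\int_{\mathbb{R}^N}\bigl(|\nabla u|^2+Vu^2\bigr)-\int_{\mathbb{R}^N}F(u),\qquad \Sigma_\alpha=\{u\in H^1: |u|_2^2=\alpha\}\quad(\alpha>0).$$ A function $u\in\Sigma_\alpha$ is a critical point of $\Phi|_{\Sigma_\alpha}$ with Lagrange multiplier $\lambda\in\mathbb{R}$ if $\mathrm{d}\Phi(u)=\lambda\,(u,\cdot)_2$ on $H^1$, where $(\cdot,\cdot)_2$ is the $L^2$ scalar product. Such a critical point is called fully nondegenerate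 if for every $g\in H^{-1}=(H^1)^*$ there is a unique weak solution $z_g\in H^1$ of $$-\Delta z_g+(V-\lambda)z_g-f'(u)z_g=g\quad\text{in }\mathbb{R}^N,$$ and if, for $g=u$ (regarded as the functional $(u,\cdot)_2$), $\int_{\mathbb{R}^N}u\,z_u\ne 0$. For $b\in\mathbb{R}^N$ write $(\mathcal{T}_bu)(x)=u(x-b)$, and for $a=(a^1,\dots,a^n)\in(\mathbb{Z}^N)^n$ write $d(a)=\min_{i\ne j}|a^i-a^j|$. **Theorem (Multibump Solutions).** Let $\alpha>0$ and $n\ge 2$, and let $\bar u$ be a fully nondegenerate critical point of $\Phi|_{\Sigma_{\alpha/n}}$ with Lagrange multiplier $\bar\lambda$. Then there is $\varepsilon_0>0$ such that for every $\varepsilon>0$ there exists $R_\varepsilon>0$ such that for every $a\in(\mathbb{Z}^N)^n$ with $d(a)\ge R_\varepsilon$ there are $u_a\in H^1$ and $\lambda_a\in\mathbb{R}$ with the following properties. 1. $u_a$ is a critical point of $\Phi|_{\Sigma_\alpha}$ with Lagrange multiplier $\lambda_a$, and $$\Bigl\|u_a-\sum_{i=1}^n\mathcal{T}_{a^i}\bar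 u\Bigr\|_{H^1}\le\varepsilon,\qquad |\lambda_a-\bar\lambda|\le\varepsilon.$$ 2. If $\varepsilon\le\varepsilon_0$, then $(u_a,\lambda_a)$ is the only pair in $H^1\times\mathbb{R}$ with property 1. 3. If $\bar u>0$ and $f(\bar u)\ge 0$ almost everywhere on $\mathbb{R}^N$, and $f(\bar u)$ is not almost everywhere $0$, then $u_a>0$ almost everywhere on $\mathbb{R}^N$. -/

import Mathlib

open MeasureTheory Filter Topology
open scoped ENNReal ContDiff

noncomputable section

/-- Euclidean space `ℝ^N`. -/
abbrev Space (N : ℕ) : Type := EuclideanSpace ℝ (Fin N)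

/-- `g` is the weak (distributional) gradient of `u` on `ℝ^N`. -/
def HasWeakGradient {N : ℕ} (u : Space N → ℝ) (g : Space N → Space N) : Prop :=
  ∀ φ : Space N → ℝ, ContDiff ℝ ∞ φ → HasCompactSupport φ → ∀ i : Fin N,
    ∫ x, u x * fderiv ℝ φ x (EuclideanSpace.single i 1) = - ∫ x, g x i * φ x

/-- The Hilbert space of pairs of square integrable functions `ℝ^N → ℝ` and `ℝ^N → ℝ^N`,
normed by `‖(u, g)‖² = |u|₂² + |g|₂²`. -/
abbrev L2Pair (N : ℕ) : Type :=
  WithLp 2 (Lp ℝ 2 (volume : Measure (Space N)) × Lp (Space N) 2 (volume : Measure (Space N)))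

theorem integrable_mul_test {N : ℕ} (u : Lp ℝ 2 (volume : Measure (Space N)))
    {ψ : Space N → ℝ} (hψ : Continuous ψ) (hs : HasCompactSupport ψ) :
    Integrable (fun x => u x * ψ x) :=
  (Lp.memLp u).integrable_mul (q := 2) (hψ.memLp_of_hasCompactSupport hs)

theorem integrable_coord_mul_test {N : ℕ} (g : Lp (Space N) 2 (volume : Measure (Space N)))
    (i : Fin N) {ψ : Space N → ℝ} (hψ : Continuous ψ) (hs : HasCompactSupport ψ) :
    Integrable (fun x => g x i * ψ x) := by
  have h : MemLp (fun x => g x i) 2 (volume : Measure (Space N)) :=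
    (EuclideanSpace.proj (𝕜 := ℝ) i).comp_memLp' (Lp.memLp g)
  exact h.integrable_mul (q := 2) (hψ.memLp_of_hasCompactSupport hs)

theorem test_partial {N : ℕ} {φ : Space N → ℝ} (h1 : ContDiff ℝ ∞ φ) (h2 : HasCompactSupport φ)
    (i : Fin N) :
    Continuous (fun x => fderiv ℝ φ x (EuclideanSpace.single i 1)) ∧
      HasCompactSupport (fun x => fderiv ℝ φ x (EuclideanSpace.single i 1)) :=
  ⟨(h1.continuous_fderiv (by simp)).clm_apply continuous_const, h2.fderiv_apply ℝ _⟩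

/-- The real Sobolev space `H¹(ℝ^N)`: square integrable functions with square integrable weak
gradient, each stored together with its weak gradient. The inherited norm is the standard one,
`‖u‖² = |u|₂² + |∇u|₂²`. -/
def H1Sub (N : ℕ) : Submodule ℝ (L2Pair N) where
  carrier := {p | HasWeakGradient p.fst p.snd}
  zero_mem' := by
    intro φ h1 h2 i
    have e1 : ∀ᵐ x : Space N, (0 : Lp ℝ 2 (volume : Measure (Space N))) x = 0 :=
      Lp.coeFn_zero ℝ 2 volume
    have e2 : ∀ᵐ x : Space N, (0 : Lp (Space N) 2 (volume : Measure (Space N))) x = 0 :=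
      Lp.coeFn_zero (Space N) 2 volume
    rw [WithLp.zero_fst, WithLp.zero_snd,
      integral_congr_ae (g := fun _ => (0 : ℝ)) (by filter_upwards [e1] with x hx; rw [hx, zero_mul]),
      integral_congr_ae (f := fun x => _ * φ x) (g := fun _ => (0 : ℝ))
        (by filter_upwards [e2] with x hx; rw [hx, PiLp.zero_apply, zero_mul])]
    simp
  add_mem' := by
    intro p q hp hq φ h1 h2 i
    obtain ⟨c, s⟩ := test_partial h1 h2 i
    have e1 := Lp.coeFn_add p.fst q.fst
    have e2 := Lp.coeFn_add p.snd q.snd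
    rw [WithLp.add_fst, WithLp.add_snd,
      integral_congr_ae (g := fun x => p.fst x * fderiv ℝ φ x (EuclideanSpace.single i 1)
          + q.fst x * fderiv ℝ φ x (EuclideanSpace.single i 1))
        (by filter_upwards [e1] with x hx; rw [hx, Pi.add_apply, add_mul]),
      integral_congr_ae (f := fun x => _ * φ x)
        (g := fun x => p.snd x i * φ x + q.snd x i * φ x)
        (by filter_upwards [e2] with x hx; rw [hx, Pi.add_apply, PiLp.add_apply, add_mul]),
      integral_add (integrable_mul_test _ c s) (integrable_mul_test _ c s),
      integral_add (integrable_coord_mul_test _ i h1.continuous h2)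
        (integrable_coord_mul_test _ i h1.continuous h2), hp φ h1 h2 i, hq φ h1 h2 i, neg_add]
  smul_mem' := by
    intro r p hp φ h1 h2 i
    have e1 := Lp.coeFn_smul r p.fst
    have e2 := Lp.coeFn_smul r p.snd
    rw [WithLp.smul_fst, WithLp.smul_snd,
      integral_congr_ae (g := fun x => r * (p.fst x * fderiv ℝ φ x (EuclideanSpace.single i 1)))
        (by filter_upwards [e1] with x hx; simp [hx, mul_assoc]),
      integral_congr_ae (f := fun x => _ * φ x) (g := fun x => r * (p.snd x i * φ x))
        (by filter_upwards [e2] with x hx; simp [hx, mul_assoc]),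
      integral_const_mul, integral_const_mul, hp φ h1 h2 i, mul_neg]

/-- `H¹(ℝ^N)` as a type, with the norm and inner product inherited from `L2Pair N`. -/
abbrev H1 (N : ℕ) : Type := H1Sub N

namespace H1

variable {N : ℕ}

/-- The underlying `L²` class of `u ∈ H¹`. -/
def fn (u : H1 N) : Lp ℝ 2 (volume : Measure (Space N)) := u.1.fst

/-- The weak gradient of `u ∈ H¹`. -/
def grad (u : H1 N) : Lp (Space N) 2 (volume : Measure (Space N)) := u.1.snd

/-- The inclusion `H¹ → L²`, `u ↦ u`, as a bounded operator. -/
def toL2 (N : ℕ) : H1 N →L[ℝ] Lp ℝ 2 (volume : Measure (Space N)) :=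
  (WithLp.fstL 2 ℝ _ _) ∘L (H1Sub N).subtypeL

/-- The functional `w ↦ (u, w)₂` on `H¹`; this is `u` regarded as an element of `H⁻¹`. -/
def l2Dual (u : H1 N) : StrongDual ℝ (H1 N) := (innerSL ℝ u.fn) ∘L toL2 N

theorem l2Dual_apply (u w : H1 N) : l2Dual u w = ∫ x, u.fn x * w.fn x := by
  change inner ℝ u.fn w.fn = _
  rw [L2.inner_def]
  simp [mul_comm]

/-- Translation of an `L²` function: `(T_b u)(x) = u (x - b)`. -/
def translateLp {F : Type*} [NormedAddCommGroup F] (b : Space N)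
    (u : Lp F 2 (volume : Measure (Space N))) : Lp F 2 (volume : Measure (Space N)) :=
  Lp.compMeasurePreserving (fun x => x - b) (measurePreserving_sub_right volume b) u

theorem translateLp_ae {F : Type*} [NormedAddCommGroup F] (b : Space N)
    (u : Lp F 2 (volume : Measure (Space N))) :
    ∀ᵐ x, translateLp b u x = u (x - b) :=
  Lp.coeFn_compMeasurePreserving u (measurePreserving_sub_right volume b)

/-- The translation operator on `H¹`: `(T_b u)(x) = u (x - b)`. -/
def translate (b : Space N) (u : H1 N) : H1 N :=
  ⟨WithLp.toLp 2 (translateLp b u.fn, translateLp b u.grad), by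
    intro φ h1 h2 i
    have h3 : ContDiff ℝ ∞ (fun x => φ (x + b)) := h1.comp (contDiff_id.add contDiff_const)
    have h4 : HasCompactSupport (fun x => φ (x + b)) :=
      h2.comp_homeomorph (Homeomorph.addRight b)
    have key := u.2 (fun x => φ (x + b)) h3 h4 i
    change ∫ x, translateLp b u.fn x * fderiv ℝ φ x (EuclideanSpace.single i 1)
      = - ∫ x, translateLp b u.grad x i * φ x
    rw [integral_congr_ae
        (g := fun x => u.fn (x - b) * fderiv ℝ φ x (EuclideanSpace.single i 1))
        (by filter_upwards [translateLp_ae b u.fn] with x hx; rw [hx]),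
      integral_congr_ae (f := fun x => _ * φ x) (g := fun x => u.grad (x - b) i * φ x)
        (by filter_upwards [translateLp_ae b u.grad] with x hx; rw [hx]),
      ← integral_add_right_eq_self _ b, ← integral_add_right_eq_self
        (fun x => u.grad (x - b) i * φ x) b]
    simp only [add_sub_cancel_right]
    simp only [fderiv_comp_add_right] at key
    exact key⟩

end H1

/-- The superlinearity and Sobolev-subcritical growth hypothesis on the nonlinearity:
`f ∈ C¹(ℝ)`, `f(0) = f'(0) = 0`, and as `|s| → ∞` one has `f'(s) = o(|s|^(2^*-2))`,
`2^* = 2N/(N-2)`, if `N ≥ 3`, and `f'(s) = o(|s|^(p-2))` for some `p > 2` if `N ≤ 2`. -/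
structure IsAdmissible (N : ℕ) (f : ℝ → ℝ) : Prop where
  contDiff : ContDiff ℝ 1 f
  zero : f 0 = 0
  deriv_zero : deriv f 0 = 0
  growth_high : 3 ≤ N →
    Tendsto (fun s : ℝ => deriv f s / |s| ^ (2 * (N : ℝ) / ((N : ℝ) - 2) - 2))
      (cocompact ℝ) (𝓝 0)
  growth_low : N ≤ 2 → ∃ p : ℝ, 2 < p ∧
    Tendsto (fun s : ℝ => deriv f s / |s| ^ (p - 2)) (cocompact ℝ) (𝓝 0)

/-- `V` is `1`-periodic in every coordinate (as a class of functions modulo null sets). -/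
def IsOnePeriodic {N : ℕ} (V : Space N → ℝ) : Prop :=
  ∀ i : Fin N, ∀ᵐ x, V (x + EuclideanSpace.single i 1) = V x

section Functional

variable {N : ℕ} (V : Space N → ℝ) (f : ℝ → ℝ)

/-- The energy `Φ(u) = ½ ∫ (|∇u|² + V u²) - ∫ F(u)`, where `F(s) = ∫₀ˢ f`. -/
def energy (u : H1 N) : ℝ :=
  (1 / 2) * (∫ x, (‖u.grad x‖ ^ 2 + V x * u.fn x ^ 2)) - ∫ x, ∫ t in (0 : ℝ)..(u.fn x), f t

/-- The sphere `Σ_α = {u ∈ H¹ : |u|₂² = α}`. -/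
def l2Sphere (N : ℕ) (α : ℝ) : Set (H1 N) := {u | ∫ x, u.fn x ^ 2 = α}

/-- `u` is a critical point of the restriction of `Φ` to `Σ_α`, with Lagrange multiplier `lam`:
`u ∈ Σ_α` and `dΦ(u) = lam (u, ·)₂` on `H¹`. -/
def IsCriticalWith (α : ℝ) (u : H1 N) (lam : ℝ) : Prop :=
  u ∈ l2Sphere N α ∧ HasFDerivAt (energy V f) (lam • u.l2Dual) u

/-- `z ∈ H¹` is a weak solution of `-Δz + (V - lam) z - f'(u) z = g`, where `g ∈ H⁻¹`. -/
def IsLinearizedSol (u : H1 N) (lam : ℝ) (g : StrongDual ℝ (H1 N)) (z : H1 N) : Prop :=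
  ∀ w : H1 N,
    ∫ x, (inner ℝ (z.grad x) (w.grad x) + (V x - lam) * z.fn x * w.fn x
      - deriv f (u.fn x) * z.fn x * w.fn x) = g w

/-- `u` is a fully nondegenerate critical point of `Φ` restricted to `Σ_α`, with Lagrange
multiplier `lam`: the linearized equation is uniquely solvable for every `g ∈ H⁻¹`, and the
solution `z` for `g = u` satisfies `∫ u z ≠ 0`. -/
structure IsFullyNondegenerate (α : ℝ) (u : H1 N) (lam : ℝ) : Prop where
  critical : IsCriticalWith V f α u lam
  solvable : ∀ g : StrongDual ℝ (H1 N), ∃! z : H1 N, IsLinearizedSol V f u lam g z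
  transversal : ∀ z : H1 N, IsLinearizedSol V f u lam u.l2Dual z → ∫ x, u.fn x * z.fn x ≠ 0

/-- `u` is a positive function (almost everywhere, as usual for elements of `H¹`). -/
def IsPositive (u : H1 N) : Prop := ∀ᵐ x, 0 < u.fn x

end Functional

/-- A point of the lattice `ℤ^N`, regarded as a point of `ℝ^N`. -/
def latticePt {N : ℕ} (k : Fin N → ℤ) : Space N := WithLp.toLp 2 (fun i => (k i : ℝ))

/-- `∑ᵢ T_{aⁱ} u`, the sum of the translates of `u` by the lattice points `a¹, …, aⁿ`. -/
def bumpSum {N n : ℕ} (a : Fin n → Fin N → ℤ) (u : H1 N) : H1 N :=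
  ∑ i, (u.translate (latticePt (a i)))

/-- `d(a) = min_{i ≠ j} |aⁱ - aʲ|` (meaningful for at least two points). -/
def minDist {N n : ℕ} (a : Fin n → Fin N → ℤ) : ℝ :=
  ⨅ p : {p : Fin n × Fin n // p.1 ≠ p.2}, ‖latticePt (a p.1.1) - latticePt (a p.1.2)‖

end

noncomputable section

/-! ### Weak gradients, cutoffs and the Hilbert space `H¹`. -/

section

/-! Critical points on the sphere are the zeros of `G(u, λ) = (-Δu + Vu - f(u) - λu, (|u|₂² -
α)/2)`, a map from `H¹ × ℝ` to `H⁻¹ × ℝ`. Its derivative is the bordered operator `(v, μ) ↦ (Lv -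
μu, (u, v)₂)` with `L = -Δ + V - λ - f'(u)`. Full nondegeneracy of `ū` says that `L` is invertible
and that the Schur complement `(u, L⁻¹u)₂` does not vanish, that is, that the bordered operator is
invertible. The theorem is a quantitative inverse function argument at the sum `U` of the translates
of `ū`, with constants independent of the positions once the bumps are far apart.

Three facts feed it. By periodicity each translate solves the equation. Since `f` and `f'` act
almost separately on distant bumps, `U` nearly solves it, and the mass of `U` is nearly `α`
(`exists_nlMap_bumps_sub_le`, `exists_l2Form_bumps_sub_le`). The linearization at `U` is bounded
below uniformly (`exists_le_norm_form_bumps`): with wide cutoffs a function is split into pieces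
near the bumps, where the operator looks like a translate of `L`, and a remainder, where it looks
like `-Δ + V - λ`. The latter inherits the lower bound of `L`, because translating to infinity
removes the term `f'(ū)`. Finally, if `Lz = ū`, then the sum of the translates of `z` nearly solves
the corresponding equation at `U`, so the Schur complement stays away from zero
(`exists_le_norm_bordered`). Existence and uniqueness in a ball follow from
`exists_unique_constrained`.

For positivity, `ū > 0` and `f(ū) ≥ 0` make `ū` a positive supersolution of `-Δ + V - λ`, so its
quadratic form is nonnegative, and coercive because the operator is bounded below. Where a solution
`v` near `U ≥ 0` is negative, `|v| ≤ |v - U|`, so the nonlinearity is too weak there to compete with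
coercivity, and the negative part vanishes (`exists_nonneg_of_near`). A logarithmic gradient
estimate shows that the indicator of `{v > 0}` has zero weak gradient. That set is therefore null or
of full measure, and the mass constraint excludes the first case (`pos_of_nonneg`). -/

theorem gradient_coord {N : ℕ} (φ : Space N → ℝ) (x : Space N) (i : Fin N) :
    gradient φ x i = fderiv ℝ φ x (EuclideanSpace.single i 1) := by
  rw [← toDual_gradient, InnerProductSpace.toDual_apply_apply, EuclideanSpace.inner_single_right]
  simp

theorem norm_gradient {N : ℕ} (φ : Space N → ℝ) (x : Space N) :
    ‖gradient φ x‖ = ‖fderiv ℝ φ x‖ := by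
  rw [← toDual_gradient, LinearIsometryEquiv.norm_map]

theorem continuous_gradient {N : ℕ} {φ : Space N → ℝ} (h : ContDiff ℝ 1 φ) :
    Continuous (gradient φ) :=
  (InnerProductSpace.toDual ℝ (Space N)).symm.continuous.comp (h.continuous_fderiv (by simp))

theorem hasCompactSupport_gradient {N : ℕ} {φ : Space N → ℝ} (h : HasCompactSupport φ) :
    HasCompactSupport (gradient φ) := by
  refine (h.fderiv (𝕜 := ℝ)).comp_left (g := (InnerProductSpace.toDual ℝ (Space N)).symm) ?_
  simp

theorem memLp_coord {N : ℕ} {g : Space N → Space N} {p : ℝ≥0∞} (hg : MemLp g p) (i : Fin N) :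
    MemLp (fun x => g x i) p (volume : Measure (Space N)) :=
  (EuclideanSpace.proj (𝕜 := ℝ) i).comp_memLp' hg

theorem HasWeakGradient.congr_ae {N : ℕ} {u v : Space N → ℝ} {g k : Space N → Space N}
    (h : HasWeakGradient u g) (huv : u =ᵐ[volume] v) (hgk : g =ᵐ[volume] k) :
    HasWeakGradient v k := by
  intro φ h1 h2 i
  have e1 : ∫ x, u x * fderiv ℝ φ x (EuclideanSpace.single i 1)
      = ∫ x, v x * fderiv ℝ φ x (EuclideanSpace.single i 1) :=
    integral_congr_ae (by filter_upwards [huv] with x hx; rw [hx])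
  have e2 : ∫ x, g x i * φ x = ∫ x, k x i * φ x :=
    integral_congr_ae (by filter_upwards [hgk] with x hx; rw [hx])
  rw [← e1, ← e2]
  exact h φ h1 h2 i

/-- The classical gradient of a `C¹` function is its weak gradient. -/
theorem ContDiff.hasWeakGradient {N : ℕ} {v : Space N → ℝ} (hv : ContDiff ℝ 1 v) :
    HasWeakGradient v (gradient v) := by
  intro φ h1 h2 i
  obtain ⟨c, s⟩ := test_partial h1 h2 i
  simp only [gradient_coord]
  have hc : Continuous (fun x => fderiv ℝ v x (EuclideanSpace.single i 1)) :=
    (hv.continuous_fderiv (by simp)).clm_apply continuous_const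
  refine integral_mul_fderiv_eq_neg_fderiv_mul_of_integrable ?_ ?_ ?_ ?_ ?_
  · exact (hc.mul h1.continuous).integrable_of_hasCompactSupport h2.mul_left
  · exact (hv.continuous.mul c).integrable_of_hasCompactSupport s.mul_left
  · exact (hv.continuous.mul h1.continuous).integrable_of_hasCompactSupport h2.mul_left
  · exact fun x _ => hv.differentiable (by simp) x
  · exact fun x _ => h1.differentiable (by simp) x

/-- A smooth function, bounded by `B`, with gradient bounded by `κ`. -/
structure IsCutoff {N : ℕ} (χ : Space N → ℝ) (B κ : ℝ) : Prop where
  smooth : ContDiff ℝ ∞ χ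
  abs_le : ∀ x, |χ x| ≤ B
  norm_gradient_le : ∀ x, ‖gradient χ x‖ ≤ κ

theorem IsCutoff.nonneg_bound {N : ℕ} {χ : Space N → ℝ} {B κ : ℝ} (h : IsCutoff χ B κ) : 0 ≤ B :=
  (abs_nonneg _).trans (h.abs_le 0)

theorem IsCutoff.nonneg_grad {N : ℕ} {χ : Space N → ℝ} {B κ : ℝ} (h : IsCutoff χ B κ) : 0 ≤ κ :=
  (norm_nonneg _).trans (h.norm_gradient_le 0)

/-- The Leibniz rule: testing the weak gradient of `u` with `χ φ` produces all terms, and no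
regularity of `u` is needed. -/
theorem HasWeakGradient.cutoff_mul {N : ℕ} {u : Space N → ℝ} {g : Space N → Space N}
    (h : HasWeakGradient u g) (hu : MemLp u 2) (hg : MemLp g 2) {χ : Space N → ℝ}
    (hχ : ContDiff ℝ ∞ χ) :
    HasWeakGradient (fun x => χ x * u x) (fun x => χ x • g x + u x • gradient χ x) := by
  intro φ h1 h2 i
  obtain ⟨c, s⟩ := test_partial h1 h2 i
  have hχ' : Continuous (fun x => gradient χ x i) :=
    (EuclideanSpace.proj (𝕜 := ℝ) i).continuous.comp
      (continuous_gradient (hχ.of_le (by simp)))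
  have key := h (fun x => χ x * φ x) (hχ.mul h1) h2.mul_left i
  have hd : ∀ x, fderiv ℝ (fun x => χ x * φ x) x (EuclideanSpace.single i 1)
      = χ x * fderiv ℝ φ x (EuclideanSpace.single i 1) + gradient χ x i * φ x := by
    intro x
    rw [fderiv_fun_mul (hχ.differentiable (by simp) x) (h1.differentiable (by simp) x),
      gradient_coord]
    simp [mul_comm]
  have i1 : Integrable (fun x => u x * (χ x * fderiv ℝ φ x (EuclideanSpace.single i 1))) :=
    hu.integrable_mul (q := 2)
      ((hχ.continuous.mul c).memLp_of_hasCompactSupport s.mul_left)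
  have i2 : Integrable (fun x => u x * (gradient χ x i * φ x)) :=
    hu.integrable_mul (q := 2)
      ((hχ'.mul h1.continuous).memLp_of_hasCompactSupport h2.mul_left)
  have i3 : Integrable (fun x => g x i * (χ x * φ x)) :=
    (memLp_coord hg i).integrable_mul (q := 2)
      ((hχ.continuous.mul h1.continuous).memLp_of_hasCompactSupport h2.mul_left)
  have e1 : ∫ x, u x * fderiv ℝ (fun x => χ x * φ x) x (EuclideanSpace.single i 1)
      = (∫ x, u x * (χ x * fderiv ℝ φ x (EuclideanSpace.single i 1)))
        + ∫ x, u x * (gradient χ x i * φ x) := by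
    rw [← integral_add i1 i2]
    congr 1; ext x; rw [hd]; ring
  have e2 : ∫ x, (χ x • g x + u x • gradient χ x) i * φ x
      = (∫ x, g x i * (χ x * φ x)) + ∫ x, u x * (gradient χ x i * φ x) := by
    rw [← integral_add i3 i2]
    congr 1; ext x; simp; ring
  rw [e2]
  have e3 : ∫ x, χ x * u x * fderiv ℝ φ x (EuclideanSpace.single i 1)
      = ∫ x, u x * (χ x * fderiv ℝ φ x (EuclideanSpace.single i 1)) := by
    congr 1; ext x; ring
  rw [e3]
  linarith

namespace H1

variable {N : ℕ}

theorem fn_add_ae (u v : H1 N) : ∀ᵐ x, (u + v).fn x = u.fn x + v.fn x := Lp.coeFn_add u.fn v.fn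
theorem fn_sub_ae (u v : H1 N) : ∀ᵐ x, (u - v).fn x = u.fn x - v.fn x := Lp.coeFn_sub u.fn v.fn
theorem fn_zero_ae : ∀ᵐ x, (0 : H1 N).fn x = 0 := Lp.coeFn_zero ℝ 2 volume
theorem fn_smul_ae (c : ℝ) (u : H1 N) : ∀ᵐ x, (c • u).fn x = c * u.fn x := Lp.coeFn_smul c u.fn
theorem grad_add_ae (u v : H1 N) : ∀ᵐ x, (u + v).grad x = u.grad x + v.grad x :=
  Lp.coeFn_add u.grad v.grad
theorem grad_sub_ae (u v : H1 N) : ∀ᵐ x, (u - v).grad x = u.grad x - v.grad x :=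
  Lp.coeFn_sub u.grad v.grad
theorem grad_smul_ae (c : ℝ) (u : H1 N) : ∀ᵐ x, (c • u).grad x = c • u.grad x :=
  Lp.coeFn_smul c u.grad

theorem ext_fn_grad {u v : H1 N} (h1 : u.fn =ᵐ[volume] v.fn) (h2 : u.grad =ᵐ[volume] v.grad) :
    u = v := by
  apply Subtype.ext
  apply (WithLp.equiv 2 _).injective
  exact Prod.ext (Lp.ext h1) (Lp.ext h2)

theorem norm_sq_eq (u : H1 N) : ‖u‖ ^ 2 = ‖u.fn‖ ^ 2 + ‖u.grad‖ ^ 2 := by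
  rw [Submodule.coe_norm, WithLp.prod_norm_sq_eq_of_L2]; rfl

theorem norm_fn_le (u : H1 N) : ‖u.fn‖ ≤ ‖u‖ := by
  have := norm_sq_eq u
  nlinarith [norm_nonneg u, norm_nonneg u.fn, sq_nonneg ‖u.grad‖]

theorem norm_grad_le (u : H1 N) : ‖u.grad‖ ≤ ‖u‖ := by
  have := norm_sq_eq u
  nlinarith [norm_nonneg u, norm_nonneg u.grad, sq_nonneg ‖u.fn‖]

theorem norm_le (u : H1 N) : ‖u‖ ≤ ‖u.fn‖ + ‖u.grad‖ := by
  have := norm_sq_eq u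
  nlinarith [norm_nonneg u, norm_nonneg u.grad, norm_nonneg u.fn]

theorem memLp_fn (u : H1 N) : MemLp u.fn 2 (volume : Measure (Space N)) := Lp.memLp u.fn
theorem memLp_grad (u : H1 N) : MemLp u.grad 2 (volume : Measure (Space N)) := Lp.memLp u.grad
theorem aesm_fn (u : H1 N) : AEStronglyMeasurable u.fn (volume : Measure (Space N)) :=
  (memLp_fn u).1
theorem aesm_grad (u : H1 N) : AEStronglyMeasurable u.grad (volume : Measure (Space N)) :=
  (memLp_grad u).1

theorem hasWeakGradient (u : H1 N) : HasWeakGradient u.fn u.grad := u.2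

/-- The inclusion of `H¹` in `L²` forgetting everything but the gradient. -/
def gradL (N : ℕ) : H1 N →L[ℝ] Lp (Space N) 2 (volume : Measure (Space N)) :=
  (WithLp.sndL 2 ℝ _ _) ∘L (H1Sub N).subtypeL

/-- The element of `H¹` defined by a square integrable function and its weak gradient. -/
def ofFun (u : Space N → ℝ) (g : Space N → Space N) (hu : MemLp u 2) (hg : MemLp g 2)
    (h : HasWeakGradient u g) : H1 N :=
  ⟨WithLp.toLp 2 (hu.toLp u, hg.toLp g), h.congr_ae hu.coeFn_toLp.symm hg.coeFn_toLp.symm⟩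

theorem ofFun_fn {u : Space N → ℝ} {g : Space N → Space N} (hu : MemLp u 2) (hg : MemLp g 2)
    (h : HasWeakGradient u g) : ∀ᵐ x, (ofFun u g hu hg h).fn x = u x := hu.coeFn_toLp

theorem ofFun_grad {u : Space N → ℝ} {g : Space N → Space N} (hu : MemLp u 2) (hg : MemLp g 2)
    (h : HasWeakGradient u g) : ∀ᵐ x, (ofFun u g hu hg h).grad x = g x := hg.coeFn_toLp

/-- A test function as an element of `H¹`. -/
def ofTest (φ : Space N → ℝ) (h1 : ContDiff ℝ ∞ φ) (h2 : HasCompactSupport φ) : H1 N :=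
  ofFun φ (gradient φ) (h1.continuous.memLp_of_hasCompactSupport h2)
    ((continuous_gradient (h1.of_le (by simp))).memLp_of_hasCompactSupport
      (hasCompactSupport_gradient h2)) (ContDiff.hasWeakGradient (h1.of_le (by simp)))

/-- Each defining identity equates two functionals continuous on `L²`, since test functions and
their derivatives lie in `L²`. Completeness of `H¹`, needed for the open mapping theorem and the
inverse function argument, follows. -/
theorem isClosed_H1Sub (N : ℕ) : IsClosed (H1Sub N : Set (L2Pair N)) := by
  have key : ∀ (ψ : Space N → ℝ) (hψ : MemLp ψ 2 (volume : Measure (Space N))),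
      Continuous (fun u : Lp ℝ 2 (volume : Measure (Space N)) => ∫ x, u x * ψ x) := by
    intro ψ hψ
    have : (fun u : Lp ℝ 2 (volume : Measure (Space N)) => ∫ x, u x * ψ x)
        = fun u => inner ℝ (hψ.toLp ψ) u := by
      ext u
      rw [L2.inner_def]
      refine integral_congr_ae ?_
      filter_upwards [hψ.coeFn_toLp] with x hx
      simp [hx]
    rw [this]
    exact continuous_const.inner continuous_id
  have key2 : ∀ (i : Fin N) (ψ : Space N → ℝ) (hψ : MemLp ψ 2 (volume : Measure (Space N))),
      Continuous (fun g : Lp (Space N) 2 (volume : Measure (Space N)) => ∫ x, g x i * ψ x) := by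
    intro i ψ hψ
    have := (key ψ hψ).comp
      ((EuclideanSpace.proj (𝕜 := ℝ) i : Space N →L[ℝ] ℝ).compLpL 2 volume).continuous
    refine this.congr fun g => ?_
    refine integral_congr_ae ?_
    filter_upwards [(EuclideanSpace.proj (𝕜 := ℝ) i : Space N →L[ℝ] ℝ).coeFn_compLpL g] with x hx
    rw [hx]; rfl
  have : (H1Sub N : Set (L2Pair N)) = ⋂ (φ : Space N → ℝ) (_ : ContDiff ℝ ∞ φ)
      (_ : HasCompactSupport φ) (i : Fin N), {p | ∫ x, p.fst x *
        fderiv ℝ φ x (EuclideanSpace.single i 1) = - ∫ x, p.snd x i * φ x} := by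
    ext p; simp only [Set.mem_iInter]; rfl
  rw [this]
  refine isClosed_iInter fun φ => isClosed_iInter fun h1 => isClosed_iInter fun h2 =>
    isClosed_iInter fun i => isClosed_eq ?_ ?_
  · obtain ⟨c, s⟩ := test_partial h1 h2 i
    exact (key _ (c.memLp_of_hasCompactSupport s)).comp (WithLp.fstL 2 ℝ _ _).continuous
  · exact ((key2 i _ (h1.continuous.memLp_of_hasCompactSupport h2)).comp
      (WithLp.sndL 2 ℝ _ _).continuous).neg

instance : CompleteSpace (H1 N) :=
  (isClosed_H1Sub N).completeSpace_coe

theorem inner_fn (u v : H1 N) : inner ℝ u.fn v.fn = ∫ x, u.fn x * v.fn x := by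
  rw [L2.inner_def]; simp [mul_comm]

theorem inner_grad (u v : H1 N) : inner ℝ u.grad v.grad = ∫ x, inner ℝ (u.grad x) (v.grad x) :=
  L2.inner_def _ _

theorem integrable_inner_grad (u v : H1 N) :
    Integrable (fun x => inner ℝ (u.grad x) (v.grad x)) := L2.integrable_inner u.grad v.grad

theorem integrable_fn_mul (u v : H1 N) : Integrable (fun x => u.fn x * v.fn x) :=
  (memLp_fn u).integrable_mul (q := 2) (memLp_fn v)

theorem translate_fn_ae (b : Space N) (u : H1 N) : ∀ᵐ x, (u.translate b).fn x = u.fn (x - b) :=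
  translateLp_ae b u.fn
theorem translate_grad_ae (b : Space N) (u : H1 N) :
    ∀ᵐ x, (u.translate b).grad x = u.grad (x - b) :=
  translateLp_ae b u.grad

/-- Almost everywhere statements are invariant under translation. -/
theorem ae_sub {p : Space N → Prop} (h : ∀ᵐ x, p x) (b : Space N) : ∀ᵐ x, p (x - b) :=
  (measurePreserving_sub_right volume b).quasiMeasurePreserving.ae h

theorem norm_translate (b : Space N) (u : H1 N) : ‖u.translate b‖ = ‖u‖ := by
  have h1 : ‖(u.translate b).fn‖ = ‖u.fn‖ := Lp.norm_compMeasurePreserving _ _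
  have h2 : ‖(u.translate b).grad‖ = ‖u.grad‖ := Lp.norm_compMeasurePreserving _ _
  have := norm_sq_eq u
  have h3 := norm_sq_eq (u.translate b)
  rw [h1, h2, ← this] at h3
  exact (sq_eq_sq₀ (norm_nonneg _) (norm_nonneg _)).1 h3

theorem translate_sub (b : Space N) (u v : H1 N) :
    (u - v).translate b = u.translate b - v.translate b := by
  apply Subtype.ext
  apply (WithLp.equiv 2 _).injective
  refine Prod.ext ?_ ?_
  · exact map_sub (Lp.compMeasurePreserving _ (measurePreserving_sub_right volume b)) u.fn v.fn
  · exact map_sub (Lp.compMeasurePreserving _ (measurePreserving_sub_right volume b)) u.grad v.grad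

theorem translate_translate (b c : Space N) (u : H1 N) :
    (u.translate b).translate c = u.translate (b + c) := by
  refine ext_fn_grad ?_ ?_
  · filter_upwards [translate_fn_ae c (u.translate b), ae_sub (translate_fn_ae b u) c,
      translate_fn_ae (b + c) u] with x h1 h2 h3
    rw [h1, h2, h3]; congr 1; abel
  · filter_upwards [translate_grad_ae c (u.translate b), ae_sub (translate_grad_ae b u) c,
      translate_grad_ae (b + c) u] with x h1 h2 h3
    rw [h1, h2, h3]; congr 1; abel

theorem translate_zero (u : H1 N) : u.translate 0 = u := by
  refine ext_fn_grad ?_ ?_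
  · filter_upwards [translate_fn_ae 0 u] with x h1; rw [h1, sub_zero]
  · filter_upwards [translate_grad_ae 0 u] with x h1; rw [h1, sub_zero]

/-- The product of a function in `H¹` with a cutoff function. -/
def mulCutoff {χ : Space N → ℝ} {B κ : ℝ} (h : IsCutoff χ B κ) (u : H1 N) : H1 N :=
  ofFun (fun x => χ x * u.fn x) (fun x => χ x • u.grad x + u.fn x • gradient χ x)
    ((memLp_fn u).of_le_mul (c := B) (h.smooth.continuous.aestronglyMeasurable.mul (aesm_fn u))
      (Eventually.of_forall fun x => by
        rw [norm_mul]; exact mul_le_mul_of_nonneg_right (h.abs_le x) (norm_nonneg _)))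
    (((memLp_grad u).of_le_mul (c := B)
      (h.smooth.continuous.aestronglyMeasurable.smul (aesm_grad u))
      (Eventually.of_forall fun x => by
        change ‖χ x • u.grad x‖ ≤ _; rw [norm_smul]; exact mul_le_mul_of_nonneg_right (h.abs_le x) (norm_nonneg _))).add
      ((memLp_fn u).of_le_mul (c := κ) ((aesm_fn u).smul
        (continuous_gradient (h.smooth.of_le (by simp))).aestronglyMeasurable)
      (Eventually.of_forall fun x => by
        rw [norm_smul, mul_comm]
        exact mul_le_mul_of_nonneg_right (h.norm_gradient_le x) (norm_nonneg _))))
    ((hasWeakGradient u).cutoff_mul (memLp_fn u) (memLp_grad u) h.smooth)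

section mulCutoff

variable {χ : Space N → ℝ} {B κ : ℝ} (h : IsCutoff χ B κ)

theorem mulCutoff_fn (u : H1 N) : ∀ᵐ x, (mulCutoff h u).fn x = χ x * u.fn x := ofFun_fn _ _ _
theorem mulCutoff_grad (u : H1 N) :
    ∀ᵐ x, (mulCutoff h u).grad x = χ x • u.grad x + u.fn x • gradient χ x := ofFun_grad _ _ _

theorem norm_mulCutoff_le (u : H1 N) : ‖mulCutoff h u‖ ≤ (2 * B + κ) * ‖u‖ := by
  have h1 : ‖(mulCutoff h u).fn‖ ≤ B * ‖u.fn‖ := by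
    refine Lp.norm_le_mul_norm_of_ae_le_mul ?_
    filter_upwards [mulCutoff_fn h u] with x hx
    rw [hx, norm_mul]; exact mul_le_mul_of_nonneg_right (h.abs_le x) (norm_nonneg _)
  have h2 : ‖(mulCutoff h u).grad‖ ≤ B * ‖u.grad‖ + κ * ‖u.fn‖ := by
    have e1 : MemLp (fun x => χ x • u.grad x) 2 volume := (memLp_grad u).of_le_mul (c := B)
      (h.smooth.continuous.aestronglyMeasurable.smul (aesm_grad u))
      (Eventually.of_forall fun x => by
        rw [norm_smul]; exact mul_le_mul_of_nonneg_right (h.abs_le x) (norm_nonneg _))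
    have e2 : MemLp (fun x => u.fn x • gradient χ x) 2 volume :=
      (memLp_fn u).of_le_mul (c := κ) ((aesm_fn u).smul
        (continuous_gradient (h.smooth.of_le (by simp))).aestronglyMeasurable)
      (Eventually.of_forall fun x => by
        rw [norm_smul, mul_comm]
        exact mul_le_mul_of_nonneg_right (h.norm_gradient_le x) (norm_nonneg _))
    have : (mulCutoff h u).grad = e1.toLp _ + e2.toLp _ := rfl
    rw [this]
    refine (norm_add_le _ _).trans (add_le_add ?_ ?_)
    · refine Lp.norm_le_mul_norm_of_ae_le_mul ?_
      filter_upwards [e1.coeFn_toLp] with x hx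
      rw [hx, norm_smul]; exact mul_le_mul_of_nonneg_right (h.abs_le x) (norm_nonneg _)
    · refine Lp.norm_le_mul_norm_of_ae_le_mul ?_
      filter_upwards [e2.coeFn_toLp] with x hx
      rw [hx, norm_smul, mul_comm]
      exact mul_le_mul_of_nonneg_right (h.norm_gradient_le x) (norm_nonneg _)
  have := norm_le (mulCutoff h u)
  have hB := h.nonneg_bound
  have hk := h.nonneg_grad
  nlinarith [mul_le_mul_of_nonneg_left (norm_fn_le u) hB, mul_le_mul_of_nonneg_left (norm_grad_le u) hB,
    mul_le_mul_of_nonneg_left (norm_fn_le u) hk]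

end mulCutoff

end H1

end

/-! ### Mollification in `L²`. -/

section

theorem eLpNorm_two_sq {α E : Type*} [MeasurableSpace α] [NormedAddCommGroup E] (μ : Measure α)
    (f : α → E) : eLpNorm f 2 μ ^ 2 = ∫⁻ x, ‖f x‖ₑ ^ 2 ∂μ := by
  rw [eLpNorm_eq_lintegral_rpow_enorm_toReal (by simp) (by simp), ← ENNReal.rpow_natCast,
    ← ENNReal.rpow_mul]
  simp

theorem eLpNorm_two_le_iff {α E : Type*} [MeasurableSpace α] [NormedAddCommGroup E] (μ : Measure α)
    (f : α → E) (c : ℝ≥0∞) : eLpNorm f 2 μ ≤ c ↔ ∫⁻ x, ‖f x‖ₑ ^ 2 ∂μ ≤ c ^ 2 := by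
  rw [← eLpNorm_two_sq]
  exact ⟨fun h => by gcongr, fun h => (ENNReal.pow_le_pow_left_iff two_ne_zero).1 h⟩

/-- Cauchy–Schwarz after splitting the weight as `√r · √r`. For a weight of total mass one it is
Jensen's inequality for the square. -/
theorem lintegral_mul_sq_le {α : Type*} [MeasurableSpace α] {μ : Measure α} {r g : α → ℝ≥0∞}
    (hr : AEMeasurable r μ) (hg : AEMeasurable g μ) :
    (∫⁻ x, r x * g x ∂μ) ^ 2 ≤ (∫⁻ x, r x ∂μ) * ∫⁻ x, r x * g x ^ 2 ∂μ := by
  have h := ENNReal.lintegral_mul_le_Lp_mul_Lq μ Real.HolderConjugate.two_two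
    (f := fun x => r x ^ (1 / 2 : ℝ)) (g := fun x => r x ^ (1 / 2 : ℝ) * g x)
    (hr.pow_const _) ((hr.pow_const _).mul hg)
  have e1 : ∀ x, ((fun x => r x ^ (1 / 2 : ℝ)) * fun x => r x ^ (1 / 2 : ℝ) * g x) x
      = r x * g x := by
    intro x
    simp only [Pi.mul_apply]
    rw [← mul_assoc, ← ENNReal.rpow_add_of_nonneg _ _ (by norm_num) (by norm_num)]
    norm_num
  have e2 : ∀ x, (r x ^ (1 / 2 : ℝ)) ^ (2 : ℝ) = r x := by
    intro x; rw [← ENNReal.rpow_mul]; norm_num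
  have e3 : ∀ x, (r x ^ (1 / 2 : ℝ) * g x) ^ (2 : ℝ) = r x * g x ^ 2 := by
    intro x; rw [ENNReal.mul_rpow_of_nonneg _ _ (by norm_num), e2]; norm_num
  simp only [e1, e2, e3] at h
  calc (∫⁻ x, r x * g x ∂μ) ^ 2
      ≤ ((∫⁻ x, r x ∂μ) ^ (1 / 2 : ℝ) * (∫⁻ x, r x * g x ^ 2 ∂μ) ^ (1 / 2 : ℝ)) ^ 2 := by gcongr
    _ = _ := by
      rw [mul_pow, ← ENNReal.rpow_natCast, ← ENNReal.rpow_natCast, ← ENNReal.rpow_mul,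
        ← ENNReal.rpow_mul]
      norm_num

section Mollify

variable {N : ℕ} {F : Type*} [NormedAddCommGroup F] [NormedSpace ℝ F]

/-- The mollification of `u` by a normalized bump function. -/
def mollify (ρ : ContDiffBump (0 : Space N)) (u : Space N → F) : Space N → F :=
  convolution (ρ.normed volume) u (ContinuousLinearMap.lsmul ℝ ℝ) volume

theorem mollify_apply (ρ : ContDiffBump (0 : Space N)) (u : Space N → F) (x : Space N) :
    mollify ρ u x = ∫ t, ρ.normed volume t • u (x - t) := rfl

theorem mollify_apply_swap (ρ : ContDiffBump (0 : Space N)) (u : Space N → F) (x : Space N) :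
    mollify ρ u x = ∫ t, ρ.normed volume (x - t) • u t := convolution_lsmul_swap

theorem mollify_integrable (ρ : ContDiffBump (0 : Space N)) {u : Space N → F}
    (hu : LocallyIntegrable u volume) (x : Space N) :
    Integrable (fun t => ρ.normed volume t • u (x - t)) :=
  ρ.hasCompactSupport_normed.convolutionExists_left (ContinuousLinearMap.lsmul ℝ ℝ)
    ρ.continuous_normed hu x

theorem lintegral_bump (ρ : ContDiffBump (0 : Space N)) :
    ∫⁻ t, ENNReal.ofReal (ρ.normed volume t) = 1 := by
  rw [← ofReal_integral_eq_lintegral_ofReal ρ.integrable_normed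
    (Eventually.of_forall fun t => ρ.nonneg_normed t), ρ.integral_normed, ENNReal.ofReal_one]

theorem enorm_mollify_sub_sq_le [CompleteSpace F] (ρ : ContDiffBump (0 : Space N)) {u : Space N → F}
    (hu : LocallyIntegrable u volume) (x : Space N) :
    ‖mollify ρ u x - u x‖ₑ ^ 2
      ≤ ∫⁻ t, ENNReal.ofReal (ρ.normed volume t) * ‖u (x - t) - u x‖ₑ ^ 2 := by
  have h1 : mollify ρ u x - u x = ∫ t, ρ.normed volume t • (u (x - t) - u x) := by
    simp only [smul_sub]
    rw [integral_sub (mollify_integrable ρ hu x) (ρ.integrable_normed.smul_const _),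
      integral_smul_const, ρ.integral_normed, one_smul, mollify_apply]
  have h2 : ‖mollify ρ u x - u x‖ₑ
      ≤ ∫⁻ t, ENNReal.ofReal (ρ.normed volume t) * ‖u (x - t) - u x‖ₑ := by
    rw [h1]
    refine (enorm_integral_le_lintegral_enorm _).trans (lintegral_mono fun t => ?_)
    rw [enorm_smul, Real.enorm_eq_ofReal (ρ.nonneg_normed t)]
  have hm : AEStronglyMeasurable (fun t => u (x - t) - u x) volume :=
    (hu.aestronglyMeasurable.comp_quasiMeasurePreserving
      (quasiMeasurePreserving_sub_left volume x)).sub aestronglyMeasurable_const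
  calc _ ≤ (∫⁻ t, ENNReal.ofReal (ρ.normed volume t) * ‖u (x - t) - u x‖ₑ) ^ 2 := by gcongr
    _ ≤ _ := by
      refine (lintegral_mul_sq_le ?_ hm.enorm).trans_eq ?_
      · exact ρ.continuous_normed.measurable.ennreal_ofReal.aemeasurable
      · rw [lintegral_bump, one_mul]

/-- A mollification averages translates of `u` by vectors of length less than `rOut`, and
translation is continuous in `L²`. Jensen's inequality and Tonelli's theorem turn closeness of the
translates into closeness of the average. -/
theorem exists_eLpNorm_mollify_sub_le [CompleteSpace F] {u : Space N → F} (hu : MemLp u 2 volume)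
    {η : ℝ} (hη : 0 < η) :
    ∃ δ > 0, ∀ ρ : ContDiffBump (0 : Space N), ρ.rOut ≤ δ →
      eLpNorm (mollify ρ u - u) 2 volume ≤ ENNReal.ofReal η := by
  have hcont : Continuous (fun t : Space N => H1.translateLp t (hu.toLp u)) := by
    have hg : Continuous (fun t : Space N => (⟨fun x => x - t, by fun_prop⟩ : C(Space N, Space N))) :=
      ContinuousMap.continuous_of_continuous_uncurry _ (continuous_snd.sub continuous_fst)
    exact Continuous.compMeasurePreservingLp (f := fun _ : Space N => hu.toLp u) continuous_const hg
      (fun t => measurePreserving_sub_right volume t) (by simp)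
  have h0 : H1.translateLp 0 (hu.toLp u) = hu.toLp u := by
    apply Lp.ext
    filter_upwards [H1.translateLp_ae 0 (hu.toLp u)] with x hx
    rw [hx, sub_zero]
  obtain ⟨δ, hδ, h⟩ := Metric.continuous_iff.1 hcont 0 η hη
  refine ⟨δ / 2, by positivity, fun ρ hρ => ?_⟩
  have hloc : LocallyIntegrable u volume := hu.locallyIntegrable (by norm_num)
  have ht : ∀ t : Space N, dist t 0 < δ →
      ∫⁻ x, ‖u (x - t) - u x‖ₑ ^ 2 ≤ ENNReal.ofReal η ^ 2 := by
    intro t ht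
    rw [← eLpNorm_two_le_iff]
    have h3 := h t ht
    rw [h0, Lp.dist_def] at h3
    have h4 : eLpNorm (fun x => u (x - t) - u x) 2 volume
        = eLpNorm (H1.translateLp t (hu.toLp u) - hu.toLp u : Space N → F) 2 volume := by
      refine eLpNorm_congr_ae ?_
      filter_upwards [H1.translateLp_ae t (hu.toLp u), hu.coeFn_toLp,
        H1.ae_sub hu.coeFn_toLp t] with x h5 h6 h7
      rw [Pi.sub_apply, h5, h6, h7]
    rw [h4]
    refine (ENNReal.le_ofReal_iff_toReal_le ?_ hη.le).2 h3.le
    rw [← h4]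
    exact ((hu.comp_measurePreserving (measurePreserving_sub_right volume t)).sub hu).eLpNorm_ne_top
  rw [eLpNorm_two_le_iff]
  have hm : AEMeasurable (Function.uncurry fun x t : Space N =>
      ENNReal.ofReal (ρ.normed volume t) * ‖u (x - t) - u x‖ₑ ^ 2)
      ((volume : Measure (Space N)).prod volume) := by
    have m1 : AEStronglyMeasurable (fun p : Space N × Space N => u (p.1 - p.2))
        ((volume : Measure (Space N)).prod volume) :=
      hu.1.comp_quasiMeasurePreserving (quasiMeasurePreserving_sub volume volume)
    have m2 : AEStronglyMeasurable (fun p : Space N × Space N => u p.1)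
        ((volume : Measure (Space N)).prod volume) :=
      hu.1.comp_quasiMeasurePreserving Measure.quasiMeasurePreserving_fst
    exact ((ρ.continuous_normed.measurable.comp measurable_snd).ennreal_ofReal.aemeasurable).mul
      ((m1.sub m2).enorm.pow_const 2)
  calc ∫⁻ x, ‖(mollify ρ u - u) x‖ₑ ^ 2
      ≤ ∫⁻ x, ∫⁻ t, ENNReal.ofReal (ρ.normed volume t) * ‖u (x - t) - u x‖ₑ ^ 2 :=
        lintegral_mono fun x => enorm_mollify_sub_sq_le ρ hloc x
    _ = ∫⁻ t, ∫⁻ x, ENNReal.ofReal (ρ.normed volume t) * ‖u (x - t) - u x‖ₑ ^ 2 :=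
        lintegral_lintegral_swap hm
    _ ≤ ∫⁻ t, ENNReal.ofReal (ρ.normed volume t) * ENNReal.ofReal η ^ 2 := by
        refine lintegral_mono fun t => ?_
        simp only
        rw [lintegral_const_mul' _ _ ENNReal.ofReal_ne_top]
        by_cases hh : dist t 0 < δ
        · gcongr; exact ht t hh
        · have : ρ.normed volume t = 0 := by
            have : t ∉ Function.support (ρ.normed volume) := by
              rw [ρ.support_normed_eq, Metric.mem_ball]
              intro h5
              linarith
            simpa using this
          simp [this]
    _ = ENNReal.ofReal η ^ 2 := by
        rw [lintegral_mul_const _ ρ.continuous_normed.measurable.ennreal_ofReal, lintegral_bump,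
          one_mul]

theorem contDiff_mollify [CompleteSpace F] (ρ : ContDiffBump (0 : Space N)) {u : Space N → F}
    (hu : LocallyIntegrable u volume) : ContDiff ℝ ∞ (mollify ρ u) :=
  ρ.hasCompactSupport_normed.contDiff_convolution_left _ ρ.contDiff_normed hu

/-- The gradient of the mollification of a function is the mollification of its weak gradient. -/
theorem gradient_mollify (ρ : ContDiffBump (0 : Space N)) {u : Space N → ℝ}
    {g : Space N → Space N} (hu : LocallyIntegrable u volume) (hg : LocallyIntegrable g volume)
    (h : HasWeakGradient u g) (x : Space N) :
    gradient (mollify ρ u) x = mollify ρ g x := by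
  ext i
  rw [gradient_coord]
  have hρ : ContDiff ℝ ∞ (ρ.normed volume) := ρ.contDiff_normed
  have h1 := (ρ.hasCompactSupport_normed (μ := volume)).hasFDerivAt_convolution_left
    (ContinuousLinearMap.lsmul ℝ ℝ) (μ := volume) ρ.contDiff_normed hu x
  have h2 : fderiv ℝ (mollify ρ u) x (EuclideanSpace.single i 1)
      = ∫ t, fderiv ℝ (ρ.normed volume) (x - t) (EuclideanSpace.single i 1) * u t := by
    unfold mollify
    rw [h1.fderiv, convolution_eq_swap, ContinuousLinearMap.integral_apply]
    · rfl
    · have := (ρ.hasCompactSupport_normed (μ := volume)).fderiv (𝕜 := ℝ)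
        |>.convolutionExists_left ((ContinuousLinearMap.lsmul ℝ ℝ).precompL (Space N))
          (hρ.continuous_fderiv (by simp)) hu x
      exact this.integrable_swap
  have hφ : ContDiff ℝ ∞ (fun t => ρ.normed volume (x - t)) :=
    hρ.comp (contDiff_const.sub contDiff_id)
  have hφc : HasCompactSupport (fun t => ρ.normed volume (x - t)) :=
    (ρ.hasCompactSupport_normed (μ := volume)).comp_homeomorph (Homeomorph.subLeft x)
  have h3 := h _ hφ hφc i
  have h4 : ∀ t, fderiv ℝ (fun t => ρ.normed volume (x - t)) t (EuclideanSpace.single i 1)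
      = - fderiv ℝ (ρ.normed volume) (x - t) (EuclideanSpace.single i 1) := by
    intro t
    have : HasFDerivAt (fun t => ρ.normed volume (x - t))
        ((fderiv ℝ (ρ.normed volume) (x - t)).comp (-(ContinuousLinearMap.id ℝ (Space N)))) t :=
      HasFDerivAt.comp t (hρ.differentiable (by simp) (x - t)).hasFDerivAt
        ((hasFDerivAt_id t).const_sub x)
    rw [this.fderiv]; simp
  have h5 : mollify ρ g x i = ∫ t, g t i * ρ.normed volume (x - t) := by
    rw [mollify_apply_swap]
    have hint : Integrable (fun t => ρ.normed volume (x - t) • g t) :=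
      ((ρ.hasCompactSupport_normed (μ := volume)).convolutionExists_left
        (ContinuousLinearMap.lsmul ℝ ℝ) ρ.continuous_normed hg x).integrable_swap
    have := (EuclideanSpace.proj (𝕜 := ℝ) i : Space N →L[ℝ] ℝ).integral_comp_comm hint
    refine this.symm.trans (integral_congr_ae (Eventually.of_forall fun t => ?_))
    exact mul_comm _ _
  rw [h2, h5]
  simp only [h4, mul_neg, integral_neg] at h3
  have h6 := neg_injective h3
  rw [← h6]
  congr 1; ext t; ring

end Mollify

theorem tendsto_eLpNorm_two_of_dominated {α E : Type*} [MeasurableSpace α] [NormedAddCommGroup E]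
    {μ : Measure α} {f : ℕ → α → E} {G : α → ℝ} (hf : ∀ k, AEStronglyMeasurable (f k) μ)
    (hG : MemLp G 2 μ) (hb : ∀ k, ∀ᵐ x ∂μ, ‖f k x‖ ≤ G x)
    (hlim : ∀ᵐ x ∂μ, Tendsto (fun k => f k x) atTop (𝓝 0)) :
    Tendsto (fun k => eLpNorm (f k) 2 μ) atTop (𝓝 0) := by
  have h1 : Tendsto (fun k => ∫⁻ x, ‖f k x‖ₑ ^ 2 ∂μ) atTop (𝓝 (∫⁻ _, 0 ∂μ)) := by
    refine tendsto_lintegral_of_dominated_convergence' (fun x => ‖G x‖ₑ ^ 2)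
      (fun k => (hf k).enorm.pow_const 2) (fun k => ?_) ?_ ?_
    · filter_upwards [hb k] with x hx
      gcongr
      rw [← ofReal_norm, ← ofReal_norm]
      exact ENNReal.ofReal_le_ofReal (hx.trans (le_abs_self _))
    · rw [← eLpNorm_two_sq]; exact ENNReal.pow_ne_top hG.eLpNorm_ne_top
    · filter_upwards [hlim] with x hx
      have := (ENNReal.continuous_pow 2).tendsto _ |>.comp hx.enorm
      simpa [Function.comp_def] using this
  have h2 : Tendsto (fun k => (∫⁻ x, ‖f k x‖ₑ ^ 2 ∂μ) ^ (1 / 2 : ℝ)) atTop (𝓝 0) := by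
    have := ENNReal.continuous_rpow_const (y := (1 / 2 : ℝ)) |>.tendsto _ |>.comp h1
    simpa [Function.comp_def] using this
  refine h2.congr fun k => ?_
  rw [eLpNorm_eq_lintegral_rpow_enorm_toReal (by simp) (by simp)]
  simp

end

/-! ### Cutoffs and density of test functions in `H¹`. -/

section

section Cutoffs

variable {N : ℕ}

/-- A bump function equal to `1` on the unit ball and vanishing outside of the ball of radius 2. -/
def unitBump (N : ℕ) : ContDiffBump (0 : Space N) := ⟨1, 2, by norm_num, by norm_num⟩

/-- The rescaled bump function at `a`, equal to `1` on the ball of radius `r` and vanishing outside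
of the ball of radius `2 r`. -/
def ballCutoff (a : Space N) (r : ℝ) : Space N → ℝ := fun x => unitBump N (r⁻¹ • (x - a))

/-- A bound for the gradient of `unitBump`. -/
def bumpConst (N : ℕ) : ℝ :=
  ((((unitBump N).contDiff (n := ⊤)).continuous_fderiv (by simp)).bounded_above_of_compact_support
    ((unitBump N).hasCompactSupport.fderiv (𝕜 := ℝ))).choose

theorem norm_fderiv_unitBump_le (x : Space N) : ‖fderiv ℝ (unitBump N) x‖ ≤ bumpConst N :=
  ((((unitBump N).contDiff (n := ⊤)).continuous_fderiv (by simp)).bounded_above_of_compact_support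
    ((unitBump N).hasCompactSupport.fderiv (𝕜 := ℝ))).choose_spec x

theorem bumpConst_nonneg (N : ℕ) : 0 ≤ bumpConst N :=
  (norm_nonneg _).trans (norm_fderiv_unitBump_le 0)

theorem isCutoff_ballCutoff (a : Space N) {r : ℝ} (hr : 0 < r) :
    IsCutoff (ballCutoff a r) 1 (bumpConst N / r) where
  smooth := (unitBump N).contDiff.comp ((contDiff_id.sub contDiff_const).const_smul r⁻¹)
  abs_le x := by
    rw [ballCutoff, abs_of_nonneg (unitBump N).nonneg]; exact (unitBump N).le_one
  norm_gradient_le x := by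
    rw [norm_gradient]
    have : HasFDerivAt (ballCutoff a r)
        ((fderiv ℝ (unitBump N) (r⁻¹ • (x - a))).comp (r⁻¹ • (ContinuousLinearMap.id ℝ (Space N))))
        x :=
      HasFDerivAt.comp x (((unitBump N).contDiff (n := ⊤)).differentiable (by simp)
        (r⁻¹ • (x - a))).hasFDerivAt (((hasFDerivAt_id x).sub_const a).const_smul r⁻¹)
    rw [this.fderiv, ContinuousLinearMap.comp_smul, ContinuousLinearMap.comp_id, norm_smul,
      Real.norm_of_nonneg (by positivity), div_eq_inv_mul]
    gcongr
    exact norm_fderiv_unitBump_le _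

theorem ballCutoff_eq_one {a x : Space N} {r : ℝ} (hr : 0 < r) (h : ‖x - a‖ ≤ r) :
    ballCutoff a r x = 1 := by
  apply (unitBump N).one_of_mem_closedBall
  rw [mem_closedBall_zero_iff, norm_smul, Real.norm_of_nonneg (by positivity)]
  change r⁻¹ * _ ≤ 1
  rw [inv_mul_le_iff₀ hr]; linarith

theorem ballCutoff_eq_zero {a x : Space N} {r : ℝ} (hr : 0 < r) (h : 2 * r ≤ ‖x - a‖) :
    ballCutoff a r x = 0 := by
  apply (unitBump N).zero_of_le_dist
  rw [dist_zero_right, norm_smul, Real.norm_of_nonneg (by positivity)]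
  change 2 ≤ r⁻¹ * _
  rw [le_inv_mul_iff₀ hr]; linarith

theorem hasCompactSupport_ballCutoff (a : Space N) {r : ℝ} (hr : 0 < r) :
    HasCompactSupport (ballCutoff a r) := by
  refine HasCompactSupport.of_support_subset_isCompact (isCompact_closedBall a (2 * r)) ?_
  intro x hx
  rw [Metric.mem_closedBall, dist_eq_norm]
  by_contra! h
  exact hx (ballCutoff_eq_zero hr h.le)

end Cutoffs

namespace H1

variable {N : ℕ}

theorem enorm_Lp_eq {F : Type*} [NormedAddCommGroup F]
    (u : Lp F 2 (volume : Measure (Space N))) : ‖u‖ = (eLpNorm u 2 volume).toReal := rfl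

theorem norm_Lp_le_of_ae {F : Type*} [NormedAddCommGroup F]
    (u : Lp F 2 (volume : Measure (Space N))) {v : Space N → F} (h : u =ᵐ[volume] v) {c : ℝ}
    (hc : 0 ≤ c) (hv : eLpNorm v 2 volume ≤ ENNReal.ofReal c) : ‖u‖ ≤ c := by
  rw [enorm_Lp_eq, eLpNorm_congr_ae h]
  exact ENNReal.toReal_le_of_le_ofReal hc hv

/-- Convergence in `H¹` from convergence of the components in `L²`. -/
theorem tendsto_of_eLpNorm {u : ℕ → H1 N} {v : H1 N}
    (h1 : Tendsto (fun k => eLpNorm (fun x => (u k).fn x - v.fn x) 2 volume) atTop (𝓝 0))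
    (h2 : Tendsto (fun k => eLpNorm (fun x => (u k).grad x - v.grad x) 2 volume) atTop (𝓝 0)) :
    Tendsto u atTop (𝓝 v) := by
  rw [tendsto_iff_norm_sub_tendsto_zero]
  have e1 : Tendsto (fun k => ‖(u k - v).fn‖) atTop (𝓝 0) := by
    have := (ENNReal.tendsto_toReal (by simp)).comp h1
    refine (this.congr fun k => ?_)
    have e : (fun x => (u k).fn x - v.fn x) =ᵐ[volume] (u k - v).fn := by
      filter_upwards [fn_sub_ae (u k) v] with x hx using hx.symm
    rw [enorm_Lp_eq, Function.comp_apply, eLpNorm_congr_ae e]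
  have e2 : Tendsto (fun k => ‖(u k - v).grad‖) atTop (𝓝 0) := by
    have := (ENNReal.tendsto_toReal (by simp)).comp h2
    refine (this.congr fun k => ?_)
    have e : (fun x => (u k).grad x - v.grad x) =ᵐ[volume] (u k - v).grad := by
      filter_upwards [grad_sub_ae (u k) v] with x hx using hx.symm
    rw [enorm_Lp_eq, Function.comp_apply, eLpNorm_congr_ae e]
  refine squeeze_zero (fun k => norm_nonneg _) (fun k => norm_le _) ?_
  simpa using e1.add e2

/-- Convergence in `H¹` implies convergence of the components in `L²`. -/
theorem tendsto_eLpNorm_fn {u : ℕ → H1 N} {v : H1 N} (h : Tendsto u atTop (𝓝 v)) :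
    Tendsto (fun k => eLpNorm (fun x => (u k).fn x - v.fn x) 2 volume) atTop (𝓝 0) := by
  have h1 : Tendsto (fun k => (u k).fn) atTop (𝓝 v.fn) := ((toL2 N).continuous.tendsto v).comp h
  exact (Lp.tendsto_Lp_iff_tendsto_eLpNorm' _ _).1 h1

theorem tendsto_eLpNorm_grad {u : ℕ → H1 N} {v : H1 N} (h : Tendsto u atTop (𝓝 v)) :
    Tendsto (fun k => eLpNorm (fun x => (u k).grad x - v.grad x) 2 volume) atTop (𝓝 0) := by
  have h1 : Tendsto (fun k => (u k).grad) atTop (𝓝 v.grad) :=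
    ((gradL N).continuous.tendsto v).comp h
  exact (Lp.tendsto_Lp_iff_tendsto_eLpNorm' _ _).1 h1

/-- A convergent sequence in `H¹` has a subsequence converging almost everywhere. -/
theorem exists_subseq_ae {u : ℕ → H1 N} {v : H1 N} (h : Tendsto u atTop (𝓝 v)) :
    ∃ ns : ℕ → ℕ, StrictMono ns ∧ ∀ᵐ x, Tendsto (fun k => (u (ns k)).fn x) atTop (𝓝 (v.fn x)) :=
  (tendstoInMeasure_of_tendsto_eLpNorm (by simp) (fun k => aesm_fn (u k)) (aesm_fn v)
    (tendsto_eLpNorm_fn h)).exists_seq_tendsto_ae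

theorem abs_ballCutoff_le_one (a : Space N) (r : ℝ) (x : Space N) : |ballCutoff a r x| ≤ 1 := by
  rw [ballCutoff, abs_of_nonneg (unitBump N).nonneg]; exact (unitBump N).le_one

theorem ballCutoff_nonneg (a : Space N) (r : ℝ) (x : Space N) : 0 ≤ ballCutoff a r x :=
  (unitBump N).nonneg

theorem tendsto_ballCutoff (x : Space N) :
    Tendsto (fun k : ℕ => ballCutoff (0 : Space N) (k + 1) x) atTop (𝓝 1) := by
  refine tendsto_const_nhds.congr' ?_
  obtain ⟨K, hK⟩ := exists_nat_ge ‖x‖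
  filter_upwards [eventually_ge_atTop K] with k hk
  rw [ballCutoff_eq_one (by positivity)]
  have : (K : ℝ) ≤ k := by exact_mod_cast hk
  rw [sub_zero]; linarith

theorem tendsto_mulCutoff (u : H1 N) :
    Tendsto (fun k : ℕ => mulCutoff (isCutoff_ballCutoff (0 : Space N) (Nat.cast_add_one_pos k)) u)
      atTop (𝓝 u) := by
  have hc : ∀ k : ℕ, Continuous (ballCutoff (0 : Space N) (k + 1)) := fun k =>
    (isCutoff_ballCutoff (0 : Space N) (Nat.cast_add_one_pos k)).smooth.continuous
  have hb : ∀ (k : ℕ) (x : Space N), |ballCutoff (0 : Space N) (k + 1) x - 1| ≤ 1 := by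
    intro k x
    have h1 := ballCutoff_nonneg (0 : Space N) (k + 1) x
    have h2 := (abs_le.1 (abs_ballCutoff_le_one (0 : Space N) (k + 1) x)).2
    rw [abs_le]; constructor <;> linarith
  refine tendsto_of_eLpNorm ?_ ?_
  · have := tendsto_eLpNorm_two_of_dominated (μ := (volume : Measure (Space N)))
      (f := fun k x => (ballCutoff (0 : Space N) (k + 1) x - 1) * u.fn x) (G := fun x => ‖u.fn x‖)
      (fun k => ((hc k).aestronglyMeasurable.sub aestronglyMeasurable_const).mul (aesm_fn u))
      (memLp_fn u).norm (fun k => Eventually.of_forall fun x => by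
        rw [norm_mul]; exact mul_le_of_le_one_left (norm_nonneg _) (hb k x))
      (Eventually.of_forall fun x => by
        simpa using ((tendsto_ballCutoff x).sub_const 1).mul_const (u.fn x))
    refine this.congr fun k => eLpNorm_congr_ae ?_
    filter_upwards [mulCutoff_fn (isCutoff_ballCutoff (0 : Space N) (Nat.cast_add_one_pos k)) u]
      with x hx
    rw [hx]; ring
  · have t1 := tendsto_eLpNorm_two_of_dominated (μ := (volume : Measure (Space N)))
      (f := fun k x => (ballCutoff (0 : Space N) (k + 1) x - 1) • u.grad x)
      (G := fun x => ‖u.grad x‖)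
      (fun k => ((hc k).aestronglyMeasurable.sub aestronglyMeasurable_const).smul (aesm_grad u))
      (memLp_grad u).norm (fun k => Eventually.of_forall fun x => by
        rw [norm_smul]; exact mul_le_of_le_one_left (norm_nonneg _) (hb k x))
      (Eventually.of_forall fun x => by
        simpa using ((tendsto_ballCutoff x).sub_const 1).smul_const (u.grad x))
    have hg : ∀ (k : ℕ) (x : Space N),
        ‖gradient (ballCutoff (0 : Space N) (k + 1)) x‖ ≤ bumpConst N / (k + 1) := fun k x =>
      (isCutoff_ballCutoff (0 : Space N) (Nat.cast_add_one_pos k)).norm_gradient_le x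
    have hB := bumpConst_nonneg N
    have hgc : ∀ k : ℕ, Continuous (gradient (ballCutoff (0 : Space N) (k + 1))) := fun k =>
      continuous_gradient
        ((isCutoff_ballCutoff (0 : Space N) (Nat.cast_add_one_pos k)).smooth.of_le (by simp))
    have t2 := tendsto_eLpNorm_two_of_dominated (μ := (volume : Measure (Space N)))
      (f := fun k x => u.fn x • gradient (ballCutoff (0 : Space N) (k + 1)) x)
      (G := fun x => bumpConst N * ‖u.fn x‖)
      (fun k => (aesm_fn u).smul (hgc k).aestronglyMeasurable)
      ((memLp_fn u).norm.const_mul _) (fun k => Eventually.of_forall fun x => by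
        rw [norm_smul, mul_comm]
        refine mul_le_mul_of_nonneg_right ((hg k x).trans (div_le_self hB ?_)) (norm_nonneg _)
        have : (0 : ℝ) ≤ k := Nat.cast_nonneg k
        linarith)
      (Eventually.of_forall fun x => by
        have : Tendsto (fun k : ℕ => gradient (ballCutoff (0 : Space N) (k + 1)) x) atTop
            (𝓝 0) := by
          refine squeeze_zero_norm (fun k => hg k x) ?_
          exact tendsto_const_nhds.div_atTop
            (tendsto_natCast_atTop_atTop.atTop_add tendsto_const_nhds)
        simpa using this.const_smul (u.fn x))
    refine tendsto_of_tendsto_of_tendsto_of_le_of_le tendsto_const_nhds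
      (by simpa using t1.add t2) (fun k => zero_le) (fun k => ?_)
    refine le_trans (eLpNorm_congr_ae ?_).le (eLpNorm_add_le
      (((hc k).aestronglyMeasurable.sub aestronglyMeasurable_const).smul (aesm_grad u))
      ((aesm_fn u).smul (hgc k).aestronglyMeasurable) (by norm_num))
    filter_upwards [mulCutoff_grad (isCutoff_ballCutoff (0 : Space N) (Nat.cast_add_one_pos k)) u]
      with x hx
    rw [hx]
    simp only [Pi.add_apply]
    module

/-- Smooth functions with compact support are dense in `H¹`. -/
theorem exists_ofTest_dist_lt (u : H1 N) {ε : ℝ} (hε : 0 < ε) :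
    ∃ (φ : Space N → ℝ) (h1 : ContDiff ℝ ∞ φ) (h2 : HasCompactSupport φ),
      ‖ofTest φ h1 h2 - u‖ < ε := by
  obtain ⟨δ₁, hδ₁, hm₁⟩ := exists_eLpNorm_mollify_sub_le (memLp_fn u) (η := ε / 5) (by positivity)
  obtain ⟨δ₂, hδ₂, hm₂⟩ := exists_eLpNorm_mollify_sub_le (memLp_grad u) (η := ε / 5)
    (by positivity)
  let ρ : ContDiffBump (0 : Space N) :=
    ⟨min δ₁ δ₂ / 2, min δ₁ δ₂, by positivity, half_lt_self (by positivity)⟩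
  have l1 : LocallyIntegrable u.fn volume := (memLp_fn u).locallyIntegrable (by norm_num)
  have l2 : LocallyIntegrable u.grad volume := (memLp_grad u).locallyIntegrable (by norm_num)
  have hg : gradient (mollify ρ u.fn) = mollify ρ u.grad :=
    funext fun x => gradient_mollify ρ l1 l2 (hasWeakGradient u) x
  have hs : ContDiff ℝ ∞ (mollify ρ u.fn) := contDiff_mollify ρ l1
  have c1 := hm₁ ρ (min_le_left _ _)
  have c2 := hm₂ ρ (min_le_right _ _)
  have m1 : MemLp (mollify ρ u.fn) 2 volume := by
    have : MemLp (fun x => mollify ρ u.fn x - u.fn x) 2 volume :=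
      ⟨hs.continuous.aestronglyMeasurable.sub (aesm_fn u), c1.trans_lt ENNReal.ofReal_lt_top⟩
    refine (this.add (memLp_fn u)).ae_eq (Eventually.of_forall fun x => ?_)
    simp
  have m2 : MemLp (mollify ρ u.grad) 2 volume := by
    have : MemLp (fun x => mollify ρ u.grad x - u.grad x) 2 volume :=
      ⟨(contDiff_mollify ρ l2).continuous.aestronglyMeasurable.sub (aesm_grad u),
        c2.trans_lt ENNReal.ofReal_lt_top⟩
    refine (this.add (memLp_grad u)).ae_eq (Eventually.of_forall fun x => ?_)
    simp
  let w : H1 N := ofFun _ _ m1 m2 (hg ▸ ContDiff.hasWeakGradient (hs.of_le (by simp)))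
  have hw : ‖w - u‖ ≤ ε / 5 + ε / 5 := by
    refine (norm_le _).trans (add_le_add ?_ ?_)
    · refine norm_Lp_le_of_ae _ (v := fun x => mollify ρ u.fn x - u.fn x) ?_ (by positivity) c1
      filter_upwards [fn_sub_ae w u, ofFun_fn m1 m2 _] with x h1 h2
      rw [h1]; exact congrArg (· - _) h2
    · refine norm_Lp_le_of_ae _ (v := fun x => mollify ρ u.grad x - u.grad x) ?_ (by positivity) c2
      filter_upwards [grad_sub_ae w u, ofFun_grad m1 m2 _] with x h1 h2
      rw [h1]; exact congrArg (· - _) h2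
  obtain ⟨k, hk⟩ := (Metric.tendsto_nhds.1 (tendsto_mulCutoff w) (ε / 5) (by positivity)).exists
  have hχ := isCutoff_ballCutoff (0 : Space N) (Nat.cast_add_one_pos (α := ℝ) k)
  have hsm : ContDiff ℝ ∞ (fun x => ballCutoff (0 : Space N) (k + 1) x * mollify ρ u.fn x) :=
    hχ.smooth.mul hs
  refine ⟨_, hsm, (hasCompactSupport_ballCutoff 0 (Nat.cast_add_one_pos k)).mul_right, ?_⟩
  -- The truncated mollification is itself a test function. Its classical gradient agrees with the
  -- Leibniz formula for `mulCutoff`, so only the truncation error (`ε / 5`) and the mollification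
  -- error (`2ε / 5`) remain.
  have e : ofTest _ hsm (hasCompactSupport_ballCutoff 0 (Nat.cast_add_one_pos k)).mul_right
      = mulCutoff hχ w := by
    refine ext_fn_grad ?_ ?_
    · filter_upwards [mulCutoff_fn hχ w, ofFun_fn m1 m2 _, ofFun_fn
        (hsm.continuous.memLp_of_hasCompactSupport
          (hasCompactSupport_ballCutoff 0 (Nat.cast_add_one_pos k)).mul_right) _
          (ContDiff.hasWeakGradient (hsm.of_le (by simp)))] with x h1 h2 h3
      rw [h1]; refine h3.trans ?_; congr 1; exact h2.symm
    · filter_upwards [mulCutoff_grad hχ w, ofFun_fn m1 m2 _, ofFun_grad m1 m2 _, ofFun_grad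
        (hsm.continuous.memLp_of_hasCompactSupport
          (hasCompactSupport_ballCutoff 0 (Nat.cast_add_one_pos k)).mul_right) _
          (ContDiff.hasWeakGradient (hsm.of_le (by simp)))] with x h1 h2 h3 h4
      rw [h1]; refine h4.trans ?_
      have h2' : w.fn x = mollify ρ u.fn x := h2
      have h3' : w.grad x = mollify ρ u.grad x := h3
      rw [h2', h3', ← hg]
      ext i
      rw [gradient_coord, fderiv_fun_mul (hχ.smooth.differentiable (by simp) x)
        (hs.differentiable (by simp) x)]
      simp [gradient_coord]
  rw [e]
  rw [dist_eq_norm] at hk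
  calc ‖mulCutoff hχ w - u‖ = ‖(mulCutoff hχ w - w) + (w - u)‖ := by congr 1; abel
    _ ≤ _ := norm_add_le _ _
    _ < ε := by linarith

theorem exists_seq_ofTest (u : H1 N) :
    ∃ (φ : ℕ → Space N → ℝ) (h1 : ∀ k, ContDiff ℝ ∞ (φ k)) (h2 : ∀ k, HasCompactSupport (φ k)),
      Tendsto (fun k => ofTest (φ k) (h1 k) (h2 k)) atTop (𝓝 u) ∧
      ∀ᵐ x, Tendsto (fun k => φ k x) atTop (𝓝 (u.fn x)) := by
  choose φ h1 h2 h3 using fun k : ℕ => exists_ofTest_dist_lt u (ε := 1 / ((k : ℝ) + 1))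
    (by positivity)
  have ht : Tendsto (fun k => ofTest (φ k) (h1 k) (h2 k)) atTop (𝓝 u) := by
    rw [tendsto_iff_norm_sub_tendsto_zero]
    exact squeeze_zero (fun k => norm_nonneg _) (fun k => (h3 k).le)
      tendsto_one_div_add_atTop_nhds_zero_nat
  obtain ⟨ns, hns, hae⟩ := exists_subseq_ae ht
  refine ⟨fun k => φ (ns k), fun k => h1 _, fun k => h2 _, ht.comp hns.tendsto_atTop, ?_⟩
  have h4 : ∀ᵐ x, ∀ k, (ofTest (φ (ns k)) (h1 _) (h2 _)).fn x = φ (ns k) x :=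
    ae_all_iff.2 fun k => ofFun_fn _ _ _
  filter_upwards [hae, h4] with x h5 h6
  simpa only [h6] using h5

theorem ofTest_fn (φ : Space N → ℝ) (h1 : ContDiff ℝ ∞ φ) (h2 : HasCompactSupport φ) :
    ∀ᵐ x, (ofTest φ h1 h2).fn x = φ x := ofFun_fn _ _ _

theorem ofTest_grad (φ : Space N → ℝ) (h1 : ContDiff ℝ ∞ φ) (h2 : HasCompactSupport φ) :
    ∀ᵐ x, (ofTest φ h1 h2).grad x = gradient φ x := ofFun_grad _ _ _

end H1

end

/-! ### Sobolev embeddings. -/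

section

/-- `H¹(ℝ^N)` embeds continuously in `L^q`. -/
def HasSobolevBound (N : ℕ) (q : ℝ) : Prop :=
  ∃ C : NNReal, ∀ u : H1 N, ∫⁻ x, ‖u.fn x‖ₑ ^ q ≤ C * ‖u‖ₑ ^ q

/-- Fatou's lemma along test functions that converge in `H¹` and almost everywhere. -/
theorem hasSobolevBound_of_test {N : ℕ} {q : ℝ} (C : NNReal)
    (h : ∀ (φ : Space N → ℝ) (h1 : ContDiff ℝ ∞ φ) (h2 : HasCompactSupport φ),
      ∫⁻ x, ‖φ x‖ₑ ^ q ≤ C * ‖H1.ofTest φ h1 h2‖ₑ ^ q) : HasSobolevBound N q := by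
  refine ⟨C, fun u => ?_⟩
  obtain ⟨φ, h1, h2, ht, hae⟩ := H1.exists_seq_ofTest u
  have hl : Tendsto (fun k => (C : ℝ≥0∞) * ‖H1.ofTest (φ k) (h1 k) (h2 k)‖ₑ ^ q) atTop
      (𝓝 (C * ‖u‖ₑ ^ q)) := by
    refine ENNReal.Tendsto.const_mul ?_ (Or.inr ENNReal.coe_ne_top)
    exact (ENNReal.continuous_rpow_const.tendsto _).comp ht.enorm
  calc ∫⁻ x, ‖u.fn x‖ₑ ^ q = ∫⁻ x, liminf (fun k => ‖φ k x‖ₑ ^ q) atTop := by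
        refine lintegral_congr_ae ?_
        filter_upwards [hae] with x hx
        exact (((ENNReal.continuous_rpow_const.tendsto _).comp hx.enorm).liminf_eq).symm
    _ ≤ liminf (fun k => ∫⁻ x, ‖φ k x‖ₑ ^ q) atTop :=
        lintegral_liminf_le fun k => ((h1 k).continuous.measurable.enorm).pow_const q
    _ ≤ liminf (fun k => (C : ℝ≥0∞) * ‖H1.ofTest (φ k) (h1 k) (h2 k)‖ₑ ^ q) atTop :=
        liminf_le_liminf (Eventually.of_forall fun k => h _ _ _)
    _ = C * ‖u‖ₑ ^ q := hl.liminf_eq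

theorem lintegral_mul_sq_le_mul {α : Type*} [MeasurableSpace α] {μ : Measure α} {f g : α → ℝ≥0∞}
    (hf : AEMeasurable f μ) (hg : AEMeasurable g μ) :
    (∫⁻ x, f x * g x ∂μ) ^ 2 ≤ (∫⁻ x, f x ^ 2 ∂μ) * ∫⁻ x, g x ^ 2 ∂μ := by
  have h := ENNReal.lintegral_mul_le_Lp_mul_Lq μ Real.HolderConjugate.two_two hf hg
  calc (∫⁻ x, f x * g x ∂μ) ^ 2
      ≤ ((∫⁻ x, f x ^ (2 : ℝ) ∂μ) ^ (1 / 2 : ℝ) * (∫⁻ x, g x ^ (2 : ℝ) ∂μ) ^ (1 / 2 : ℝ)) ^ 2 := by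
        gcongr; exact h
    _ = _ := by
      rw [mul_pow, ← ENNReal.rpow_natCast, ← ENNReal.rpow_natCast, ← ENNReal.rpow_mul,
        ← ENNReal.rpow_mul]
      norm_num

namespace H1

variable {N : ℕ}

theorem enorm_fn_le (u : H1 N) : ‖u.fn‖ₑ ≤ ‖u‖ₑ := by
  rw [← ofReal_norm, ← ofReal_norm]; exact ENNReal.ofReal_le_ofReal (norm_fn_le u)

theorem enorm_grad_le (u : H1 N) : ‖u.grad‖ₑ ≤ ‖u‖ₑ := by
  rw [← ofReal_norm, ← ofReal_norm]; exact ENNReal.ofReal_le_ofReal (norm_grad_le u)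

theorem eLpNorm_test_le (φ : Space N → ℝ) (h1 : ContDiff ℝ ∞ φ) (h2 : HasCompactSupport φ) :
    eLpNorm φ 2 volume ≤ ‖ofTest φ h1 h2‖ₑ := by
  refine le_trans ?_ (enorm_fn_le _)
  rw [Lp.enorm_def]
  exact (eLpNorm_congr_ae (ofTest_fn φ h1 h2)).ge

theorem eLpNorm_fderiv_test_le (φ : Space N → ℝ) (h1 : ContDiff ℝ ∞ φ)
    (h2 : HasCompactSupport φ) :
    eLpNorm (fderiv ℝ φ) 2 volume ≤ ‖ofTest φ h1 h2‖ₑ := by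
  refine le_trans ?_ (enorm_grad_le _)
  rw [Lp.enorm_def, eLpNorm_congr_ae (ofTest_grad φ h1 h2)]
  exact (eLpNorm_congr_norm_ae (Eventually.of_forall fun x => (norm_gradient φ x).symm)).le

theorem lintegral_test_le (φ : Space N → ℝ) (h1 : ContDiff ℝ ∞ φ) (h2 : HasCompactSupport φ) :
    ∫⁻ x, ‖φ x‖ₑ ^ 2 ≤ ‖ofTest φ h1 h2‖ₑ ^ 2 :=
  (eLpNorm_two_le_iff _ _ _).1 (eLpNorm_test_le φ h1 h2)

theorem lintegral_fderiv_test_le (φ : Space N → ℝ) (h1 : ContDiff ℝ ∞ φ)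
    (h2 : HasCompactSupport φ) : ∫⁻ x, ‖fderiv ℝ φ x‖ₑ ^ 2 ≤ ‖ofTest φ h1 h2‖ₑ ^ 2 :=
  (eLpNorm_two_le_iff _ _ _).1 (eLpNorm_fderiv_test_le φ h1 h2)

end H1

theorem hasSobolevBound_of_three_le {N : ℕ} (hN : 3 ≤ N) :
    HasSobolevBound N (2 * (N : ℝ) / ((N : ℝ) - 2)) := by
  have hN' : (3 : ℝ) ≤ N := by exact_mod_cast hN
  have hN2 : (0 : ℝ) < N - 2 := by linarith
  have hq : (0 : ℝ) < 2 * (N : ℝ) / ((N : ℝ) - 2) := div_pos (by linarith) hN2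
  set q : ℝ := 2 * (N : ℝ) / ((N : ℝ) - 2) with hqdef
  let q' : NNReal := ⟨q, hq.le⟩
  let K : NNReal := SNormLESNormFDerivOfEqConst ℝ (volume : Measure (Space N)) 2
  refine hasSobolevBound_of_test (K ^ q) fun φ h1 h2 => ?_
  have key := eLpNorm_le_eLpNorm_fderiv_of_eq (volume : Measure (Space N)) (F := ℝ) (u := φ)
    (h1.of_le (by simp)) h2 (p := 2) (p' := q') (by norm_num) (by simp; omega) (by
      change q⁻¹ = _
      rw [hqdef]; simp; field_simp)
  have hq0 : (q' : ℝ≥0∞) ≠ 0 := by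
    have : q' ≠ 0 := fun h => hq.ne' (congrArg NNReal.toReal h)
    exact_mod_cast this
  have e : ∫⁻ x, ‖φ x‖ₑ ^ q = eLpNorm φ q' volume ^ q := by
    rw [eLpNorm_eq_lintegral_rpow_enorm_toReal hq0 (by simp), ← ENNReal.rpow_mul]
    have : (q' : ℝ≥0∞).toReal = q := rfl
    rw [this, one_div, inv_mul_cancel₀ hq.ne', ENNReal.rpow_one]
  rw [e]
  calc eLpNorm φ q' volume ^ q ≤ (K * ‖H1.ofTest φ h1 h2‖ₑ) ^ q := by
        gcongr
        exact key.trans (mul_le_mul_right (H1.eLpNorm_fderiv_test_le φ h1 h2) _)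
    _ = _ := by
        rw [ENNReal.mul_rpow_of_nonneg _ _ hq.le, ENNReal.coe_rpow_of_nonneg _ hq.le]

/-- Induction on the power: the planar inequality `∫ v² ≤ K (∫ |∇v|)²` for `v = φ^(m+2)`, followed
by Cauchy–Schwarz on `|φ|^(m+1) |∇φ|`, bounds `∫ φ^(2(m+2))` by a multiple of `∫ φ^(2(m+1)) · ∫
|∇φ|²`. -/
theorem hasSobolevBound_two (m : ℕ) : HasSobolevBound 2 (2 * (m + 1 : ℕ)) := by
  let K : NNReal := lintegralPowLePowLIntegralFDerivConst (volume : Measure (Space 2)) 2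
  have main : ∀ m : ℕ, ∃ C : NNReal, ∀ (φ : Space 2 → ℝ) (h1 : ContDiff ℝ ∞ φ)
      (h2 : HasCompactSupport φ),
      ∫⁻ x, ‖φ x‖ₑ ^ (2 * (m + 1)) ≤ C * ‖H1.ofTest φ h1 h2‖ₑ ^ (2 * (m + 1)) := by
    intro m
    induction m with
    | zero => exact ⟨1, fun φ h1 h2 => by simpa using H1.lintegral_test_le φ h1 h2⟩
    | succ m ih =>
      obtain ⟨C, hC⟩ := ih
      refine ⟨K * ((m + 1 + 1 : ℕ) ^ 2 * C), fun φ h1 h2 => ?_⟩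
      have hpow : ContDiff ℝ 1 (fun x => φ x ^ (m + 1 + 1)) := (h1.of_le (by simp)).pow _
      have hcs : HasCompactSupport (fun x => φ x ^ (m + 1 + 1)) :=
        h2.comp_left (g := fun t : ℝ => t ^ (m + 1 + 1)) (by simp)
      have key := lintegral_pow_le_pow_lintegral_fderiv (volume : Measure (Space 2)) hpow hcs
        (p := 2) (by simpa using Real.HolderConjugate.two_two)
      have hd : ∀ x, ‖fderiv ℝ (fun x => φ x ^ (m + 1 + 1)) x‖ₑ
          = (m + 1 + 1 : ℕ) * (‖φ x‖ₑ ^ (m + 1) * ‖fderiv ℝ φ x‖ₑ) := by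
        intro x
        rw [fderiv_fun_pow _ (h1.differentiable (by simp) x)]
        simp only [Nat.add_sub_cancel, enorm_smul, nsmul_eq_mul, enorm_mul, enorm_pow, mul_assoc]
        congr 1
        rw [← ofReal_norm, Real.norm_natCast, ENNReal.ofReal_natCast]
      have hm1 : AEMeasurable (fun x => ‖φ x‖ₑ ^ (m + 1)) :=
        (h1.continuous.measurable.enorm.pow_const _).aemeasurable
      have hm2 : AEMeasurable (fun x => ‖fderiv ℝ φ x‖ₑ) :=
        ((h1.continuous_fderiv (by simp)).measurable.enorm).aemeasurable
      have e0 : ∀ x, ‖φ x‖ₑ ^ (2 * (m + 1 + 1)) = ‖φ x ^ (m + 1 + 1)‖ₑ ^ (2 : ℝ) := by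
        intro x; rw [enorm_pow, ENNReal.rpow_ofNat, ← pow_mul, mul_comm]
      calc ∫⁻ x, ‖φ x‖ₑ ^ (2 * (m + 1 + 1)) = ∫⁻ x, ‖φ x ^ (m + 1 + 1)‖ₑ ^ (2 : ℝ) := by
            simp only [e0]
        _ ≤ K * (∫⁻ x, ‖fderiv ℝ (fun x => φ x ^ (m + 1 + 1)) x‖ₑ) ^ (2 : ℝ) := key
        _ = K * ((m + 1 + 1 : ℕ) ^ 2 * (∫⁻ x, ‖φ x‖ₑ ^ (m + 1) * ‖fderiv ℝ φ x‖ₑ) ^ 2) := by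
            simp only [hd]
            rw [lintegral_const_mul' _ _ (by simp), ENNReal.rpow_ofNat, mul_pow]
        _ ≤ K * ((m + 1 + 1 : ℕ) ^ 2 * ((C * ‖H1.ofTest φ h1 h2‖ₑ ^ (2 * (m + 1)))
              * ‖H1.ofTest φ h1 h2‖ₑ ^ 2)) := by
            gcongr
            refine (lintegral_mul_sq_le_mul hm1 hm2).trans ?_
            gcongr
            · refine le_trans (le_of_eq ?_) (hC φ h1 h2)
              congr 1; ext x; rw [← pow_mul]; congr 1; ring
            · exact H1.lintegral_fderiv_test_le φ h1 h2
        _ = _ := by push_cast; ring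
  obtain ⟨C, hC⟩ := main m
  refine hasSobolevBound_of_test C fun φ h1 h2 => ?_
  have : (2 * ((m + 1 : ℕ) : ℝ)) = ((2 * (m + 1) : ℕ) : ℝ) := by push_cast; ring
  rw [this]
  simpa only [ENNReal.rpow_natCast] using hC φ h1 h2

/-- The fundamental theorem of calculus on the line, carried to `Space 1` by the measure preserving
isometry `L`. -/
theorem enorm_le_lintegral_fderiv_one {v : Space 1 → ℝ} (hv : ContDiff ℝ 1 v)
    (hc : HasCompactSupport v) (x : Space 1) : ‖v x‖ₑ ≤ ∫⁻ y, ‖fderiv ℝ v y‖ₑ := by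
  let L : ℝ → Space 1 := fun t => WithLp.toLp 2 ((MeasurableEquiv.funUnique (Fin 1) ℝ).symm t)
  have hL : MeasurePreserving L volume volume :=
    (PiLp.volume_preserving_toLp (Fin 1)).comp ((volume_preserving_funUnique (Fin 1) ℝ).symm _)
  have hLs : ∀ t, L t = t • EuclideanSpace.single (0 : Fin 1) (1 : ℝ) := by
    intro t; ext i; fin_cases i; simp [L, MeasurableEquiv.funUnique]
  have hLd : ∀ t, HasDerivAt L (EuclideanSpace.single (0 : Fin 1) (1 : ℝ)) t := by
    intro t
    have : L = fun t => t • EuclideanSpace.single (0 : Fin 1) (1 : ℝ) := funext hLs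
    rw [this]
    simpa using (hasDerivAt_id t).smul_const (EuclideanSpace.single (0 : Fin 1) (1 : ℝ))
  have hLc : ContDiff ℝ 1 L := by
    have : L = fun t => t • EuclideanSpace.single (0 : Fin 1) (1 : ℝ) := funext hLs
    rw [this]; fun_prop
  have hLiso : Isometry L := by
    refine Isometry.of_dist_eq fun s t => ?_
    rw [hLs, hLs, dist_eq_norm, ← sub_smul, norm_smul, dist_eq_norm]; simp
  have hcs : HasCompactSupport (v ∘ L) := hc.comp_isClosedEmbedding hLiso.isClosedEmbedding
  have hx : x = L (x 0) := by
    rw [hLs]; ext i; fin_cases i; simp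
  calc ‖v x‖ₑ = ‖(v ∘ L) (x 0)‖ₑ := by rw [Function.comp_apply, ← hx]
    _ ≤ ∫⁻ t in Set.Iic (x 0), ‖deriv (v ∘ L) t‖ₑ :=
        HasCompactSupport.enorm_le_lintegral_Ici_deriv (hv.comp hLc) hcs _
    _ ≤ ∫⁻ t, ‖deriv (v ∘ L) t‖ₑ := setLIntegral_le_lintegral _ _
    _ ≤ ∫⁻ t, ‖fderiv ℝ v (L t)‖ₑ := by
        refine lintegral_mono fun t => ?_
        rw [((hv.differentiable (by simp) (L t)).hasFDerivAt.comp_hasDerivAt t (hLd t)).deriv]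
        refine (ContinuousLinearMap.le_opENorm _ _).trans ?_
        rw [← ofReal_norm (EuclideanSpace.single (0 : Fin 1) (1 : ℝ))]
        simp
    _ = ∫⁻ y, ‖fderiv ℝ v y‖ₑ :=
        hL.lintegral_comp ((hv.continuous_fderiv (by simp)).measurable.enorm)

/-- The fundamental theorem of calculus for `φ²` bounds `sup |φ|²` by `2 ∫ |φ| |φ'|`, hence by the
squared `H¹` norm. Each step of the induction pulls one factor `φ²` out of the integral. -/
theorem hasSobolevBound_one (m : ℕ) : HasSobolevBound 1 (2 * (m + 1 : ℕ)) := by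
  have hsup : ∀ (φ : Space 1 → ℝ) (h1 : ContDiff ℝ ∞ φ) (h2 : HasCompactSupport φ) (x : Space 1),
      ‖φ x‖ₑ ^ 4 ≤ 4 * ‖H1.ofTest φ h1 h2‖ₑ ^ 4 := by
    intro φ h1 h2 x
    have hpow : ContDiff ℝ 1 (fun x => φ x ^ 2) := (h1.of_le (by simp)).pow _
    have hcs : HasCompactSupport (fun x => φ x ^ 2) :=
      h2.comp_left (g := fun t : ℝ => t ^ 2) (by simp)
    have hd : ∀ x, ‖fderiv ℝ (fun x => φ x ^ 2) x‖ₑ = 2 * (‖φ x‖ₑ * ‖fderiv ℝ φ x‖ₑ) := by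
      intro x
      rw [fderiv_fun_pow _ (h1.differentiable (by simp) x)]
      simp only [Nat.add_one_sub_one, pow_one, enorm_smul, nsmul_eq_mul, enorm_mul, mul_assoc]
      congr 1
      rw [← ofReal_norm]; simp
    have h3 := enorm_le_lintegral_fderiv_one hpow hcs x
    simp only [hd] at h3
    rw [lintegral_const_mul' _ _ (by simp), enorm_pow] at h3
    calc ‖φ x‖ₑ ^ 4 = (‖φ x‖ₑ ^ 2) ^ 2 := by rw [← pow_mul]
      _ ≤ (2 * ∫⁻ y, ‖φ y‖ₑ * ‖fderiv ℝ φ y‖ₑ) ^ 2 := by gcongr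
      _ = 4 * (∫⁻ y, ‖φ y‖ₑ * ‖fderiv ℝ φ y‖ₑ) ^ 2 := by rw [mul_pow]; norm_num
      _ ≤ 4 * (‖H1.ofTest φ h1 h2‖ₑ ^ 2 * ‖H1.ofTest φ h1 h2‖ₑ ^ 2) := by
          gcongr
          refine (lintegral_mul_sq_le_mul h1.continuous.measurable.enorm.aemeasurable
            (h1.continuous_fderiv (by simp)).measurable.enorm.aemeasurable).trans ?_
          gcongr
          · exact H1.lintegral_test_le φ h1 h2
          · exact H1.lintegral_fderiv_test_le φ h1 h2
      _ = _ := by ring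
  have hsup2 : ∀ (φ : Space 1 → ℝ) (h1 : ContDiff ℝ ∞ φ) (h2 : HasCompactSupport φ) (x : Space 1),
      ‖φ x‖ₑ ^ 2 ≤ 2 * ‖H1.ofTest φ h1 h2‖ₑ ^ 2 := by
    intro φ h1 h2 x
    rw [← ENNReal.pow_le_pow_left_iff two_ne_zero]
    calc _ = ‖φ x‖ₑ ^ 4 := by rw [← pow_mul]
      _ ≤ _ := hsup φ h1 h2 x
      _ = _ := by ring
  have main : ∀ m : ℕ, ∃ C : NNReal, ∀ (φ : Space 1 → ℝ) (h1 : ContDiff ℝ ∞ φ)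
      (h2 : HasCompactSupport φ),
      ∫⁻ x, ‖φ x‖ₑ ^ (2 * (m + 1)) ≤ C * ‖H1.ofTest φ h1 h2‖ₑ ^ (2 * (m + 1)) := by
    intro m
    induction m with
    | zero => exact ⟨1, fun φ h1 h2 => by simpa using H1.lintegral_test_le φ h1 h2⟩
    | succ m ih =>
      obtain ⟨C, hC⟩ := ih
      refine ⟨2 * C, fun φ h1 h2 => ?_⟩
      calc ∫⁻ x, ‖φ x‖ₑ ^ (2 * (m + 1 + 1))
          ≤ ∫⁻ x, (2 * ‖H1.ofTest φ h1 h2‖ₑ ^ 2) * ‖φ x‖ₑ ^ (2 * (m + 1)) := by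
            refine lintegral_mono fun x => ?_
            have : ‖φ x‖ₑ ^ (2 * (m + 1 + 1)) = ‖φ x‖ₑ ^ 2 * ‖φ x‖ₑ ^ (2 * (m + 1)) := by ring
            simp only [this]
            gcongr
            exact hsup2 φ h1 h2 x
        _ = (2 * ‖H1.ofTest φ h1 h2‖ₑ ^ 2) * ∫⁻ x, ‖φ x‖ₑ ^ (2 * (m + 1)) :=
            lintegral_const_mul' _ _ (ENNReal.mul_ne_top (by simp) (by simp))
        _ ≤ (2 * ‖H1.ofTest φ h1 h2‖ₑ ^ 2) * (C * ‖H1.ofTest φ h1 h2‖ₑ ^ (2 * (m + 1))) := by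
            gcongr; exact hC φ h1 h2
        _ = _ := by push_cast; ring
  obtain ⟨C, hC⟩ := main m
  refine hasSobolevBound_of_test C fun φ h1 h2 => ?_
  have : (2 * ((m + 1 : ℕ) : ℝ)) = ((2 * (m + 1) : ℕ) : ℝ) := by push_cast; ring
  rw [this]
  simpa only [ENNReal.rpow_natCast] using hC φ h1 h2

/-- An admissible nonlinearity is subcritical for some Sobolev exponent `q > 2`. -/
theorem IsAdmissible.exists_exponent {N : ℕ} (hN : 1 ≤ N) {f : ℝ → ℝ} (hf : IsAdmissible N f) :
    ∃ q : ℝ, 2 < q ∧ HasSobolevBound N q ∧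
      Tendsto (fun s : ℝ => deriv f s / |s| ^ (q - 2)) (cocompact ℝ) (𝓝 0) := by
  by_cases h3 : 3 ≤ N
  · refine ⟨_, ?_, hasSobolevBound_of_three_le h3, hf.growth_high h3⟩
    have hN' : (3 : ℝ) ≤ N := by exact_mod_cast h3
    rw [lt_div_iff₀ (by linarith)]; linarith
  · obtain ⟨p, hp, hlim⟩ := hf.growth_low (by omega)
    obtain ⟨m, hm⟩ := exists_nat_ge p
    -- In low dimensions any larger exponent is also admissible, so `p` is replaced by an even
    -- integer, for which the embedding has been established.
    refine ⟨2 * (m + 1 : ℕ), ?_, ?_, ?_⟩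
    · push_cast; linarith
    · interval_cases N
      · exact hasSobolevBound_one m
      · exact hasSobolevBound_two m
    · refine squeeze_zero_norm' ?_ (by simpa using hlim.norm)
      have hev : ∀ᶠ s : ℝ in cocompact ℝ, 1 ≤ ‖s‖ :=
        (tendsto_norm_cocompact_atTop (E := ℝ)).eventually_ge_atTop 1
      filter_upwards [hev] with s hs
      rw [Real.norm_eq_abs] at hs
      rw [norm_div, Real.norm_of_nonneg (Real.rpow_nonneg (abs_nonneg s) _),
        abs_of_nonneg (Real.rpow_nonneg (abs_nonneg s) (p - 2)), Real.norm_eq_abs]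
      gcongr
      push_cast; linarith

end

/-! ### Pointwise growth and Taylor estimates for the nonlinearity. -/

section

section Pointwise

theorem abs_add_rpow_le {m : ℝ} (hm : 0 < m) (s t : ℝ) :
    |s + t| ^ m ≤ 2 ^ m * (|s| ^ m + |t| ^ m) := by
  have h : |s + t| ≤ 2 * max |s| |t| := by
    have := abs_add_le s t
    have h1 := le_max_left |s| |t|
    have h2 := le_max_right |s| |t|
    linarith
  calc |s + t| ^ m ≤ (2 * max |s| |t|) ^ m := Real.rpow_le_rpow (abs_nonneg _) h hm.le
    _ = 2 ^ m * (max |s| |t|) ^ m := Real.mul_rpow (by norm_num) (by positivity)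
    _ ≤ _ := by
      gcongr
      have h1 : 0 ≤ |s| ^ m := by positivity
      have h2 : 0 ≤ |t| ^ m := by positivity
      rcases le_total |s| |t| with h3 | h3
      · rw [max_eq_right h3]; linarith
      · rw [max_eq_left h3]; linarith

/-- A continuous function which is `o(|s|^m)` at infinity has this modulus of continuity. -/
theorem exists_abs_sub_le_of_growth {h : ℝ → ℝ} (hc : Continuous h) {m : ℝ} (hm : 0 < m)
    (hlim : Tendsto (fun s : ℝ => h s / |s| ^ m) (cocompact ℝ) (𝓝 0)) {ε : ℝ} (hε : 0 < ε) :
    ∃ C : ℝ, 0 ≤ C ∧ ∀ s t : ℝ, |h (s + t) - h s| ≤ ε * (1 + |s| ^ m) + C * |t| ^ m := by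
  have h2m : (1 : ℝ) ≤ 2 ^ m := Real.one_le_rpow (by norm_num) hm.le
  -- For large arguments the values at `s + t` and at `s` contribute `η 2^m |s|^m` and `η |s|^m`,
  -- which add up to `ε |s|^m`.
  set η : ℝ := ε / (1 + 2 ^ m) with hη
  have hη0 : 0 < η := by positivity
  have hηε : η * (1 + 2 ^ m) = ε := by rw [hη]; field_simp
  obtain ⟨M, hM0, hM⟩ : ∃ M : ℝ, 1 ≤ M ∧ ∀ s : ℝ, M ≤ |s| → |h s| ≤ η * |s| ^ m := by
    have h1 := Metric.tendsto_nhds.1 hlim η hη0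
    rw [← Metric.cobounded_eq_cocompact, ← comap_norm_atTop, eventually_comap] at h1
    obtain ⟨M, hM⟩ := eventually_atTop.1 h1
    refine ⟨max M 1, le_max_right _ _, fun s hs => ?_⟩
    have h2 := hM |s| ((le_max_left _ _).trans hs) s rfl
    have hs0 : 0 < |s| := lt_of_lt_of_le one_pos ((le_max_right _ _).trans hs)
    have h3 : 0 < |s| ^ m := Real.rpow_pos_of_pos hs0 m
    rw [dist_zero_right, norm_div, Real.norm_of_nonneg h3.le, div_lt_iff₀ h3] at h2
    exact h2.le
  obtain ⟨D, hD⟩ := (isCompact_Icc (a := -M) (b := M)).exists_bound_of_continuousOn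
    hc.continuousOn
  have hD0 : 0 ≤ D := (norm_nonneg _).trans (hD 0 ⟨by linarith, by linarith⟩)
  have hglob : ∀ s, |h s| ≤ D + η * |s| ^ m := by
    intro s
    have h1 : 0 ≤ η * |s| ^ m := by positivity
    rcases le_total M |s| with h2 | h2
    · linarith [hM s h2]
    · linarith [hD s (abs_le.1 h2), Real.norm_eq_abs (h s)]
  obtain ⟨δ, hδ0, hδ⟩ := Metric.uniformContinuousOn_iff.1
    ((isCompact_Icc (a := -(M + 2)) (b := M + 2)).uniformContinuousOn_of_continuous
      hc.continuousOn) ε hε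
  set d : ℝ := min δ 1 with hd
  have hd0 : 0 < d := by positivity
  have hdm : 0 < d ^ m := Real.rpow_pos_of_pos hd0 m
  refine ⟨2 * D / d ^ m + η * 2 ^ m, by positivity, fun s t => ?_⟩
  have hs0 : 0 ≤ |s| ^ m := by positivity
  have ht0 : 0 ≤ |t| ^ m := by positivity
  have htri : |h (s + t) - h s| ≤ |h (s + t)| + |h s| := abs_sub _ _
  have hadd := abs_add_rpow_le hm s t
  -- For small `t` either `s` lies in a compact interval, where uniform continuity applies, or both
  -- `s` and `s + t` are in the growth regime. For `|t| ≥ d` additive constants are absorbed into a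
  -- multiple of `|t|^m`.
  rcases lt_or_ge |t| d with h1 | h1
  · rcases le_total |s| (M + 1) with h2 | h2
    · have h3 : |t| < 1 := h1.trans_le (min_le_right _ _)
      have h4 : dist (h (s + t)) (h s) < ε := by
        rw [abs_le] at h2
        rw [abs_lt] at h3
        refine hδ _ ⟨by linarith, by linarith⟩ _ ⟨by linarith, by linarith⟩ ?_
        rw [Real.dist_eq, add_sub_cancel_left]
        exact h1.trans_le (min_le_left _ _)
      rw [Real.dist_eq] at h4
      have : 0 ≤ (2 * D / d ^ m + η * 2 ^ m) * |t| ^ m := by positivity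
      nlinarith
    · have h3 : |t| < 1 := h1.trans_le (min_le_right _ _)
      have h4 : M ≤ |s + t| := by
        have := abs_sub_abs_le_abs_sub s (-t)
        rw [sub_neg_eq_add, abs_neg] at this
        linarith
      have h5 := hM _ h4
      have h6 := hM s (by linarith)
      have h7 : 0 ≤ 2 * D / d ^ m * |t| ^ m := by positivity
      have h8 := mul_le_mul_of_nonneg_left hadd hη0.le
      calc |h (s + t) - h s| ≤ η * (2 ^ m * (|s| ^ m + |t| ^ m)) + η * |s| ^ m := by linarith
        _ = (η * (1 + 2 ^ m)) * |s| ^ m + η * 2 ^ m * |t| ^ m := by ring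
        _ ≤ _ := by rw [hηε]; nlinarith
  · have h3 : d ^ m ≤ |t| ^ m := Real.rpow_le_rpow hd0.le h1 hm.le
    have h5 := hglob (s + t)
    have h6 := hglob s
    have h7 : 2 * D ≤ 2 * D / d ^ m * |t| ^ m := by
      rw [div_mul_eq_mul_div, le_div_iff₀ hdm]
      exact mul_le_mul_of_nonneg_left h3 (by positivity)
    have h8 := mul_le_mul_of_nonneg_left hadd hη0.le
    calc |h (s + t) - h s|
        ≤ 2 * D + η * (2 ^ m * (|s| ^ m + |t| ^ m)) + η * |s| ^ m := by linarith
      _ = 2 * D + (η * (1 + 2 ^ m)) * |s| ^ m + η * 2 ^ m * |t| ^ m := by ring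
      _ ≤ _ := by rw [hηε]; nlinarith

/-- The properties of the nonlinearity used in the estimates: `f` is `C¹`, `f(0) = f'(0) = 0`, and
the derivative has growth `o(|s|^(q-2))` for a Sobolev exponent `q`. -/
structure HasGrowth (N : ℕ) (q : ℝ) (f : ℝ → ℝ) : Prop where
  two_lt : 2 < q
  sobolev : HasSobolevBound N q
  contDiff : ContDiff ℝ 1 f
  zero : f 0 = 0
  deriv_zero : deriv f 0 = 0
  lim : Tendsto (fun s : ℝ => deriv f s / |s| ^ (q - 2)) (cocompact ℝ) (𝓝 0)

variable {N : ℕ} {q : ℝ} {f : ℝ → ℝ}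

theorem IsAdmissible.exists_hasGrowth (hN : 1 ≤ N) (hf : IsAdmissible N f) :
    ∃ q, HasGrowth N q f := by
  obtain ⟨q, h1, h2, h3⟩ := hf.exists_exponent hN
  exact ⟨q, h1, h2, hf.contDiff, hf.zero, hf.deriv_zero, h3⟩

namespace HasGrowth

theorem exponent_pos (h : HasGrowth N q f) : 0 < q - 2 := by linarith [h.two_lt]

theorem continuous_deriv (h : HasGrowth N q f) : Continuous (deriv f) :=
  h.contDiff.continuous_deriv (by simp)

theorem hasDerivAt (h : HasGrowth N q f) (s : ℝ) : HasDerivAt f (deriv f s) s :=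
  (h.contDiff.differentiable (by simp) s).hasDerivAt

theorem exists_deriv_sub_le (h : HasGrowth N q f) {ε : ℝ} (hε : 0 < ε) :
    ∃ C : ℝ, 0 ≤ C ∧ ∀ s t : ℝ,
      |deriv f t - deriv f s| ≤ ε * (1 + |s| ^ (q - 2)) + C * |t - s| ^ (q - 2) := by
  obtain ⟨C, hC, H⟩ := exists_abs_sub_le_of_growth h.continuous_deriv h.exponent_pos h.lim hε
  refine ⟨C, hC, fun s t => ?_⟩
  simpa using H s (t - s)

theorem exists_deriv_le (h : HasGrowth N q f) {ε : ℝ} (hε : 0 < ε) :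
    ∃ C : ℝ, 0 ≤ C ∧ ∀ t : ℝ, |deriv f t| ≤ ε + C * |t| ^ (q - 2) := by
  obtain ⟨C, hC, H⟩ := h.exists_deriv_sub_le hε
  refine ⟨C, hC, fun t => ?_⟩
  have := H 0 t
  rw [h.deriv_zero, abs_zero, Real.zero_rpow h.exponent_pos.ne'] at this
  simpa using this

/-- Quantitative differentiability of `f`. -/
theorem exists_sub_sub_le (h : HasGrowth N q f) {ε : ℝ} (hε : 0 < ε) :
    ∃ C : ℝ, 0 ≤ C ∧ ∀ x y r : ℝ, |f x - f y - deriv f r * (x - y)| ≤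
      (ε * (1 + |r| ^ (q - 2)) + C * (|x - r| ^ (q - 2) + |y - r| ^ (q - 2))) * |x - y| := by
  obtain ⟨C, hC, H⟩ := h.exists_deriv_sub_le hε
  refine ⟨C, hC, fun x y r => ?_⟩
  -- Mean value inequality for `t ↦ f t - f'(r) t`. Between `y` and `x` one has `|t - r| ≤ max |x -
  -- r| |y - r|`, so the modulus of continuity of `f'` bounds the derivative.
  have key := (convex_uIcc y x).norm_image_sub_le_of_norm_hasDerivWithin_le
    (f := fun t => f t - deriv f r * t) (f' := fun t => deriv f t - deriv f r)
    (C := ε * (1 + |r| ^ (q - 2)) + C * (|x - r| ^ (q - 2) + |y - r| ^ (q - 2)))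
    (fun t _ => by
      have := (h.hasDerivAt t).sub ((hasDerivAt_id t).const_mul (deriv f r))
      rw [mul_one] at this
      exact this.hasDerivWithinAt) (fun t ht => ?_) Set.left_mem_uIcc Set.right_mem_uIcc
  · rw [Real.norm_eq_abs, Real.norm_eq_abs] at key
    convert key using 2
    ring
  · rw [Real.norm_eq_abs]
    refine (H r t).trans ?_
    have h1 : |t - r| ≤ max |x - r| |y - r| := by
      rcases Set.mem_uIcc.1 ht with ⟨h1, h2⟩ | ⟨h1, h2⟩
      · exact abs_le.2 ⟨by linarith [neg_abs_le (y - r), le_max_right |x - r| |y - r|],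
          by linarith [le_abs_self (x - r), le_max_left |x - r| |y - r|]⟩
      · exact abs_le.2 ⟨by linarith [neg_abs_le (x - r), le_max_left |x - r| |y - r|],
          by linarith [le_abs_self (y - r), le_max_right |x - r| |y - r|]⟩
    have hx : 0 ≤ |x - r| ^ (q - 2) := by positivity
    have hy : 0 ≤ |y - r| ^ (q - 2) := by positivity
    have h2 : |t - r| ^ (q - 2) ≤ |x - r| ^ (q - 2) + |y - r| ^ (q - 2) := by
      refine (Real.rpow_le_rpow (abs_nonneg _) h1 h.exponent_pos.le).trans ?_
      rcases le_total |x - r| |y - r| with h3 | h3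
      · rw [max_eq_right h3]; linarith
      · rw [max_eq_left h3]; linarith
    gcongr

theorem exists_abs_le (h : HasGrowth N q f) {ε : ℝ} (hε : 0 < ε) :
    ∃ C : ℝ, 0 ≤ C ∧ ∀ x : ℝ, |f x| ≤ (ε + C * |x| ^ (q - 2)) * |x| := by
  obtain ⟨C, hC, H⟩ := h.exists_sub_sub_le hε
  refine ⟨C, hC, fun x => ?_⟩
  have := H x 0 0
  rw [h.deriv_zero, h.zero, abs_zero, Real.zero_rpow h.exponent_pos.ne'] at this
  simpa [Real.zero_rpow h.exponent_pos.ne'] using this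

theorem continuous (h : HasGrowth N q f) : Continuous f := h.contDiff.continuous

theorem hasDerivAt_primitive (h : HasGrowth N q f) (s : ℝ) :
    HasDerivAt (fun x => ∫ t in (0 : ℝ)..x, f t) (f s) s :=
  intervalIntegral.integral_hasDerivAt_right (h.continuous.intervalIntegrable _ _)
    (h.continuous.stronglyMeasurableAtFilter _ _) h.continuous.continuousAt

/-- Quantitative differentiability of the primitive of `f`. -/
theorem exists_primitive_sub_le (h : HasGrowth N q f) :
    ∃ C : ℝ, 0 ≤ C ∧ ∀ s v : ℝ,
      |(∫ t in (0 : ℝ)..(s + v), f t) - (∫ t in (0 : ℝ)..s, f t) - f s * v| ≤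
        (2 + C * |s| ^ (q - 2) + C * |v| ^ (q - 2)) * |v| * |v| := by
  obtain ⟨C₁, hC₁, H₁⟩ := h.exists_sub_sub_le one_pos
  obtain ⟨C₂, hC₂, H₂⟩ := h.exists_deriv_le one_pos
  refine ⟨1 + C₁ + C₂, by positivity, fun s v => ?_⟩
  -- The derivative of the primitive minus its linear part is `f t - f s`, itself of order `|v|`.
  -- This supplies the second factor `|v|`, which makes the Taylor remainder quadratic.
  have key := (convex_uIcc s (s + v)).norm_image_sub_le_of_norm_hasDerivWithin_le
    (f := fun t => (∫ τ in (0 : ℝ)..t, f τ) - f s * t) (f' := fun t => f t - f s)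
    (C := (2 + (1 + C₁ + C₂) * |s| ^ (q - 2) + (1 + C₁ + C₂) * |v| ^ (q - 2)) * |v|)
    (fun t _ => by
      have := (h.hasDerivAt_primitive t).sub ((hasDerivAt_id t).const_mul (f s))
      rw [mul_one] at this
      exact this.hasDerivWithinAt) (fun t ht => ?_) Set.left_mem_uIcc Set.right_mem_uIcc
  · rw [Real.norm_eq_abs, Real.norm_eq_abs] at key
    rw [add_sub_cancel_left] at key
    convert key using 2
    ring
  · have h1 : |t - s| ≤ |v| := by
      have := Set.abs_sub_left_of_mem_uIcc ht
      simpa using this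
    have h2 := H₁ t s s
    rw [sub_self, abs_zero, Real.zero_rpow h.exponent_pos.ne', add_zero] at h2
    have h3 := H₂ s
    have h4 : |f t - f s| ≤ |f t - f s - deriv f s * (t - s)| + |deriv f s| * |t - s| := by
      rw [← abs_mul]
      have := abs_add_le (f t - f s - deriv f s * (t - s)) (deriv f s * (t - s))
      simpa using this
    have h5 : |t - s| ^ (q - 2) ≤ |v| ^ (q - 2) :=
      Real.rpow_le_rpow (abs_nonneg _) h1 h.exponent_pos.le
    have hs : 0 ≤ |s| ^ (q - 2) := by positivity
    have hv : 0 ≤ |v| ^ (q - 2) := by positivity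
    have hts := abs_nonneg (t - s)
    rw [Real.norm_eq_abs]
    calc |f t - f s| ≤ (1 * (1 + |s| ^ (q - 2)) + C₁ * |t - s| ^ (q - 2)) * |t - s|
          + (1 + C₂ * |s| ^ (q - 2)) * |t - s| := by
          refine h4.trans (add_le_add h2 ?_); gcongr
      _ = (2 + (1 + C₂) * |s| ^ (q - 2) + C₁ * |t - s| ^ (q - 2)) * |t - s| := by ring
      _ ≤ (2 + (1 + C₁ + C₂) * |s| ^ (q - 2) + (1 + C₁ + C₂) * |v| ^ (q - 2)) * |v| := by
          gcongr
          · linarith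
          · linarith

end HasGrowth

end Pointwise

end

/-! ### `H¹` as a Hilbert space with its bilinear forms. -/

section

theorem integral_abs_mul_le_of_sq {α : Type*} [MeasurableSpace α] {μ : Measure α} {f g : α → ℝ}
    (hf : MemLp f 2 μ) (hg : MemLp g 2 μ) {a b : ℝ} (ha : 0 ≤ a) (hb : 0 ≤ b)
    (hfa : ∫ x, f x ^ 2 ∂μ ≤ a ^ 2) (hgb : ∫ x, g x ^ 2 ∂μ ≤ b ^ 2) :
    ∫ x, |f x * g x| ∂μ ≤ a * b := by
  have h := integral_mul_le_Lp_mul_Lq_of_nonneg (μ := μ) Real.HolderConjugate.two_two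
    (f := fun x => |f x|) (g := fun x => |g x|) (Eventually.of_forall fun x => abs_nonneg _)
    (Eventually.of_forall fun x => abs_nonneg _) (by simpa using hf.norm) (by simpa using hg.norm)
  simp only [Real.rpow_ofNat, sq_abs] at h
  simp only [abs_mul]
  refine h.trans ?_
  gcongr
  · rw [← Real.sqrt_eq_rpow, Real.sqrt_le_left ha]; exact hfa
  · rw [← Real.sqrt_eq_rpow, Real.sqrt_le_left hb]; exact hgb

theorem H1.inner_eq {N : ℕ} (u v : H1 N) :
    inner ℝ u v = (∫ x, u.fn x * v.fn x) + ∫ x, inner ℝ (u.grad x) (v.grad x) := by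
  have h : inner ℝ u v = inner ℝ u.fn v.fn + inner ℝ u.grad v.grad := WithLp.prod_inner_apply _ _
  rw [h, H1.inner_fn, H1.inner_grad]

/-- The Sobolev space `H¹(ℝ^N)` as a Hilbert space, with sealed instances. -/
def HOne (N : ℕ) : Type := H1 N

namespace HOne

variable {N : ℕ}

instance : NormedAddCommGroup (HOne N) := inferInstanceAs (NormedAddCommGroup (H1 N))
instance : InnerProductSpace ℝ (HOne N) := inferInstanceAs (InnerProductSpace ℝ (H1 N))
instance : CompleteSpace (HOne N) := inferInstanceAs (CompleteSpace (H1 N))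

/-- The function underlying an element of `H¹`. -/
def fn (u : HOne N) : Space N → ℝ := H1.fn (N := N) u

/-- The weak gradient of an element of `H¹`. -/
def grad (u : HOne N) : Space N → Space N := H1.grad (N := N) u

theorem fn_add_ae (u v : HOne N) : ∀ᵐ x, (u + v).fn x = u.fn x + v.fn x :=
  H1.fn_add_ae (N := N) u v
theorem fn_sub_ae (u v : HOne N) : ∀ᵐ x, (u - v).fn x = u.fn x - v.fn x :=
  H1.fn_sub_ae (N := N) u v
theorem fn_zero_ae : ∀ᵐ x, (0 : HOne N).fn x = 0 := H1.fn_zero_ae (N := N)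
theorem fn_smul_ae (c : ℝ) (u : HOne N) : ∀ᵐ x, (c • u).fn x = c * u.fn x :=
  H1.fn_smul_ae (N := N) c u
theorem grad_add_ae (u v : HOne N) : ∀ᵐ x, (u + v).grad x = u.grad x + v.grad x :=
  H1.grad_add_ae (N := N) u v
theorem grad_sub_ae (u v : HOne N) : ∀ᵐ x, (u - v).grad x = u.grad x - v.grad x :=
  H1.grad_sub_ae (N := N) u v
theorem grad_smul_ae (c : ℝ) (u : HOne N) : ∀ᵐ x, (c • u).grad x = c • u.grad x :=
  H1.grad_smul_ae (N := N) c u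

theorem fn_sum_ae {ι : Type*} (s : Finset ι) (u : ι → HOne N) :
    ∀ᵐ x, (∑ i ∈ s, u i).fn x = ∑ i ∈ s, (u i).fn x := by
  classical
  induction s using Finset.induction_on with
  | empty => simpa using fn_zero_ae (N := N)
  | insert i s hi ih =>
    rw [Finset.sum_insert hi]
    filter_upwards [ih, fn_add_ae (u i) (∑ i ∈ s, u i)] with x h1 h2
    rw [h2, h1, Finset.sum_insert hi]

theorem memLp_fn (u : HOne N) : MemLp u.fn 2 volume := H1.memLp_fn (N := N) u
theorem memLp_grad (u : HOne N) : MemLp u.grad 2 volume := H1.memLp_grad (N := N) u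
theorem aesm_fn (u : HOne N) : AEStronglyMeasurable u.fn volume := H1.aesm_fn (N := N) u
theorem aesm_grad (u : HOne N) : AEStronglyMeasurable u.grad volume := H1.aesm_grad (N := N) u
theorem hasWeakGradient (u : HOne N) : HasWeakGradient u.fn u.grad := H1.hasWeakGradient (N := N) u

theorem integrable_fn_mul (u v : HOne N) : Integrable (fun x => u.fn x * v.fn x) :=
  H1.integrable_fn_mul (N := N) u v
theorem integrable_inner_grad (u v : HOne N) :
    Integrable (fun x => inner ℝ (u.grad x) (v.grad x)) :=
  H1.integrable_inner_grad (N := N) u v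

theorem inner_eq (u v : HOne N) :
    inner ℝ u v = (∫ x, u.fn x * v.fn x) + ∫ x, inner ℝ (u.grad x) (v.grad x) :=
  H1.inner_eq (N := N) u v

theorem norm_sq_eq (u : HOne N) : ‖u‖ ^ 2 = (∫ x, u.fn x ^ 2) + ∫ x, ‖u.grad x‖ ^ 2 := by
  rw [← real_inner_self_eq_norm_sq, inner_eq]
  congr 1
  · congr 1; ext x; ring
  · congr 1; ext x; rw [real_inner_self_eq_norm_sq]

theorem integral_sq_fn_le (u : HOne N) : ∫ x, u.fn x ^ 2 ≤ ‖u‖ ^ 2 := by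
  rw [norm_sq_eq]
  have : 0 ≤ ∫ x, ‖u.grad x‖ ^ 2 := integral_nonneg fun x => by positivity
  linarith

theorem integral_sq_grad_le (u : HOne N) : ∫ x, ‖u.grad x‖ ^ 2 ≤ ‖u‖ ^ 2 := by
  rw [norm_sq_eq]
  have : 0 ≤ ∫ x, u.fn x ^ 2 := integral_nonneg fun x => by positivity
  linarith

theorem integral_abs_fn_mul_le (u v : HOne N) : ∫ x, |u.fn x * v.fn x| ≤ ‖u‖ * ‖v‖ :=
  integral_abs_mul_le_of_sq u.memLp_fn v.memLp_fn (norm_nonneg _) (norm_nonneg _)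
    u.integral_sq_fn_le v.integral_sq_fn_le

theorem integral_fn_mul_grad_le (u v : HOne N) :
    ∫ x, |u.fn x| * ‖v.grad x‖ ≤ ‖u‖ * ‖v‖ := by
  have h := integral_abs_mul_le_of_sq u.memLp_fn v.memLp_grad.norm (norm_nonneg u) (norm_nonneg v)
    u.integral_sq_fn_le v.integral_sq_grad_le
  simpa only [abs_mul, abs_norm] using h

theorem integrable_fn_mul_grad (u v : HOne N) : Integrable (fun x => |u.fn x| * ‖v.grad x‖) :=
  MemLp.integrable_mul (q := 2) u.memLp_fn.norm v.memLp_grad.norm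

/-- The form `(u, v) ↦ ∫ u v`. -/
def l2Form (N : ℕ) : HOne N →L[ℝ] HOne N →L[ℝ] ℝ :=
  LinearMap.mkContinuous₂
    (LinearMap.mk₂ ℝ (fun z w : HOne N => ∫ x, z.fn x * w.fn x)
      (fun z z' w => by
        rw [← integral_add (integrable_fn_mul z w) (integrable_fn_mul z' w)]
        refine integral_congr_ae ?_
        filter_upwards [fn_add_ae z z'] with x hx
        rw [hx]; ring)
      (fun a z w => by
        rw [smul_eq_mul, ← integral_const_mul]
        refine integral_congr_ae ?_
        filter_upwards [fn_smul_ae a z] with x hx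
        rw [hx]; ring)
      (fun z w w' => by
        rw [← integral_add (integrable_fn_mul z w) (integrable_fn_mul z w')]
        refine integral_congr_ae ?_
        filter_upwards [fn_add_ae w w'] with x hx
        rw [hx]; ring)
      (fun a z w => by
        rw [smul_eq_mul, ← integral_const_mul]
        refine integral_congr_ae ?_
        filter_upwards [fn_smul_ae a w] with x hx
        rw [hx]; ring))
    1 (fun z w => by
      rw [one_mul]
      exact (abs_integral_le_integral_abs).trans (integral_abs_fn_mul_le z w))

theorem l2Form_apply (u v : HOne N) : l2Form N u v = ∫ x, u.fn x * v.fn x := rfl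

theorem l2Form_symm (u v : HOne N) : l2Form N u v = l2Form N v u := by
  rw [l2Form_apply, l2Form_apply]; congr 1; ext x; ring

theorem abs_l2Form_le (u v : HOne N) : |l2Form N u v| ≤ ‖u‖ * ‖v‖ :=
  (abs_integral_le_integral_abs).trans (integral_abs_fn_mul_le u v)

/-- The form `(u, v) ↦ ∫ ∇u · ∇v`. -/
def gradForm (N : ℕ) : HOne N →L[ℝ] HOne N →L[ℝ] ℝ :=
  LinearMap.mkContinuous₂ (innerₗ (HOne N)) 1
    (fun u v => by rw [one_mul]; exact norm_inner_le_norm u v) - l2Form N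

theorem gradForm_apply (u v : HOne N) : gradForm N u v = ∫ x, inner ℝ (u.grad x) (v.grad x) := by
  have h : gradForm N u v = inner ℝ u v - l2Form N u v := rfl
  rw [h, inner_eq, l2Form_apply, add_sub_cancel_left]

/-- The element of `H¹` defined by a square integrable function and its weak gradient. -/
def ofFun (u : Space N → ℝ) (g : Space N → Space N) (hu : MemLp u 2) (hg : MemLp g 2)
    (h : HasWeakGradient u g) : HOne N := H1.ofFun u g hu hg h

theorem ofFun_fn {u : Space N → ℝ} {g : Space N → Space N} (hu : MemLp u 2) (hg : MemLp g 2)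
    (h : HasWeakGradient u g) : ∀ᵐ x, (ofFun u g hu hg h).fn x = u x := hu.coeFn_toLp

theorem ofFun_grad {u : Space N → ℝ} {g : Space N → Space N} (hu : MemLp u 2) (hg : MemLp g 2)
    (h : HasWeakGradient u g) : ∀ᵐ x, (ofFun u g hu hg h).grad x = g x := hg.coeFn_toLp

/-- A test function as an element of `H¹`. -/
def ofTest (φ : Space N → ℝ) (h1 : ContDiff ℝ ∞ φ) (h2 : HasCompactSupport φ) : HOne N :=
  H1.ofTest φ h1 h2

theorem ofTest_fn (φ : Space N → ℝ) (h1 : ContDiff ℝ ∞ φ) (h2 : HasCompactSupport φ) :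
    ∀ᵐ x, (ofTest φ h1 h2).fn x = φ x := H1.ofTest_fn φ h1 h2

theorem ofTest_grad (φ : Space N → ℝ) (h1 : ContDiff ℝ ∞ φ) (h2 : HasCompactSupport φ) :
    ∀ᵐ x, (ofTest φ h1 h2).grad x = gradient φ x := H1.ofTest_grad φ h1 h2

theorem exists_seq_ofTest (u : HOne N) :
    ∃ (φ : ℕ → Space N → ℝ) (h1 : ∀ k, ContDiff ℝ ∞ (φ k)) (h2 : ∀ k, HasCompactSupport (φ k)),
      Tendsto (fun k => ofTest (φ k) (h1 k) (h2 k)) atTop (𝓝 u) ∧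
      ∀ᵐ x, Tendsto (fun k => φ k x) atTop (𝓝 (u.fn x)) := H1.exists_seq_ofTest (N := N) u

theorem tendsto_eLpNorm_fn {u : ℕ → HOne N} {v : HOne N} (h : Tendsto u atTop (𝓝 v)) :
    Tendsto (fun k => eLpNorm (fun x => (u k).fn x - v.fn x) 2 volume) atTop (𝓝 0) :=
  H1.tendsto_eLpNorm_fn (N := N) h

theorem tendsto_eLpNorm_grad {u : ℕ → HOne N} {v : HOne N} (h : Tendsto u atTop (𝓝 v)) :
    Tendsto (fun k => eLpNorm (fun x => (u k).grad x - v.grad x) 2 volume) atTop (𝓝 0) :=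
  H1.tendsto_eLpNorm_grad (N := N) h

/-- Translation in `H¹`. -/
def translate (b : Space N) (u : HOne N) : HOne N := H1.translate (N := N) b u

theorem translate_fn_ae (b : Space N) (u : HOne N) : ∀ᵐ x, (u.translate b).fn x = u.fn (x - b) :=
  H1.translate_fn_ae (N := N) b u
theorem translate_grad_ae (b : Space N) (u : HOne N) :
    ∀ᵐ x, (u.translate b).grad x = u.grad (x - b) := H1.translate_grad_ae (N := N) b u
theorem norm_translate (b : Space N) (u : HOne N) : ‖u.translate b‖ = ‖u‖ :=
  H1.norm_translate (N := N) b u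
theorem translate_sub (b : Space N) (u v : HOne N) :
    (u - v).translate b = u.translate b - v.translate b := H1.translate_sub (N := N) b u v
theorem translate_translate (b c : Space N) (u : HOne N) :
    (u.translate b).translate c = u.translate (b + c) := H1.translate_translate (N := N) b c u
theorem translate_zero (u : HOne N) : u.translate 0 = u := H1.translate_zero (N := N) u

/-- The product of a function in `H¹` with a cutoff function. -/
def mulCutoff {χ : Space N → ℝ} {B κ : ℝ} (h : IsCutoff χ B κ) (u : HOne N) : HOne N :=
  H1.mulCutoff (N := N) h u

variable {χ : Space N → ℝ} {B κ : ℝ} (h : IsCutoff χ B κ)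

theorem mulCutoff_fn (u : HOne N) : ∀ᵐ x, (mulCutoff h u).fn x = χ x * u.fn x :=
  H1.mulCutoff_fn (N := N) h u
theorem mulCutoff_grad (u : HOne N) :
    ∀ᵐ x, (mulCutoff h u).grad x = χ x • u.grad x + u.fn x • gradient χ x :=
  H1.mulCutoff_grad (N := N) h u
theorem norm_mulCutoff_le (u : HOne N) : ‖mulCutoff h u‖ ≤ (2 * B + κ) * ‖u‖ :=
  H1.norm_mulCutoff_le (N := N) h u

theorem tendsto_mulCutoff (u : HOne N) :
    Tendsto (fun k : ℕ => mulCutoff (isCutoff_ballCutoff (0 : Space N) (Nat.cast_add_one_pos k)) u)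
      atTop (𝓝 u) := H1.tendsto_mulCutoff (N := N) u

end HOne

end

/-! ### Functions acting as bounded forms and functionals on `H¹`. -/

section

variable {N : ℕ}

/-- Multiplication by `c` defines a bilinear form on `H¹`, bounded by `κ`. -/
structure IsMultiplier (c : Space N → ℝ) (κ : ℝ) : Prop where
  aesm : AEStronglyMeasurable c volume
  integrable : ∀ z w : HOne N, Integrable (fun x => c x * z.fn x * w.fn x)
  bound : ∀ z w : HOne N, ∫ x, |c x * z.fn x * w.fn x| ≤ κ * ‖z‖ * ‖w‖

/-- Integration against `h` defines a functional on `H¹`, bounded by `κ`. -/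
structure IsSource (h : Space N → ℝ) (κ : ℝ) : Prop where
  integrable : ∀ w : HOne N, Integrable (fun x => h x * w.fn x)
  bound : ∀ w : HOne N, ∫ x, |h x * w.fn x| ≤ κ * ‖w‖

namespace IsMultiplier

variable {c d : Space N → ℝ} {κ η : ℝ}

theorem mono_bound (h : IsMultiplier c κ) (hk : κ ≤ η) : IsMultiplier c η :=
  ⟨h.aesm, h.integrable, fun z w => (h.bound z w).trans (by gcongr)⟩

theorem mono (h : IsMultiplier d κ) (hc : AEStronglyMeasurable c volume)
    (hcd : ∀ᵐ x, |c x| ≤ d x) : IsMultiplier c κ := by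
  have hle : ∀ z w : HOne N, ∀ᵐ x, |c x * z.fn x * w.fn x| ≤ |d x * z.fn x * w.fn x| := by
    intro z w
    filter_upwards [hcd] with x hx
    rw [abs_mul, abs_mul, abs_mul, abs_mul]
    have := hx.trans (le_abs_self _)
    gcongr
  have hi : ∀ z w : HOne N, Integrable (fun x => c x * z.fn x * w.fn x) := fun z w =>
    (h.integrable z w).mono ((hc.mul z.aesm_fn).mul w.aesm_fn) (hle z w)
  exact ⟨hc, hi, fun z w => (integral_mono_ae (hi z w).abs (h.integrable z w).abs
    (hle z w)).trans (h.bound z w)⟩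

theorem add (hc : IsMultiplier c κ) (hd : IsMultiplier d η) :
    IsMultiplier (fun x => c x + d x) (κ + η) := by
  have hi : ∀ z w : HOne N, Integrable (fun x => (c x + d x) * z.fn x * w.fn x) := by
    intro z w
    refine ((hc.integrable z w).add (hd.integrable z w)).congr (Eventually.of_forall fun x => ?_)
    simp only [Pi.add_apply]; ring
  refine ⟨hc.aesm.add hd.aesm, hi, fun z w => ?_⟩
  calc ∫ x, |(c x + d x) * z.fn x * w.fn x|
      ≤ ∫ x, (|c x * z.fn x * w.fn x| + |d x * z.fn x * w.fn x|) := by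
        refine integral_mono (hi z w).abs ((hc.integrable z w).abs.add (hd.integrable z w).abs)
          fun x => ?_
        simp only
        rw [add_mul, add_mul]; exact abs_add_le _ _
    _ = _ := integral_add (hc.integrable z w).abs (hd.integrable z w).abs
    _ ≤ κ * ‖z‖ * ‖w‖ + η * ‖z‖ * ‖w‖ := add_le_add (hc.bound z w) (hd.bound z w)
    _ = _ := by ring

theorem const_mul (hc : IsMultiplier c κ) {a : ℝ} (ha : 0 ≤ a) :
    IsMultiplier (fun x => a * c x) (a * κ) := by
  refine ⟨hc.aesm.const_mul a, fun z w => ?_, fun z w => ?_⟩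
  · refine ((hc.integrable z w).const_mul a).congr (Eventually.of_forall fun x => ?_)
    simp only; ring
  · have : ∀ x, |a * c x * z.fn x * w.fn x| = a * |c x * z.fn x * w.fn x| := by
      intro x
      rw [mul_assoc a, mul_assoc a, abs_mul, abs_of_nonneg ha]
    simp only [this]
    rw [integral_const_mul]
    calc _ ≤ a * (κ * ‖z‖ * ‖w‖) := mul_le_mul_of_nonneg_left (hc.bound z w) ha
      _ = _ := by ring

theorem of_bounded {A : ℝ} (hA : 0 ≤ A) (hc : AEStronglyMeasurable c volume)
    (h : ∀ᵐ x, |c x| ≤ A) : IsMultiplier c A := by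
  have hone : IsMultiplier (fun _ : Space N => (1 : ℝ)) 1 := by
    refine ⟨aestronglyMeasurable_const, fun z w => by simpa using HOne.integrable_fn_mul z w,
      fun z w => ?_⟩
    simp only [one_mul]
    exact HOne.integral_abs_fn_mul_le z w
  have h2 := hone.const_mul hA
  simp only [mul_one] at h2
  exact h2.mono hc h

end IsMultiplier

theorem HasSobolevBound.exists_integral_le {q : ℝ} (hq : 0 < q) (h : HasSobolevBound N q) :
    ∃ C : ℝ, 0 ≤ C ∧ ∀ u : HOne N, Integrable (fun x => |u.fn x| ^ q) ∧
      ∫ x, |u.fn x| ^ q ≤ C * ‖u‖ ^ q := by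
  obtain ⟨C, hC⟩ := h
  refine ⟨C, C.2, fun u => ?_⟩
  have hm : AEStronglyMeasurable (fun x => |u.fn x| ^ q) volume :=
    (Real.continuous_rpow_const hq.le).comp_aestronglyMeasurable u.aesm_fn.norm
  have e1 : ∀ x, ENNReal.ofReal (|u.fn x| ^ q) = ‖u.fn x‖ₑ ^ q := by
    intro x
    rw [← ofReal_norm, ENNReal.ofReal_rpow_of_nonneg (norm_nonneg _) hq.le, Real.norm_eq_abs]
  have e2 : (C : ℝ≥0∞) * ‖u‖ₑ ^ q = ENNReal.ofReal (C * ‖u‖ ^ q) := by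
    rw [← ofReal_norm, ENNReal.ofReal_rpow_of_nonneg (norm_nonneg _) hq.le,
      ENNReal.ofReal_mul NNReal.zero_le_coe, ENNReal.ofReal_coe_nnreal]
  have h1 : ∫⁻ x, ‖u.fn x‖ₑ ^ q ≤ C * ‖u‖ₑ ^ q := hC u
  simp only [← e1] at h1
  rw [e2] at h1
  constructor
  · refine ⟨hm, ?_⟩
    rw [hasFiniteIntegral_iff_ofReal (Eventually.of_forall fun x => by positivity)]
    exact h1.trans_lt ENNReal.ofReal_lt_top
  · rw [integral_eq_lintegral_of_nonneg_ae (Eventually.of_forall fun x => by positivity) hm]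
    exact ENNReal.toReal_le_of_le_ofReal (mul_nonneg C.2 (by positivity)) h1

/-- Replacing each of the three factors by the largest gives its `q`-th power, since the exponents
add up to `q`. -/
theorem rpow_mul_mul_le {q : ℝ} (hq : 2 < q) {a b c : ℝ} (ha : 0 ≤ a) (hb : 0 ≤ b) (hc : 0 ≤ c) :
    a ^ (q - 2) * b * c ≤ a ^ q + b ^ q + c ^ q := by
  have key : ∀ M : ℝ, a ≤ M → b ≤ M → c ≤ M → a ^ (q - 2) * b * c ≤ M ^ q := by
    intro M h1 h2 h3
    rcases (ha.trans h1).eq_or_lt with h0 | h0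
    · have : b = 0 := le_antisymm (h0 ▸ h2) hb
      rw [this]; simp; positivity
    · calc a ^ (q - 2) * b * c ≤ M ^ (q - 2) * M * M := by gcongr
        _ = M ^ q := by
          rw [mul_assoc, ← pow_two, ← Real.rpow_natCast M 2, ← Real.rpow_add h0]
          norm_num
  have h1 : 0 ≤ a ^ q := by positivity
  have h2 : 0 ≤ b ^ q := by positivity
  have h3 : 0 ≤ c ^ q := by positivity
  rcases le_total a b with hab | hab <;> rcases le_total b c with hbc | hbc <;>
    rcases le_total a c with hac | hac
  · linarith [key c hac hbc le_rfl]
  · linarith [key c (hab.trans hbc) hbc le_rfl]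
  · linarith [key b hab le_rfl hbc]
  · linarith [key b hab le_rfl hbc]
  · linarith [key c hac hbc le_rfl]
  · linarith [key a le_rfl hab hac]
  · linarith [key a le_rfl hab (hbc.trans hab)]
  · linarith [key a le_rfl hab hac]

/-- A substitute for the three-factor Hölder inequality: the pointwise bound by `|r|^q + |z|^q +
|w|^q` together with the Sobolev bound gives an inhomogeneous estimate, and scaling the three
functions to norm one makes it homogeneous. -/
theorem HasSobolevBound.exists_isMultiplier_rpow {q : ℝ} (hq : 2 < q) (h : HasSobolevBound N q) :
    ∃ S : ℝ, 0 ≤ S ∧ ∀ r : HOne N,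
      IsMultiplier (fun x => |r.fn x| ^ (q - 2)) (S * ‖r‖ ^ (q - 2)) := by
  have hq0 : 0 < q := by linarith
  have hq2 : 0 < q - 2 := by linarith
  obtain ⟨C, hC, H⟩ := h.exists_integral_le hq0
  refine ⟨3 * C, by positivity, fun r => ?_⟩
  have hm : ∀ r : HOne N, AEStronglyMeasurable (fun x => |r.fn x| ^ (q - 2)) volume := fun r =>
    (Real.continuous_rpow_const hq2.le).comp_aestronglyMeasurable r.aesm_fn.norm
  have hle : ∀ (r z w : HOne N) (x : Space N), |(|r.fn x| ^ (q - 2) * z.fn x * w.fn x)|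
      ≤ |r.fn x| ^ q + |z.fn x| ^ q + |w.fn x| ^ q := by
    intro r z w x
    rw [abs_mul, abs_mul, abs_of_nonneg (a := |r.fn x| ^ (q - 2)) (by positivity)]
    exact rpow_mul_mul_le hq (abs_nonneg _) (abs_nonneg _) (abs_nonneg _)
  have hi0 : ∀ r z w : HOne N,
      Integrable (fun x => |r.fn x| ^ q + |z.fn x| ^ q + |w.fn x| ^ q) := fun r z w =>
    ((H r).1.add (H z).1).add (H w).1
  have hi : ∀ r z w : HOne N, Integrable (fun x => |r.fn x| ^ (q - 2) * z.fn x * w.fn x) :=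
    fun r z w => (hi0 r z w).mono' (((hm r).mul z.aesm_fn).mul w.aesm_fn)
      (Eventually.of_forall (hle r z w))
  have hb : ∀ r z w : HOne N, ∫ x, |(|r.fn x| ^ (q - 2) * z.fn x * w.fn x)|
      ≤ C * (‖r‖ ^ q + ‖z‖ ^ q + ‖w‖ ^ q) := by
    intro r z w
    refine (integral_mono (hi r z w).abs (hi0 r z w) (hle r z w)).trans ?_
    have e1 := integral_add ((H r).1.add (H z).1) (H w).1
    have e2 := integral_add (H r).1 (H z).1
    simp only [Pi.add_apply] at e1
    rw [e1, e2]
    linarith [(H r).2, (H z).2, (H w).2]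
  refine ⟨hm r, hi r, fun z w => ?_⟩
  -- Vanishing functions cannot be normalized. For `r = 0` the integrand is zero because `q - 2 >
  -- 0`.
  by_cases hr0 : r = 0
  · have : ∫ x, |(|r.fn x| ^ (q - 2) * z.fn x * w.fn x)| = 0 := by
      rw [← integral_zero (Space N) ℝ]
      refine integral_congr_ae ?_
      filter_upwards [HOne.fn_zero_ae (N := N)] with x hx
      rw [hr0, hx, abs_zero, Real.zero_rpow hq2.ne']; simp
    rw [this]; positivity
  by_cases hz0 : z = 0
  · have : ∫ x, |(|r.fn x| ^ (q - 2) * z.fn x * w.fn x)| = 0 := by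
      rw [← integral_zero (Space N) ℝ]
      refine integral_congr_ae ?_
      filter_upwards [HOne.fn_zero_ae (N := N)] with x hx
      rw [hz0, hx]; simp
    rw [this]; positivity
  by_cases hw0 : w = 0
  · have : ∫ x, |(|r.fn x| ^ (q - 2) * z.fn x * w.fn x)| = 0 := by
      rw [← integral_zero (Space N) ℝ]
      refine integral_congr_ae ?_
      filter_upwards [HOne.fn_zero_ae (N := N)] with x hx
      rw [hw0, hx]; simp
    rw [this]; positivity
  have nr : 0 < ‖r‖ := norm_pos_iff.2 hr0
  have nz : 0 < ‖z‖ := norm_pos_iff.2 hz0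
  have nw : 0 < ‖w‖ := norm_pos_iff.2 hw0
  have h1 := hb (‖r‖⁻¹ • r) (‖z‖⁻¹ • z) (‖w‖⁻¹ • w)
  have e1 : ∫ x, |(|(‖r‖⁻¹ • r).fn x| ^ (q - 2) * (‖z‖⁻¹ • z).fn x * (‖w‖⁻¹ • w).fn x)|
      = (‖r‖ ^ (q - 2))⁻¹ * ‖z‖⁻¹ * ‖w‖⁻¹ * ∫ x, |(|r.fn x| ^ (q - 2) * z.fn x * w.fn x)| := by
    rw [← integral_const_mul]
    refine integral_congr_ae ?_
    filter_upwards [HOne.fn_smul_ae ‖r‖⁻¹ r, HOne.fn_smul_ae ‖z‖⁻¹ z, HOne.fn_smul_ae ‖w‖⁻¹ w]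
      with x h1 h2 h3
    rw [h1, h2, h3, abs_mul ‖r‖⁻¹, Real.mul_rpow (abs_nonneg _) (abs_nonneg _),
      abs_of_pos (inv_pos.2 nr), Real.inv_rpow nr.le]
    simp only [abs_mul]
    rw [abs_of_pos (inv_pos.2 nz), abs_of_pos (inv_pos.2 nw),
      abs_of_pos (inv_pos.2 (Real.rpow_pos_of_pos nr _))]
    ring
  rw [e1, norm_smul, norm_smul, norm_smul, norm_inv, norm_inv, norm_inv, norm_norm, norm_norm,
    norm_norm, inv_mul_cancel₀ nr.ne', inv_mul_cancel₀ nz.ne', inv_mul_cancel₀ nw.ne',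
    Real.one_rpow] at h1
  have nrq : 0 < ‖r‖ ^ (q - 2) := Real.rpow_pos_of_pos nr _
  have h2 : ∫ x, |(|r.fn x| ^ (q - 2) * z.fn x * w.fn x)|
      = (‖r‖ ^ (q - 2) * ‖z‖ * ‖w‖) * ((‖r‖ ^ (q - 2))⁻¹ * ‖z‖⁻¹ * ‖w‖⁻¹ *
        ∫ x, |(|r.fn x| ^ (q - 2) * z.fn x * w.fn x)|) := by
    field_simp
  rw [h2]
  calc _ ≤ (‖r‖ ^ (q - 2) * ‖z‖ * ‖w‖) * (C * (1 + 1 + 1)) := by gcongr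
    _ = _ := by ring

/-- Freezing one argument of the form turns pointwise Taylor bounds on `f` into `H⁻¹` bounds that
carry the factor `‖z‖`. -/
theorem IsMultiplier.isSource {c h : Space N → ℝ} {κ : ℝ} (hc : IsMultiplier c κ) {z : HOne N}
    (hm : AEStronglyMeasurable h volume) (hb : ∀ᵐ x, |h x| ≤ c x * |z.fn x|) :
    IsSource h (κ * ‖z‖) := by
  have hle : ∀ w : HOne N, ∀ᵐ x, |h x * w.fn x| ≤ |c x * z.fn x * w.fn x| := by
    intro w
    filter_upwards [hb] with x hx
    rw [abs_mul, abs_mul, abs_mul]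
    have : |h x| ≤ |c x| * |z.fn x| := hx.trans (by gcongr; exact le_abs_self _)
    gcongr
  have hi : ∀ w : HOne N, Integrable (fun x => h x * w.fn x) := fun w =>
    (hc.integrable z w).mono (hm.mul w.aesm_fn) (hle w)
  exact ⟨hi, fun w => (integral_mono_ae (hi w).abs (hc.integrable z w).abs (hle w)).trans
    (hc.bound z w)⟩

open Classical in
/-- The functional `w ↦ ∫ h w` on `H¹`, for a source `h`. -/
def srcForm (h : Space N → ℝ) : StrongDual ℝ (HOne N) :=
  if H : ∃ κ, IsSource h κ then
    LinearMap.mkContinuous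
      { toFun := fun w : HOne N => ∫ x, h x * w.fn x
        map_add' := fun v w => by
          rw [← integral_add (H.choose_spec.integrable v) (H.choose_spec.integrable w)]
          refine integral_congr_ae ?_
          filter_upwards [HOne.fn_add_ae v w] with x hx
          rw [hx, mul_add]
        map_smul' := fun a w => by
          rw [RingHom.id_apply, smul_eq_mul, ← integral_const_mul]
          refine integral_congr_ae ?_
          filter_upwards [HOne.fn_smul_ae a w] with x hx
          rw [hx]; ring }
      H.choose (fun w => (abs_integral_le_integral_abs).trans (H.choose_spec.bound w))
  else 0

theorem IsSource.srcForm_apply {h : Space N → ℝ} {κ : ℝ} (H : IsSource h κ) (w : HOne N) :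
    srcForm h w = ∫ x, h x * w.fn x := by
  rw [srcForm, dif_pos ⟨κ, H⟩]; rfl

open Classical in
/-- The form `(z, w) ↦ ∫ c z w` on `H¹`, for a multiplier `c`. -/
def multForm (c : Space N → ℝ) : HOne N →L[ℝ] HOne N →L[ℝ] ℝ :=
  if H : ∃ κ, IsMultiplier c κ then
    LinearMap.mkContinuous₂
      (LinearMap.mk₂ ℝ (fun z w : HOne N => ∫ x, c x * z.fn x * w.fn x)
        (fun z z' w => by
          rw [← integral_add (H.choose_spec.integrable z w) (H.choose_spec.integrable z' w)]
          refine integral_congr_ae ?_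
          filter_upwards [HOne.fn_add_ae z z'] with x hx
          rw [hx]; ring)
        (fun a z w => by
          rw [smul_eq_mul, ← integral_const_mul]
          refine integral_congr_ae ?_
          filter_upwards [HOne.fn_smul_ae a z] with x hx
          rw [hx]; ring)
        (fun z w w' => by
          rw [← integral_add (H.choose_spec.integrable z w) (H.choose_spec.integrable z w')]
          refine integral_congr_ae ?_
          filter_upwards [HOne.fn_add_ae w w'] with x hx
          rw [hx]; ring)
        (fun a z w => by
          rw [smul_eq_mul, ← integral_const_mul]
          refine integral_congr_ae ?_
          filter_upwards [HOne.fn_smul_ae a w] with x hx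
          rw [hx]; ring))
      H.choose (fun z w => (abs_integral_le_integral_abs).trans (H.choose_spec.bound z w))
  else 0

theorem IsMultiplier.multForm_apply {c : Space N → ℝ} {κ : ℝ} (H : IsMultiplier c κ) (z w : HOne N) :
    multForm c z w = ∫ x, c x * z.fn x * w.fn x := by
  rw [multForm, dif_pos ⟨κ, H⟩]; rfl

theorem IsMultiplier.norm_le {c : Space N → ℝ} {κ : ℝ} (H : IsMultiplier c κ) (hκ : 0 ≤ κ) :
    ‖multForm c‖ ≤ κ :=
  ContinuousLinearMap.opNorm_le_bound₂ _ hκ fun z w => by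
    rw [H.multForm_apply]; exact abs_integral_le_integral_abs.trans (H.bound z w)

theorem IsMultiplier.multForm_symm {c : Space N → ℝ} {κ : ℝ} (H : IsMultiplier c κ) (z w : HOne N) :
    multForm c z w = multForm c w z := by
  rw [H.multForm_apply, H.multForm_apply]
  congr 1; ext x; ring

theorem MemLp.isMultiplier {V : Space N → ℝ} (hV : MemLp V ∞ volume) :
    ∃ A, 0 ≤ A ∧ (∀ᵐ x, |V x| ≤ A) ∧ IsMultiplier V A := by
  have h : ∀ᵐ x, |V x| ≤ (eLpNorm V ∞ volume).toReal := by
    have := ae_le_eLpNormEssSup (f := V) (μ := (volume : Measure (Space N)))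
    filter_upwards [this] with x hx
    rw [← Real.norm_eq_abs, ← toReal_enorm]
    refine ENNReal.toReal_mono hV.eLpNorm_ne_top ?_
    rwa [eLpNorm_exponent_top]
  exact ⟨_, ENNReal.toReal_nonneg, h, IsMultiplier.of_bounded ENNReal.toReal_nonneg hV.1 h⟩

end

/-! ### The nonlinear operator, the energy and the Euler–Lagrange equation. -/

section

variable {N : ℕ}

/-- The functional `w ↦ ∫ f(u) w`. -/
def nlMap (f : ℝ → ℝ) (u : HOne N) : StrongDual ℝ (HOne N) := srcForm (fun x => f (u.fn x))

/-- The form `(z, w) ↦ ∫ f'(u) z w`. -/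
def nlForm (f : ℝ → ℝ) (u : HOne N) : HOne N →L[ℝ] HOne N →L[ℝ] ℝ :=
  multForm (fun x => deriv f (u.fn x))

theorem exists_pos_forall_mul_rpow_le {m : ℝ} (hm : 0 < m) (K : ℝ) {ε : ℝ} (hε : 0 < ε) :
    ∃ δ > 0, ∀ t : ℝ, 0 ≤ t → t ≤ δ → K * t ^ m ≤ ε := by
  have h1 : Tendsto (fun t : ℝ => K * t ^ m) (𝓝 0) (𝓝 0) := by
    have := ((Real.continuous_rpow_const hm.le).tendsto 0).const_mul K
    simpa [Real.zero_rpow hm.ne'] using this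
  obtain ⟨δ, hδ, H⟩ := Metric.eventually_nhds_iff.1 (h1.eventually_le_const hε)
  refine ⟨δ / 2, by positivity, fun t h0 ht => H ?_⟩
  rw [dist_zero_right, Real.norm_of_nonneg h0]; linarith

namespace HasGrowth

variable {q : ℝ} {f : ℝ → ℝ} (h : HasGrowth N q f)

include h

theorem exists_isMultiplier : ∃ S : ℝ, 0 ≤ S ∧ ∀ r : HOne N,
    IsMultiplier (fun x => |r.fn x| ^ (q - 2)) (S * ‖r‖ ^ (q - 2)) :=
  h.sobolev.exists_isMultiplier_rpow h.two_lt

theorem aesm_deriv (u : HOne N) : AEStronglyMeasurable (fun x => deriv f (u.fn x)) volume :=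
  h.continuous_deriv.comp_aestronglyMeasurable u.aesm_fn

theorem aesm_comp (u : HOne N) : AEStronglyMeasurable (fun x => f (u.fn x)) volume :=
  h.continuous.comp_aestronglyMeasurable u.aesm_fn

/-- The growth bound `|f'(s)| ≤ 1 + C |s|^(q-2)` is the sum of a bounded multiplier and a power
multiplier, whose norm is controlled by `‖u‖^(q-2)`. -/
theorem exists_bound_deriv (M : ℝ) : ∃ C : ℝ, 0 ≤ C ∧ ∀ u : HOne N, ‖u‖ ≤ M →
    IsMultiplier (fun x => deriv f (u.fn x)) C := by
  obtain ⟨S, hS, HS⟩ := h.exists_isMultiplier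
  obtain ⟨C, hC, H⟩ := h.exists_deriv_le one_pos
  refine ⟨1 + C * (S * |M| ^ (q - 2)), by positivity, fun u hu => ?_⟩
  have h1 : IsMultiplier (fun x => 1 + C * |u.fn x| ^ (q - 2)) (1 + C * (S * ‖u‖ ^ (q - 2))) :=
    (IsMultiplier.of_bounded zero_le_one aestronglyMeasurable_const (by simp)).add
      ((HS u).const_mul hC)
  refine (h1.mono (h.aesm_deriv u) (Eventually.of_forall fun x => H _)).mono_bound ?_
  have hp := h.exponent_pos.le
  gcongr
  exact hu.trans (le_abs_self M)

theorem isMultiplier_deriv (u : HOne N) : ∃ C, IsMultiplier (fun x => deriv f (u.fn x)) C :=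
  let ⟨C, _, H⟩ := h.exists_bound_deriv ‖u‖
  ⟨C, H u le_rfl⟩

theorem nlForm_apply (u z w : HOne N) :
    nlForm f u z w = ∫ x, deriv f (u.fn x) * z.fn x * w.fn x :=
  let ⟨_, H⟩ := h.isMultiplier_deriv u
  H.multForm_apply z w

theorem nlForm_symm (u z w : HOne N) : nlForm f u z w = nlForm f u w z :=
  let ⟨_, H⟩ := h.isMultiplier_deriv u
  H.multForm_symm z w

theorem exists_nlForm_le (M : ℝ) : ∃ C : ℝ, 0 ≤ C ∧ ∀ u : HOne N, ‖u‖ ≤ M → ‖nlForm f u‖ ≤ C :=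
  let ⟨C, hC, H⟩ := h.exists_bound_deriv M
  ⟨C, hC, fun u hu => (H u hu).norm_le hC⟩

theorem isSource_comp (u : HOne N) : ∃ κ, IsSource (fun x => f (u.fn x)) κ := by
  obtain ⟨S, hS, HS⟩ := h.exists_isMultiplier
  obtain ⟨C, hC, H⟩ := h.exists_abs_le one_pos
  exact ⟨_, ((IsMultiplier.of_bounded zero_le_one aestronglyMeasurable_const (by simp)).add
      ((HS u).const_mul hC)).isSource (h.aesm_comp u) (Eventually.of_forall fun x => H _)⟩

theorem nlMap_apply (u w : HOne N) : nlMap f u w = ∫ x, f (u.fn x) * w.fn x :=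
  let ⟨_, H⟩ := h.isSource_comp u
  H.srcForm_apply w

/-- `u ↦ f'(u)` is uniformly continuous on bounded sets. -/
theorem exists_nlForm_sub_le (M : ℝ) {ε : ℝ} (hε : 0 < ε) :
    ∃ δ > 0, ∀ u r : HOne N, ‖r‖ ≤ M → ‖u - r‖ ≤ δ → ‖nlForm f u - nlForm f r‖ ≤ ε := by
  obtain ⟨S, hS, HS⟩ := h.exists_isMultiplier
  have hp := h.exponent_pos
  -- Half of `ε` pays for the term `ε₁ (1 + |r|^(q-2))` uniformly on the ball of radius `M`. The
  -- other half pays for `|u - r|^(q-2)`, which is small in multiplier norm by the choice of `δ`.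
  set ε₁ : ℝ := ε / (2 * (1 + S * |M| ^ (q - 2))) with hε₁
  have hden : 0 < 1 + S * |M| ^ (q - 2) := by positivity
  obtain ⟨C, hC, H⟩ := h.exists_deriv_sub_le (ε := ε₁) (by positivity)
  obtain ⟨δ, hδ, Hδ⟩ := exists_pos_forall_mul_rpow_le hp (C * S) (half_pos hε)
  refine ⟨δ, hδ, fun u r hr hu => ?_⟩
  have hmul : IsMultiplier (fun x => deriv f (u.fn x) - deriv f (r.fn x)) ε := by
    have h1 : IsMultiplier (fun x => ε₁ * (1 + |r.fn x| ^ (q - 2))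
        + C * |(u - r).fn x| ^ (q - 2))
        (ε₁ * (1 + S * ‖r‖ ^ (q - 2)) + C * (S * ‖u - r‖ ^ (q - 2))) :=
      (((IsMultiplier.of_bounded zero_le_one aestronglyMeasurable_const (by simp)).add
        (HS r)).const_mul (by positivity)).add ((HS _).const_mul hC)
    refine (h1.mono ((h.aesm_deriv u).sub (h.aesm_deriv r)) ?_).mono_bound ?_
    · filter_upwards [HOne.fn_sub_ae u r] with x hx
      rw [hx]; exact H _ _
    · have h2 : ε₁ * (1 + S * ‖r‖ ^ (q - 2)) ≤ ε / 2 := by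
        calc ε₁ * (1 + S * ‖r‖ ^ (q - 2)) ≤ ε₁ * (1 + S * |M| ^ (q - 2)) := by
              gcongr; exact hr.trans (le_abs_self M)
          _ = ε / 2 := by rw [hε₁]; field_simp
      have h3 := Hδ ‖u - r‖ (norm_nonneg _) hu
      linarith
  obtain ⟨_, Hu⟩ := h.isMultiplier_deriv u
  obtain ⟨_, Hr⟩ := h.isMultiplier_deriv r
  refine ContinuousLinearMap.opNorm_le_bound₂ _ hε.le fun z w => ?_
  have e : (nlForm f u - nlForm f r) z w
      = ∫ x, (deriv f (u.fn x) - deriv f (r.fn x)) * z.fn x * w.fn x := by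
    rw [sub_apply, sub_apply, h.nlForm_apply,
      h.nlForm_apply, ← integral_sub (Hu.integrable z w) (Hr.integrable z w)]
    congr 1; ext x; ring
  rw [e]
  exact abs_integral_le_integral_abs.trans (hmul.bound z w)

/-- `u ↦ f(u)` is uniformly approximated by its linearization. -/
theorem exists_nlMap_sub_sub_le (M : ℝ) {ε : ℝ} (hε : 0 < ε) :
    ∃ δ > 0, ∀ u v r : HOne N, ‖r‖ ≤ M → ‖u - r‖ ≤ δ → ‖v - r‖ ≤ δ →
      ‖nlMap f u - nlMap f v - nlForm f r (u - v)‖ ≤ ε * ‖u - v‖ := by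
  obtain ⟨S, hS, HS⟩ := h.exists_isMultiplier
  have hp := h.exponent_pos
  set ε₁ : ℝ := ε / (2 * (1 + S * |M| ^ (q - 2))) with hε₁
  have hden : 0 < 1 + S * |M| ^ (q - 2) := by positivity
  obtain ⟨C, hC, H⟩ := h.exists_sub_sub_le (ε := ε₁) (by positivity)
  obtain ⟨δ, hδ, Hδ⟩ := exists_pos_forall_mul_rpow_le hp (C * S) (ε := ε / 4) (by positivity)
  refine ⟨δ, hδ, fun u v r hr hu hv => ?_⟩
  have h1 : IsMultiplier (fun x => ε₁ * (1 + |r.fn x| ^ (q - 2))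
        + C * (|(u - r).fn x| ^ (q - 2) + |(v - r).fn x| ^ (q - 2)))
        (ε₁ * (1 + S * ‖r‖ ^ (q - 2)) + C * (S * ‖u - r‖ ^ (q - 2) + S * ‖v - r‖ ^ (q - 2))) :=
      (((IsMultiplier.of_bounded zero_le_one aestronglyMeasurable_const (by simp)).add
        (HS r)).const_mul (by positivity)).add (((HS _).add (HS _)).const_mul hC)
  have h2 := h1.mono_bound (η := ε) (by
    have h2 : ε₁ * (1 + S * ‖r‖ ^ (q - 2)) ≤ ε / 2 := by
      calc ε₁ * (1 + S * ‖r‖ ^ (q - 2)) ≤ ε₁ * (1 + S * |M| ^ (q - 2)) := by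
            gcongr; exact hr.trans (le_abs_self M)
        _ = ε / 2 := by rw [hε₁]; field_simp
    have h3 := Hδ ‖u - r‖ (norm_nonneg _) hu
    have h4 := Hδ ‖v - r‖ (norm_nonneg _) hv
    linarith)
  have hm : AEStronglyMeasurable
      (fun x => f (u.fn x) - f (v.fn x) - deriv f (r.fn x) * (u.fn x - v.fn x)) volume :=
    ((h.aesm_comp u).sub (h.aesm_comp v)).sub ((h.aesm_deriv r).mul (u.aesm_fn.sub v.aesm_fn))
  have hsrc : IsSource
      (fun x => f (u.fn x) - f (v.fn x) - deriv f (r.fn x) * (u.fn x - v.fn x)) (ε * ‖u - v‖) := by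
    refine h2.isSource hm ?_
    filter_upwards [HOne.fn_sub_ae u r, HOne.fn_sub_ae v r, HOne.fn_sub_ae u v] with x h3 h4 h5
    rw [h3, h4, h5]; exact H _ _ _
  obtain ⟨_, Hu⟩ := h.isSource_comp u
  obtain ⟨_, Hv⟩ := h.isSource_comp v
  obtain ⟨_, Hr⟩ := h.isMultiplier_deriv r
  refine ContinuousLinearMap.opNorm_le_bound _ (by positivity) fun w => ?_
  have i1 := integral_sub ((Hu.integrable w).sub (Hv.integrable w)) (Hr.integrable (u - v) w)
  simp only [Pi.sub_apply] at i1
  have e : (nlMap f u - nlMap f v - nlForm f r (u - v)) w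
      = ∫ x, (f (u.fn x) - f (v.fn x) - deriv f (r.fn x) * (u.fn x - v.fn x)) * w.fn x := by
    rw [sub_apply, sub_apply, h.nlForm_apply,
      h.nlMap_apply, h.nlMap_apply, ← integral_sub (Hu.integrable w) (Hv.integrable w), ← i1]
    refine integral_congr_ae ?_
    filter_upwards [HOne.fn_sub_ae u v] with x hx
    rw [hx]; ring
  rw [e]
  exact abs_integral_le_integral_abs.trans (hsrc.bound w)

/-- The increment is its linearization, bounded by a multiple of `‖u - r‖`, plus a remainder that is
at most `‖u - r‖`. -/
theorem exists_nlMap_sub_le (M : ℝ) {ε : ℝ} (hε : 0 < ε) :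
    ∃ δ > 0, ∀ u r : HOne N, ‖r‖ ≤ M → ‖u - r‖ ≤ δ → ‖nlMap f u - nlMap f r‖ ≤ ε := by
  obtain ⟨δ, hδ, H⟩ := h.exists_nlMap_sub_sub_le M one_pos
  obtain ⟨C, hC, HC⟩ := h.exists_nlForm_le M
  refine ⟨min δ (ε / (1 + C)), by positivity, fun u r hr hu => ?_⟩
  have h1 := H u r r hr (hu.trans (min_le_left _ _)) (by simpa using hδ.le)
  have h2 : ‖nlForm f r (u - r)‖ ≤ C * ‖u - r‖ :=
    (ContinuousLinearMap.le_opNorm _ _).trans (by gcongr; exact HC r hr)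
  calc ‖nlMap f u - nlMap f r‖
      = ‖(nlMap f u - nlMap f r - nlForm f r (u - r)) + nlForm f r (u - r)‖ := by
        congr 1; abel
    _ ≤ 1 * ‖u - r‖ + C * ‖u - r‖ := (norm_add_le _ _).trans (add_le_add h1 h2)
    _ = (1 + C) * ‖u - r‖ := by ring
    _ ≤ (1 + C) * (ε / (1 + C)) := by gcongr; exact hu.trans (min_le_right _ _)
    _ = ε := by field_simp

end HasGrowth

/-- The form `(u, w) ↦ ∫ ∇u · ∇w + V u w`. -/
def linForm (V : Space N → ℝ) : HOne N →L[ℝ] HOne N →L[ℝ] ℝ := HOne.gradForm N + multForm V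

theorem linForm_apply {V : Space N → ℝ} {A : ℝ} (hV : IsMultiplier V A) (u w : HOne N) :
    linForm V u w = ∫ x, (inner ℝ (u.grad x) (w.grad x) + V x * u.fn x * w.fn x) := by
  rw [linForm, add_apply, add_apply, HOne.gradForm_apply,
    hV.multForm_apply, ← integral_add (HOne.integrable_inner_grad u w) (hV.integrable u w)]

theorem linForm_symm {V : Space N → ℝ} {A : ℝ} (hV : IsMultiplier V A) (u w : HOne N) :
    linForm V u w = linForm V w u := by
  rw [linForm_apply hV, linForm_apply hV]
  congr 1; ext x; rw [real_inner_comm]; ring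

theorem HasGrowth.isSource_primitive {q : ℝ} {f : ℝ → ℝ} (h : HasGrowth N q f) (u : HOne N) :
    Integrable (fun x => ∫ t in (0 : ℝ)..(u.fn x), f t) := by
  obtain ⟨S, hS, HS⟩ := h.exists_isMultiplier
  obtain ⟨C, hC, H⟩ := h.exists_primitive_sub_le
  have hc : Continuous (fun s : ℝ => ∫ t in (0 : ℝ)..s, f t) :=
    continuous_iff_continuousAt.2 fun s => (h.hasDerivAt_primitive s).continuousAt
  have h1 := ((IsMultiplier.of_bounded (N := N) (c := fun _ => 2) zero_le_two
    aestronglyMeasurable_const (by simp)).add ((HS u).const_mul hC)).integrable u u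
  refine h1.mono (hc.comp_aestronglyMeasurable u.aesm_fn) (Eventually.of_forall fun x => ?_)
  have h2 := H 0 (u.fn x)
  rw [abs_zero, Real.zero_rpow h.exponent_pos.ne', h.zero] at h2
  simp only [zero_add, intervalIntegral.integral_same, sub_zero, zero_mul, mul_zero,
    add_zero] at h2
  refine h2.trans ?_
  rw [Real.norm_eq_abs, abs_mul, abs_mul]
  gcongr
  exact le_abs_self _

/-- The energy, as a function on `HOne N`. -/
def HOne.energy (V : Space N → ℝ) (f : ℝ → ℝ) (u : HOne N) : ℝ :=
  (1 / 2) * (∫ x, (‖u.grad x‖ ^ 2 + V x * u.fn x ^ 2)) - ∫ x, ∫ t in (0 : ℝ)..(u.fn x), f t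

/-- The energy is differentiable, with derivative `w ↦ ∫ ∇u · ∇w + V u w - f(u) w`. -/
theorem HasGrowth.hasFDerivAt_energy {q : ℝ} {f : ℝ → ℝ} (h : HasGrowth N q f)
    {V : Space N → ℝ} {A : ℝ} (hV : IsMultiplier V A) (u : HOne N) :
    HasFDerivAt (HOne.energy V f) (linForm V u - nlMap f u) u := by
  obtain ⟨S, hS, HS⟩ := h.exists_isMultiplier
  obtain ⟨C, hC, H⟩ := h.exists_primitive_sub_le
  have hp := h.exponent_pos.le
  have hE : ∀ w : HOne N, HOne.energy V f w
      = (1 / 2) * linForm V w w - ∫ x, ∫ t in (0 : ℝ)..(w.fn x), f t := by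
    intro w
    rw [HOne.energy, linForm_apply hV]
    congr 2
    refine integral_congr_ae (Eventually.of_forall fun x => ?_)
    simp only [real_inner_self_eq_norm_sq]; ring
  set K : ℝ := 2 + C * (S * ‖u‖ ^ (q - 2)) + C * S with hK
  obtain ⟨_, Hu⟩ := h.isSource_comp u
  -- The remainder of the energy is quadratic in `v`. The restriction `‖v‖ ≤ 1` only serves to bound
  -- the multiplier norm of `|v|^(q-2)`.
  have key : ∀ v : HOne N, ‖v‖ ≤ 1 → |HOne.energy V f (u + v) - HOne.energy V f u
      - (linForm V u - nlMap f u) v| ≤ (‖linForm (N := N) V‖ + K) * ‖v‖ ^ 2 := by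
    intro v hv
    have e1 : HOne.energy V f (u + v) - HOne.energy V f u - (linForm V u - nlMap f u) v
        = (1 / 2) * linForm V v v - ∫ x, ((∫ t in (0 : ℝ)..((u + v).fn x), f t)
          - (∫ t in (0 : ℝ)..(u.fn x), f t) - f (u.fn x) * v.fn x) := by
      have i1 := integral_sub ((h.isSource_primitive (u + v)).sub (h.isSource_primitive u))
        (Hu.integrable v)
      have i2 := integral_sub (h.isSource_primitive (u + v)) (h.isSource_primitive u)
      simp only [Pi.sub_apply] at i1
      have i3 : linForm V (u + v) (u + v)
          = linForm V u u + 2 * linForm V u v + linForm V v v := by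
        simp only [map_add, add_apply]; rw [linForm_symm hV v u]; ring
      rw [i1, i2, hE, hE, sub_apply, h.nlMap_apply, i3]
      ring
    have hmul : IsMultiplier (fun x => 2 + C * |u.fn x| ^ (q - 2) + C * |v.fn x| ^ (q - 2)) K := by
      refine (((IsMultiplier.of_bounded (N := N) (c := fun _ => 2) zero_le_two
        aestronglyMeasurable_const (by simp)).add ((HS u).const_mul hC)).add
        ((HS v).const_mul hC)).mono_bound ?_
      have : ‖v‖ ^ (q - 2) ≤ 1 := Real.rpow_le_one (norm_nonneg _) hv hp
      have : C * (S * ‖v‖ ^ (q - 2)) ≤ C * S := by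
        rw [← mul_assoc]; exact mul_le_of_le_one_right (by positivity) this
      rw [hK]; linarith
    have e2 : |∫ x, ((∫ t in (0 : ℝ)..((u + v).fn x), f t)
          - (∫ t in (0 : ℝ)..(u.fn x), f t) - f (u.fn x) * v.fn x)| ≤ K * ‖v‖ ^ 2 := by
      refine abs_integral_le_integral_abs.trans ?_
      have hb := hmul.bound v v
      rw [mul_assoc, ← pow_two] at hb
      refine le_trans (integral_mono_ae ?_ (hmul.integrable v v).abs ?_) hb
      · exact (((h.isSource_primitive (u + v)).sub (h.isSource_primitive u)).sub
          (Hu.integrable v)).abs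
      · filter_upwards [HOne.fn_add_ae u v] with x hx
        rw [hx]
        refine (H (u.fn x) (v.fn x)).trans ?_
        rw [abs_mul, abs_mul]
        gcongr
        exact le_abs_self _
    have e3 : |(1 / 2) * linForm V v v| ≤ ‖linForm (N := N) V‖ * ‖v‖ ^ 2 := by
      have h3 := (linForm V).le_opNorm₂ v v
      rw [Real.norm_eq_abs, mul_assoc, ← pow_two] at h3
      rw [abs_mul]
      norm_num
      linarith [abs_nonneg (linForm V v v)]
    rw [e1]
    refine (abs_sub _ _).trans ?_
    linarith
  rw [hasFDerivAt_iff_isLittleO_nhds_zero]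
  have hO : (fun v => HOne.energy V f (u + v) - HOne.energy V f u - (linForm V u - nlMap f u) v)
      =O[𝓝 0] fun v : HOne N => ‖v‖ ^ 2 := by
    refine Asymptotics.IsBigO.of_bound (‖linForm (N := N) V‖ + K) ?_
    filter_upwards [Metric.closedBall_mem_nhds (0 : HOne N) one_pos] with v hv
    rw [Real.norm_eq_abs, Real.norm_of_nonneg (by positivity)]
    exact key v (by simpa using hv)
  exact hO.trans_isLittleO (Asymptotics.isLittleO_norm_pow_id one_lt_two)

/-- The Euler-Lagrange equation of critical points. -/
theorem HasGrowth.isCriticalWith_iff {q : ℝ} {f : ℝ → ℝ} (h : HasGrowth N q f)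
    {V : Space N → ℝ} {A : ℝ} (hV : IsMultiplier V A) {α : ℝ} {u : HOne N} {lam : ℝ} :
    IsCriticalWith (N := N) V f α u lam ↔
      HOne.l2Form N u u = α ∧ linForm V u - nlMap f u = lam • HOne.l2Form N u := by
  have hd := h.hasFDerivAt_energy hV u
  have e : HOne.l2Form N u u = ∫ x, u.fn x ^ 2 := by
    rw [HOne.l2Form_apply]; congr 1; ext x; ring
  have e2 : (H1.l2Dual (N := N) u : StrongDual ℝ (HOne N)) = HOne.l2Form N u :=
    ContinuousLinearMap.ext fun w => H1.l2Dual_apply (N := N) u w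
  rw [e]
  constructor
  · rintro ⟨h1, h2⟩
    have h3 : HasFDerivAt (HOne.energy V f) (lam • HOne.l2Form N u) u := by
      rw [← e2]; exact h2
    exact ⟨h1, hd.unique h3⟩
  · rintro ⟨h1, h2⟩
    have h3 : HasFDerivAt (HOne.energy V f) (lam • HOne.l2Form N u) u := by
      rw [← h2]; exact hd
    have h4 := h3.congr_fderiv (congrArg (fun D : StrongDual ℝ (HOne N) => lam • D) e2.symm)
    exact ⟨h1, h4⟩

end

/-! ### Symmetric forms, bordered operators and a quantitative inverse function theorem. -/

section

section Hilbert

variable {E : Type*} [NormedAddCommGroup E] [InnerProductSpace ℝ E]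

/-- A symmetric form which is bounded below is surjective. -/
theorem exists_eq_of_symm_of_le [CompleteSpace E] {B : E →L[ℝ] E →L[ℝ] ℝ} (hs : ∀ v w, B v w = B w v) {c : ℝ}
    (hc : 0 < c) (hB : ∀ v, c * ‖v‖ ≤ ‖B v‖) (g : StrongDual ℝ E) : ∃ v, B v = g := by
  have hanti : AntilipschitzWith (Real.toNNReal c⁻¹) B := by
    refine AddMonoidHomClass.antilipschitz_of_bound B fun v => ?_
    rw [Real.coe_toNNReal _ (inv_nonneg.2 hc.le), ← div_eq_inv_mul, le_div_iff₀ hc, mul_comm]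
    exact hB v
  have hclosed : IsClosed (LinearMap.range B.toLinearMap : Set (StrongDual ℝ E)) := by
    rw [LinearMap.coe_range]
    exact hanti.isClosed_range B.uniformContinuous
  let J := InnerProductSpace.toDual ℝ E
  let K : Submodule ℝ E := (LinearMap.range B.toLinearMap).comap J.toLinearEquiv.toLinearMap
  have hK : IsClosed (K : Set E) := hclosed.preimage J.continuous
  have : CompleteSpace K := hK.completeSpace_coe
  have htop : K = ⊤ := by
    rw [← Submodule.orthogonal_eq_bot_iff, Submodule.eq_bot_iff]
    intro x hx
    -- By symmetry a vector orthogonal to the range, identified by the Riesz isomorphism with a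
    -- subspace of `E`, lies in the kernel of `B`. The lower bound makes that kernel trivial.
    have h1 : B x = 0 := by
      ext y
      have h2 : J.symm (B y) ∈ K := by
        change J (J.symm (B y)) ∈ LinearMap.range B.toLinearMap
        rw [LinearIsometryEquiv.apply_symm_apply]
        exact ⟨y, rfl⟩
      have h3 := (Submodule.mem_orthogonal K x).1 hx _ h2
      rw [InnerProductSpace.toDual_symm_apply] at h3
      rw [hs, h3]; rfl
    have h2 := hB x
    rw [h1, norm_zero] at h2
    exact norm_le_zero_iff.1 (nonpos_of_mul_nonpos_right h2 hc)
  have h1 : J.symm g ∈ K := htop ▸ Submodule.mem_top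
  have h2 : J (J.symm g) ∈ LinearMap.range B.toLinearMap := h1
  rw [LinearIsometryEquiv.apply_symm_apply] at h2
  exact h2

/-- A continuous bijective operator into a Banach space is bounded below. -/
theorem exists_le_norm_of_bijective [CompleteSpace E] {F : Type*} [NormedAddCommGroup F] [NormedSpace ℝ F]
    [CompleteSpace F] (B : E →L[ℝ] F) (h : Function.Bijective B) :
    ∃ c : ℝ, 0 < c ∧ ∀ v, c * ‖v‖ ≤ ‖B v‖ := by
  let e := ContinuousLinearEquiv.ofBijective B (LinearMap.ker_eq_bot.2 h.1)
    (LinearMap.range_eq_top.2 h.2)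
  refine ⟨(‖(e.symm : F →L[ℝ] E)‖ + 1)⁻¹, by positivity, fun v => ?_⟩
  rw [inv_mul_le_iff₀ (by positivity)]
  have h1 := (e.symm : F →L[ℝ] E).le_opNorm (B v)
  have h2 : (e.symm : F →L[ℝ] E) (B v) = v := e.symm_apply_apply v
  rw [h2] at h1
  nlinarith [norm_nonneg (B v)]

/-- The bordered operator `(v, μ) ↦ (L v - μ p, p v)`. -/
def bordered (L : E →L[ℝ] E →L[ℝ] ℝ) (p : StrongDual ℝ E) :
    (E × ℝ) →L[ℝ] (StrongDual ℝ E × ℝ) :=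
  (L ∘L ContinuousLinearMap.fst ℝ E ℝ - (ContinuousLinearMap.snd ℝ E ℝ).smulRight p).prod
    (p ∘L ContinuousLinearMap.fst ℝ E ℝ)

theorem bordered_apply (L : E →L[ℝ] E →L[ℝ] ℝ) (p : StrongDual ℝ E) (x : E × ℝ) :
    bordered L p x = (L x.1 - x.2 • p, p x.1) := rfl

/-- A Schur complement argument with an approximate solution `Z` of `L Z = p`. Pairing `L v - μ p`
with `Z` and using symmetry isolates `μ p(Z)`, so `μ` is controlled by the data and a small multiple
of `‖v‖`. The lower bound for `L` then controls `v`. The constants depend on `L`, `p` and `Z` only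
through the stated bounds, which makes them uniform over all bump configurations. -/
theorem exists_le_norm_bordered {c U M t : ℝ} (hc : 0 < c) (hU : 0 < U) (hM : 0 < M)
    (ht : 0 < t) : ∃ c' > 0, ∃ η > 0, ∀ (L : E →L[ℝ] E →L[ℝ] ℝ) (p : StrongDual ℝ E) (Z : E),
      (∀ v w, L v w = L w v) → (∀ v, c * ‖v‖ ≤ ‖L v‖) → ‖p‖ ≤ U → ‖Z‖ ≤ M → t ≤ |p Z| →
      ‖L Z - p‖ ≤ η → ∀ x, c' * ‖x‖ ≤ ‖bordered L p x‖ := by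
  set K₁ : ℝ := 2 / c * (1 + U * (1 + M) / t) with hK₁
  set K₂ : ℝ := (1 + M + c * K₁) / t with hK₂
  have h1 : 0 < K₁ := by positivity
  have h2 : 0 < K₂ := by positivity
  -- The tolerance is chosen so that the feedback `U η / t` of `‖v‖` through `μ` is at most `c / 2`
  -- and can be absorbed into `c ‖v‖`. It also satisfies `η ≤ c`.
  refine ⟨(K₁ + K₂)⁻¹, by positivity, c * t / (2 * U + t), by positivity,
    fun L p Z hs hL hp hZ hpZ hη x => ?_⟩
  obtain ⟨v, μ⟩ := x
  set η : ℝ := c * t / (2 * U + t) with hηd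
  have hη1 : U * η / t ≤ c / 2 := by
    rw [hηd, div_le_div_iff₀ ht two_pos, mul_div_assoc', div_mul_eq_mul_div,
      div_le_iff₀ (by positivity)]
    nlinarith [mul_pos hc ht, mul_pos (mul_pos hc ht) ht]
  have hη2 : η ≤ c := by
    rw [hηd, div_le_iff₀ (by positivity)]
    nlinarith [mul_pos hc hU]
  rw [inv_mul_le_iff₀ (by positivity), bordered_apply]
  set X : ℝ := ‖(L v - μ • p, p v)‖ with hX
  have hg : ‖L v - μ • p‖ ≤ X := norm_fst_le (L v - μ • p, p v)
  have hsn : |p v| ≤ X := norm_snd_le (L v - μ • p, p v)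
  have hX0 : 0 ≤ X := norm_nonneg _
  have hv0 := norm_nonneg v
  have e1 : μ * p Z = p v + (L Z - p) v - (L v - μ • p) Z := by
    simp only [sub_apply, smul_apply, smul_eq_mul]
    rw [hs v Z]; ring
  have h3 : |(L Z - p) v| ≤ η * ‖v‖ :=
    ((L Z - p).le_opNorm v).trans (by gcongr)
  have h4 : |(L v - μ • p) Z| ≤ X * M :=
    ((L v - μ • p).le_opNorm Z).trans (by gcongr)
  have h5 : |μ| * t ≤ X * (1 + M) + η * ‖v‖ := by
    calc |μ| * t ≤ |μ| * |p Z| := by gcongr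
      _ = |p v + (L Z - p) v - (L v - μ • p) Z| := by rw [← abs_mul, e1]
      _ ≤ |p v| + |(L Z - p) v| + |(L v - μ • p) Z| :=
          (abs_sub _ _).trans (by gcongr; exact abs_add_le _ _)
      _ ≤ X * (1 + M) + η * ‖v‖ := by linarith
  have h6 : c * ‖v‖ ≤ X + |μ| * U := by
    calc c * ‖v‖ ≤ ‖L v‖ := hL v
      _ = ‖(L v - μ • p) + μ • p‖ := by rw [sub_add_cancel]
      _ ≤ X + |μ| * U := by
          refine (norm_add_le _ _).trans ?_
          rw [norm_smul, Real.norm_eq_abs]; gcongr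
  have h7 : |μ| ≤ (X * (1 + M) + η * ‖v‖) / t := by rwa [le_div_iff₀ ht]
  have h8 : ‖v‖ ≤ K₁ * X := by
    have h9 : |μ| * U ≤ X * (U * (1 + M) / t) + c / 2 * ‖v‖ := by
      calc |μ| * U ≤ (X * (1 + M) + η * ‖v‖) / t * U := by gcongr
        _ = X * (U * (1 + M) / t) + U * η / t * ‖v‖ := by field_simp
        _ ≤ _ := by gcongr
    have h10 : c / 2 * ‖v‖ ≤ X * (1 + U * (1 + M) / t) := by linarith
    calc ‖v‖ = 2 / c * (c / 2 * ‖v‖) := by field_simp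
      _ ≤ 2 / c * (X * (1 + U * (1 + M) / t)) := by gcongr
      _ = K₁ * X := by rw [hK₁]; ring
  have h9 : |μ| ≤ K₂ * X := by
    refine h7.trans ?_
    have h10 : η * ‖v‖ ≤ c * (K₁ * X) := by gcongr
    have h11 : X * (1 + M) + η * ‖v‖ ≤ (1 + M + c * K₁) * X := by linarith
    exact (div_le_div_of_nonneg_right h11 ht.le).trans_eq (by rw [hK₂]; ring)
  refine max_le ?_ ?_
  · change ‖v‖ ≤ _
    nlinarith
  · change ‖μ‖ ≤ _
    rw [Real.norm_eq_abs]; nlinarith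

/-- With `L z = p` one must have `p z ≠ 0`, for otherwise `(z, 1)` would be a nonzero element of the
kernel. A solution of `L v = g` is then corrected by a multiple of `z` to reach the prescribed
second component. -/
theorem bordered_surjective [CompleteSpace E] {L : E →L[ℝ] E →L[ℝ] ℝ} {p : StrongDual ℝ E}
    (hs : ∀ v w, L v w = L w v) {c c' : ℝ} (hc : 0 < c) (hL : ∀ v, c * ‖v‖ ≤ ‖L v‖)
    (hc' : 0 < c') (h : ∀ x, c' * ‖x‖ ≤ ‖bordered L p x‖) :
    Function.Surjective (bordered L p) := by
  rintro ⟨g, s⟩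
  obtain ⟨z, hz⟩ := exists_eq_of_symm_of_le hs hc hL p
  obtain ⟨v, hv⟩ := exists_eq_of_symm_of_le hs hc hL g
  have hpz : p z ≠ 0 := by
    intro h0
    have h1 := h (z, 1)
    rw [bordered_apply] at h1
    simp only [hz, one_smul, sub_self, h0] at h1
    have h2 : ‖((0 : StrongDual ℝ E), (0 : ℝ))‖ = 0 := norm_zero
    rw [h2] at h1
    have h3 : ‖(z, (1 : ℝ))‖ ≤ 0 := nonpos_of_mul_nonpos_right h1 hc'
    have h4 : ‖(1 : ℝ)‖ ≤ 0 := (norm_snd_le (z, (1 : ℝ))).trans h3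
    norm_num at h4
  refine ⟨(v + ((s - p v) / p z) • z, (s - p v) / p z), ?_⟩
  rw [bordered_apply]
  simp only [map_add, map_smul, hv, hz, add_sub_cancel_right, smul_eq_mul]
  rw [div_mul_cancel₀ _ hpz, add_sub_cancel]

/-- Solutions of `A u - ν u = lam ℓ u`, `ℓ u u = α` near an approximate solution. -/
theorem exists_unique_constrained [CompleteSpace E] {A ℓ : E →L[ℝ] E →L[ℝ] ℝ} (hℓ : ∀ v w, ℓ v w = ℓ w v)
    (hℓ1 : ∀ v w, |ℓ v w| ≤ ‖v‖ * ‖w‖) {ν : E → StrongDual ℝ E} {K : E →L[ℝ] E →L[ℝ] ℝ}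
    {u₀ : E} {lam₀ α c δ : ℝ} (hc : 0 < c) (hδ : 2 * δ ≤ c / 4)
    (hlow : ∀ x, c * ‖x‖ ≤ ‖bordered (A - K - lam₀ • ℓ) (ℓ u₀) x‖)
    (hsurj : Function.Surjective (bordered (A - K - lam₀ • ℓ) (ℓ u₀)))
    (hν : ∀ u v, ‖u - u₀‖ ≤ δ → ‖v - u₀‖ ≤ δ → ‖ν u - ν v - K (u - v)‖ ≤ c / 4 * ‖u - v‖) :
    (∀ u lam u' lam', ‖u - u₀‖ ≤ δ → |lam - lam₀| ≤ δ → ‖u' - u₀‖ ≤ δ → |lam' - lam₀| ≤ δ →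
      A u - ν u = lam • ℓ u → ℓ u u = α → A u' - ν u' = lam' • ℓ u' → ℓ u' u' = α →
      u = u' ∧ lam = lam') ∧
    ∀ ε, 0 ≤ ε → ε ≤ δ → ‖A u₀ - ν u₀ - lam₀ • ℓ u₀‖ ≤ c / 2 * ε → |ℓ u₀ u₀ - α| ≤ c / 2 * ε →
      ∃ u lam, ‖u - u₀‖ ≤ ε ∧ |lam - lam₀| ≤ ε ∧ A u - ν u = lam • ℓ u ∧ ℓ u u = α := by
  set D := bordered (A - K - lam₀ • ℓ) (ℓ u₀) with hD
  -- The factor `1 / 2` makes the derivative of the constraint at `u₀` equal to `ℓ u₀`, the second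
  -- row of the bordered operator.
  set G : E × ℝ → StrongDual ℝ E × ℝ :=
    fun x => (A x.1 - ν x.1 - x.2 • ℓ x.1, 1 / 2 * (ℓ x.1 x.1 - α)) with hG
  have hzero : ∀ u lam, G (u, lam) = 0 ↔ A u - ν u = lam • ℓ u ∧ ℓ u u = α := by
    intro u lam
    simp only [hG, Prod.mk_eq_zero, sub_eq_zero, mul_eq_zero]
    norm_num
  have hmem : ∀ (x : E × ℝ) r, x ∈ Metric.closedBall (u₀, lam₀) r ↔
      ‖x.1 - u₀‖ ≤ r ∧ |x.2 - lam₀| ≤ r := by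
    intro x r
    rw [mem_closedBall_iff_norm, Prod.norm_def]
    simp
  have hℓn : ∀ v, ‖ℓ v‖ ≤ ‖v‖ := fun v =>
    ContinuousLinearMap.opNorm_le_bound _ (norm_nonneg _) (hℓ1 v)
  have happ : ∀ x ∈ Metric.closedBall (u₀, lam₀) δ, ∀ y ∈ Metric.closedBall (u₀, lam₀) δ,
      ‖G x - G y - D (x - y)‖ ≤ c / 2 * ‖x - y‖ := by
    rintro ⟨u, s⟩ hx ⟨v, t⟩ hy
    rw [hmem] at hx hy
    obtain ⟨hu, hs⟩ := hx
    obtain ⟨hv, ht⟩ := hy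
    simp only at hu hv hs ht
    have n1 : ‖u - v‖ ≤ ‖(u, s) - (v, t)‖ := norm_fst_le ((u, s) - (v, t))
    have n2 : |s - t| ≤ ‖(u, s) - (v, t)‖ := norm_snd_le ((u, s) - (v, t))
    set X := ‖(u, s) - (v, t)‖ with hX
    have hX0 : 0 ≤ X := norm_nonneg _
    have hδ0 : 0 ≤ δ := (norm_nonneg _).trans hu
    refine max_le ?_ ?_
    -- The deviation from linearity consists of the remainder of `ν` and of the bilinear coupling
    -- between `λ` and `u`. The latter contributes `2δ` times the distance, hence the requirement
    -- `2δ ≤ c / 4`.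
    · have e : (G (u, s) - G (v, t) - D ((u, s) - (v, t))).1
          = -(ν u - ν v - K (u - v)) - (s - lam₀) • ℓ (u - v) - (s - t) • ℓ (v - u₀) := by
        simp only [hG, hD, bordered_apply, Prod.fst_sub, sub_apply, smul_apply, map_sub]
        module
      rw [e]
      have b1 := hν u v hu hv
      have b2 : ‖(s - lam₀) • ℓ (u - v)‖ ≤ δ * X := by
        rw [norm_smul]; gcongr
        · exact hs
        · exact (hℓn _).trans n1
      have b3 : ‖(s - t) • ℓ (v - u₀)‖ ≤ X * δ := by
        rw [norm_smul]; gcongr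
        · exact n2
        · exact (hℓn _).trans hv
      calc _ ≤ ‖ν u - ν v - K (u - v)‖ + ‖(s - lam₀) • ℓ (u - v)‖ + ‖(s - t) • ℓ (v - u₀)‖ := by
            refine (norm_sub_le _ _).trans (add_le_add_left ((norm_sub_le _ _).trans ?_) _)
            rw [norm_neg]
        _ ≤ c / 4 * X + δ * X + X * δ := by
            gcongr
            exact b1.trans (by gcongr)
        _ ≤ c / 2 * X := by nlinarith
    · have e : (G (u, s) - G (v, t) - D ((u, s) - (v, t))).2
          = 1 / 2 * (ℓ (u - u₀) (u - v) + ℓ (v - u₀) (u - v)) := by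
        simp only [hG, hD, bordered_apply, Prod.snd_sub, sub_apply, map_sub]
        rw [hℓ v u]; ring
      rw [e, Real.norm_eq_abs, abs_mul]
      have b1 := hℓ1 (u - u₀) (u - v)
      have b2 := hℓ1 (v - u₀) (u - v)
      have b3 : ‖u - u₀‖ * ‖u - v‖ ≤ δ * X := by gcongr
      have b4 : ‖v - u₀‖ * ‖u - v‖ ≤ δ * X := by gcongr
      have b5 := abs_add_le (ℓ (u - u₀) (u - v)) (ℓ (v - u₀) (u - v))
      have b6 : |(1 / 2 : ℝ)| = 1 / 2 := by norm_num
      rw [b6]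
      nlinarith
  constructor
  · intro u lam u' lam' h1 h2 h3 h4 h5 h6 h7 h8
    have hx : G (u, lam) = 0 := (hzero _ _).2 ⟨h5, h6⟩
    have hy : G (u', lam') = 0 := (hzero _ _).2 ⟨h7, h8⟩
    have h9 := happ (u, lam) ((hmem _ _).2 ⟨h1, h2⟩) (u', lam') ((hmem _ _).2 ⟨h3, h4⟩)
    rw [hx, hy, sub_zero, zero_sub, norm_neg] at h9
    have h10 := hlow ((u, lam) - (u', lam'))
    -- For two zeros of `G`, the operator `D` expands their difference by at least `c`, while the
    -- approximation property allows at most `c / 2`.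
    have h11 : ‖(u, lam) - (u', lam')‖ ≤ 0 := by nlinarith
    have h12 := sub_eq_zero.1 (norm_le_zero_iff.1 h11)
    exact ⟨congrArg Prod.fst h12, congrArg Prod.snd h12⟩
  · intro ε hε0 hεδ h1 h2
    choose inv hinv using hsurj
    -- The lower bound gives a right inverse of norm at most `1 / c`. As `G` deviates from `D` by `c
    -- / 2`, the image of the ball of radius `ε` contains the ball of radius `(c - c / 2) ε` about
    -- `G (u₀, lam₀)`.
    let R : D.NonlinearRightInverse :=
      { toFun := inv
        nnnorm := Real.toNNReal c⁻¹
        bound' := fun y => by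
          rw [Real.coe_toNNReal _ (inv_nonneg.2 hc.le), ← div_eq_inv_mul, le_div_iff₀ hc, mul_comm]
          have := hlow (inv y)
          rwa [hinv] at this
        right_inv' := hinv }
    have hA : ApproximatesLinearOn G D (Metric.closedBall (u₀, lam₀) δ) (Real.toNNReal (c / 2)) := by
      intro x hx y hy
      rw [Real.coe_toNNReal _ (by positivity)]
      exact happ x hx y hy
    have hS := hA.surjOn_closedBall_of_nonlinearRightInverse R hε0
      (Metric.closedBall_subset_closedBall hεδ)
    have hr : ((R.nnnorm : ℝ)⁻¹ - (Real.toNNReal (c / 2) : ℝ)) = c / 2 := by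
      change (((Real.toNNReal c⁻¹ : NNReal) : ℝ))⁻¹ - _ = _
      rw [Real.coe_toNNReal _ (inv_nonneg.2 hc.le), Real.coe_toNNReal _ (by positivity), inv_inv]
      ring
    have hm : (0 : StrongDual ℝ E × ℝ) ∈ Metric.closedBall (G (u₀, lam₀))
        (((R.nnnorm : ℝ)⁻¹ - (Real.toNNReal (c / 2) : ℝ)) * ε) := by
      rw [hr, mem_closedBall_iff_norm, zero_sub, norm_neg]
      refine max_le h1 ?_
      change ‖1 / 2 * (ℓ u₀ u₀ - α)‖ ≤ _
      rw [Real.norm_eq_abs, abs_mul]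
      have : |(1 / 2 : ℝ)| = 1 / 2 := by norm_num
      rw [this]
      linarith [abs_nonneg (ℓ u₀ u₀ - α)]
    obtain ⟨⟨u, lam⟩, hx, hx0⟩ := hS hm
    rw [hmem] at hx
    exact ⟨u, lam, hx.1, hx.2, (hzero _ _).1 hx0⟩

end Hilbert

end

/-! ### Sums of distant translates. -/

section

variable {N : ℕ} {ι : Type*} [Fintype ι]

/-- The points `b i` have mutual distances at least `R`. -/
def Separated (b : ι → Space N) (R : ℝ) : Prop := ∀ i j, i ≠ j → R ≤ ‖b i - b j‖

omit [Fintype ι] in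
theorem Separated.mono {b : ι → Space N} {R S : ℝ} (h : Separated b R) (hS : S ≤ R) :
    Separated b S := fun i j hij => hS.trans (h i j hij)

namespace HOne

/-- `u` vanishes outside the ball of radius `ρ` around the origin. -/
def SuppIn (u : HOne N) (ρ : ℝ) : Prop := ∀ᵐ x, ρ ≤ ‖x‖ → u.fn x = 0

theorem exists_suppIn (u : HOne N) {ε : ℝ} (hε : 0 < ε) :
    ∃ ρ > 0, ∃ v : HOne N, SuppIn v ρ ∧ ‖u - v‖ ≤ ε := by
  obtain ⟨k, hk⟩ := ((Metric.tendsto_nhds.1 (tendsto_mulCutoff u)) ε hε).exists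
  refine ⟨2 * (k + 1), by positivity, _, ?_, by rw [← dist_eq_norm, dist_comm]; exact hk.le⟩
  filter_upwards [mulCutoff_fn (isCutoff_ballCutoff (0 : Space N) (Nat.cast_add_one_pos k)) u]
    with x hx hr
  rw [hx, ballCutoff_eq_zero (by positivity) (by rwa [sub_zero]), zero_mul]

theorem SuppIn.mono {u : HOne N} {ρ σ : ℝ} (h : SuppIn u ρ) (hs : ρ ≤ σ) : SuppIn u σ :=
  Eventually.mono h fun _ hx hr => hx (hs.trans hr)

theorem SuppIn.translate {u : HOne N} {ρ : ℝ} (h : SuppIn u ρ) (b : Space N) :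
    ∀ᵐ x, ρ ≤ ‖x - b‖ → (u.translate b).fn x = 0 := by
  filter_upwards [translate_fn_ae b u, H1.ae_sub h b] with x h1 h2 h3
  rw [h1, h2 h3]

omit [Fintype ι] in
theorem Separated.le_of_lt {b : ι → Space N} {ρ σ : ℝ} (h : Separated b (ρ + σ)) {i j : ι}
    (hij : j ≠ i) {x : Space N} (hx : ‖x - b i‖ < σ) : ρ ≤ ‖x - b j‖ := by
  have h1 := h i j hij.symm
  have h2 : ‖b i - b j‖ ≤ ‖x - b j‖ + ‖x - b i‖ := by
    have : b i - b j = (x - b j) - (x - b i) := by abel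
    rw [this]; exact norm_sub_le _ _
  linarith

/-- The balls carrying the translates are disjoint, so at almost every point at most one bump is
alive; outside all balls any index will do. Nonlinear expressions in a sum of bumps can therefore be
evaluated bump by bump. -/
theorem SuppIn.ae_exists_forall_ne [Nonempty ι] {u z : HOne N} {ρ : ℝ} (hu : SuppIn u ρ)
    (hz : SuppIn z ρ) {b : ι → Space N} (hb : Separated b (ρ + ρ)) :
    ∀ᵐ x, ∃ i, ∀ j, j ≠ i → (u.translate (b j)).fn x = 0 ∧ (z.translate (b j)).fn x = 0 := by
  filter_upwards [ae_all_iff.2 fun j => hu.translate (b j), ae_all_iff.2 fun j => hz.translate (b j)]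
    with x h1 h2
  by_cases h : ∃ i, ‖x - b i‖ < ρ
  · obtain ⟨i, hi⟩ := h
    exact ⟨i, fun j hj => ⟨h1 j (Separated.le_of_lt hb hj hi), h2 j (Separated.le_of_lt hb hj hi)⟩⟩
  · push Not at h
    exact ⟨Classical.arbitrary ι, fun j _ => ⟨h1 j (h j), h2 j (h j)⟩⟩

/-- The sum of the translates of `u` by the points `b i`. -/
def bumps (b : ι → Space N) (u : HOne N) : HOne N := ∑ i, u.translate (b i)

theorem bumps_sub (b : ι → Space N) (u v : HOne N) : bumps b (u - v) = bumps b u - bumps b v := by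
  simp only [bumps, translate_sub, Finset.sum_sub_distrib]

theorem norm_bumps_le (b : ι → Space N) (u : HOne N) : ‖bumps b u‖ ≤ Fintype.card ι * ‖u‖ := by
  refine (norm_sum_le _ _).trans ?_
  simp [norm_translate]

theorem bumps_fn_ae (b : ι → Space N) (u : HOne N) :
    ∀ᵐ x, (bumps b u).fn x = ∑ i, (u.translate (b i)).fn x := fn_sum_ae _ _

theorem l2Form_translate (b : Space N) (u v : HOne N) :
    l2Form N (u.translate b) (v.translate b) = l2Form N u v := by
  rw [l2Form_apply, l2Form_apply, ← integral_sub_right_eq_self (fun x => u.fn x * v.fn x) b]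
  refine integral_congr_ae ?_
  filter_upwards [translate_fn_ae b u, translate_fn_ae b v] with x h1 h2
  rw [h1, h2]

theorem gradForm_translate (b : Space N) (u v : HOne N) :
    gradForm N (u.translate b) (v.translate b) = gradForm N u v := by
  rw [gradForm_apply, gradForm_apply,
    ← integral_sub_right_eq_self (fun x => inner ℝ (u.grad x) (v.grad x)) b]
  refine integral_congr_ae ?_
  filter_upwards [translate_grad_ae b u, translate_grad_ae b v] with x h1 h2
  rw [h1, h2]

theorem translate_neg_translate (b : Space N) (u : HOne N) :
    (u.translate (-b)).translate b = u := by
  rw [translate_translate, neg_add_cancel, translate_zero]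

end HOne

open HOne

/-- The periods of `V`, taken modulo null sets, form an additive group. It contains the coordinate
vectors and hence the lattice. -/
theorem IsOnePeriodic.ae_sub {V : Space N → ℝ} (h : IsOnePeriodic V) (k : Fin N → ℤ) :
    ∀ᵐ x, V (x - latticePt k) = V x := by
  let G : AddSubgroup (Space N) :=
    { carrier := {b | ∀ᵐ x, V (x - b) = V x}
      zero_mem' := by
        change ∀ᵐ x, V (x - 0) = V x
        simp
      add_mem' := by
        intro b c hb hc
        change ∀ᵐ x, V (x - (b + c)) = V x
        filter_upwards [H1.ae_sub hb c, hc] with x h1 h2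
        rw [← h2, ← h1]; congr 1; abel
      neg_mem' := by
        intro b hb
        change ∀ᵐ x, V (x - -b) = V x
        filter_upwards [H1.ae_sub hb (-b)] with x h1
        rw [← h1]; congr 1; abel }
  have hG : ∀ i, EuclideanSpace.single i (1 : ℝ) ∈ G := by
    intro i
    have h1 : ∀ᵐ x, V (x - -EuclideanSpace.single i 1) = V x := by
      filter_upwards [h i] with x hx
      rw [sub_neg_eq_add, hx]
    exact neg_neg (EuclideanSpace.single i (1 : ℝ)) ▸ G.neg_mem h1
  have hk : latticePt k = ∑ i, k i • EuclideanSpace.single i (1 : ℝ) := by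
    ext j
    simp [latticePt, Pi.single_apply]
  have : latticePt k ∈ G := by
    rw [hk]
    exact G.sum_mem fun i _ => G.zsmul_mem (hG i) _
  exact this

/-- Here periodicity enters: the potential restricts the invariance to lattice translations, while
the other forms are invariant under all translations. -/
theorem linForm_translate {V : Space N → ℝ} {A : ℝ} (hV : IsMultiplier V A)
    (hp : IsOnePeriodic V) (k : Fin N → ℤ) (u v : HOne N) :
    linForm V (u.translate (latticePt k)) (v.translate (latticePt k)) = linForm V u v := by
  rw [linForm, add_apply, add_apply, add_apply, add_apply, gradForm_translate,
    hV.multForm_apply, hV.multForm_apply,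
    ← integral_sub_right_eq_self (fun x => V x * u.fn x * v.fn x) (latticePt k)]
  congr 1
  refine integral_congr_ae ?_
  filter_upwards [translate_fn_ae (latticePt k) u, translate_fn_ae (latticePt k) v,
    hp.ae_sub k] with x h1 h2 h3
  rw [h1, h2, h3]

namespace HasGrowth

variable {q : ℝ} {f : ℝ → ℝ} (h : HasGrowth N q f)

include h

omit [Fintype ι] in
theorem nlMap_translate (b : Space N) (u w : HOne N) :
    nlMap f (u.translate b) (w.translate b) = nlMap f u w := by
  rw [h.nlMap_apply, h.nlMap_apply,
    ← integral_sub_right_eq_self (fun x => f (u.fn x) * w.fn x) b]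
  refine integral_congr_ae ?_
  filter_upwards [translate_fn_ae b u, translate_fn_ae b w] with x h1 h2
  rw [h1, h2]

omit [Fintype ι] in
theorem nlForm_translate (b : Space N) (u z w : HOne N) :
    nlForm f (u.translate b) (z.translate b) (w.translate b) = nlForm f u z w := by
  rw [h.nlForm_apply, h.nlForm_apply,
    ← integral_sub_right_eq_self (fun x => deriv f (u.fn x) * z.fn x * w.fn x) b]
  refine integral_congr_ae ?_
  filter_upwards [translate_fn_ae b u, translate_fn_ae b z, translate_fn_ae b w] with x h1 h2 h3
  rw [h1, h2, h3]

theorem nlMap_bumps_of_suppIn [Nonempty ι] {u : HOne N} {ρ : ℝ} (hu : SuppIn u ρ)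
    {b : ι → Space N} (hb : Separated b (ρ + ρ)) :
    nlMap f (bumps b u) = ∑ i, nlMap f (u.translate (b i)) := by
  ext w
  rw [h.nlMap_apply, sum_apply]
  simp only [h.nlMap_apply]
  rw [← integral_finsetSum _ fun i _ => (h.isSource_comp (u.translate (b i))).choose_spec.integrable w]
  refine integral_congr_ae ?_
  filter_upwards [bumps_fn_ae b u, hu.ae_exists_forall_ne hu hb] with x h1 ⟨i, hi⟩
  rw [h1, Finset.sum_eq_single i (fun j _ hj => (hi j hj).1) (by simp),
    Finset.sum_eq_single i (fun j _ hj => by rw [(hi j hj).1, h.zero, zero_mul]) (by simp)]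

theorem nlForm_bumps_of_suppIn [Nonempty ι] {u z : HOne N} {ρ : ℝ} (hu : SuppIn u ρ)
    (hz : SuppIn z ρ) {b : ι → Space N} (hb : Separated b (ρ + ρ)) :
    nlForm f (bumps b u) (bumps b z)
      = ∑ i, nlForm f (u.translate (b i)) (z.translate (b i)) := by
  ext w
  rw [h.nlForm_apply, sum_apply]
  simp only [h.nlForm_apply]
  rw [← integral_finsetSum _ fun i _ =>
    (h.isMultiplier_deriv (u.translate (b i))).choose_spec.integrable (z.translate (b i)) w]
  refine integral_congr_ae ?_
  filter_upwards [bumps_fn_ae b u, bumps_fn_ae b z, hu.ae_exists_forall_ne hz hb]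
    with x h1 h2 ⟨i, hi⟩
  rw [h1, h2, Finset.sum_eq_single i (fun j _ hj => (hi j hj).1) (by simp),
    Finset.sum_eq_single i (fun j _ hj => (hi j hj).2) (by simp),
    Finset.sum_eq_single i (fun j _ hj => by rw [(hi j hj).2, mul_zero, zero_mul]) (by simp)]

/-- `f` is asymptotically additive on distant translates. -/
theorem exists_nlMap_bumps_sub_le [Nonempty ι] (u : HOne N) {ε : ℝ} (hε : 0 < ε) :
    ∃ R : ℝ, ∀ b : ι → Space N, Separated b R →
      ‖nlMap f (bumps b u) - ∑ i, nlMap f (u.translate (b i))‖ ≤ ε := by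
  set n : ℝ := (Fintype.card ι : ℝ) with hn
  have hn1 : 1 ≤ n := by rw [hn]; exact_mod_cast Fintype.card_pos
  have hn0 : 0 < n := by linarith
  obtain ⟨δ, hδ, H⟩ := h.exists_nlMap_sub_le (n * ‖u‖) (ε := ε / (n + 1)) (by positivity)
  -- Replacing `u` by a compactly supported `v` makes the additivity exact for separated bumps.
  -- Summing over the bumps multiplies the truncation error by at most `n`, hence the tolerance `δ /
  -- n`.
  obtain ⟨ρ, hρ, v, hv, huv⟩ := exists_suppIn u (ε := δ / n) (by positivity)
  refine ⟨ρ + ρ, fun b hb => ?_⟩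
  have h1 : ‖nlMap f (bumps b v) - nlMap f (bumps b u)‖ ≤ ε / (n + 1) := by
    refine H _ _ (norm_bumps_le b u) ?_
    rw [← bumps_sub, norm_sub_rev] at *
    refine (norm_bumps_le b _).trans ?_
    rw [norm_sub_rev]
    calc n * ‖u - v‖ ≤ n * (δ / n) := by gcongr; rwa [norm_sub_rev]
      _ = δ := by field_simp
  have h2 : ∀ i, ‖nlMap f (v.translate (b i)) - nlMap f (u.translate (b i))‖ ≤ ε / (n + 1) := by
    intro i
    refine H _ _ ?_ ?_
    · rw [norm_translate]; nlinarith [norm_nonneg u]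
    · rw [← translate_sub, norm_translate, norm_sub_rev]
      exact huv.trans (div_le_self hδ.le hn1)
  have h3 : ‖∑ i, (nlMap f (v.translate (b i)) - nlMap f (u.translate (b i)))‖
      ≤ n * (ε / (n + 1)) := by
    refine (norm_sum_le _ _).trans ((Finset.sum_le_sum fun i _ => h2 i).trans ?_)
    simp [hn]
  have e := h.nlMap_bumps_of_suppIn hv hb
  calc _ = ‖∑ i, (nlMap f (v.translate (b i)) - nlMap f (u.translate (b i)))
        - (nlMap f (bumps b v) - nlMap f (bumps b u))‖ := by
        rw [e, Finset.sum_sub_distrib]; congr 1; abel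
    _ ≤ n * (ε / (n + 1)) + ε / (n + 1) := (norm_sub_le _ _).trans (add_le_add h3 h1)
    _ = ε := by field_simp

/-- The identity is exact when `u` and `z` have compact support. The general case follows from
truncation and the uniform continuity of `u ↦ f'(u)` on bounded sets. -/
theorem exists_nlForm_bumps_sub_le [Nonempty ι] (u z : HOne N) {ε : ℝ} (hε : 0 < ε) :
    ∃ R : ℝ, ∀ b : ι → Space N, Separated b R →
      ‖nlForm f (bumps b u) (bumps b z)
        - ∑ i, nlForm f (u.translate (b i)) (z.translate (b i))‖ ≤ ε := by
  set n : ℝ := (Fintype.card ι : ℝ) with hn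
  have hn1 : 1 ≤ n := by rw [hn]; exact_mod_cast Fintype.card_pos
  have hn0 : 0 < n := by linarith
  obtain ⟨C, hC, HC⟩ := h.exists_nlForm_le (n * ‖u‖)
  set η : ℝ := ε / (2 * n * (‖z‖ + 1 + C)) with hη
  have hz0 := norm_nonneg z
  have hη0 : 0 < η := by positivity
  obtain ⟨δ, hδ, H⟩ := h.exists_nlForm_sub_le (n * ‖u‖) hη0
  obtain ⟨ρ, hρ, v, hv, huv⟩ := exists_suppIn u (ε := δ / n) (by positivity)
  obtain ⟨σ, hσ, y, hy, hzy⟩ := exists_suppIn z (ε := min 1 η) (by positivity)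
  have hy1 : ‖y‖ ≤ ‖z‖ + 1 := by
    have := norm_le_norm_add_norm_sub' y z
    rw [norm_sub_rev] at this
    linarith [hzy.trans (min_le_left _ _)]
  have hzy2 := hzy.trans (min_le_right _ _)
  -- One estimate serves twice: with `m = n` for the sums of bumps and with `m = 1` for a single
  -- translate.
  have key : ∀ U U' Y Z : HOne N, ‖U‖ ≤ n * ‖u‖ → ‖U' - U‖ ≤ δ → ∀ m : ℝ, 0 ≤ m → ‖Y‖ ≤ m * ‖y‖ →
      ‖Z - Y‖ ≤ m * ‖z - y‖ → ‖nlForm f U' Y - nlForm f U Z‖ ≤ m * (η * (‖z‖ + 1 + C)) := by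
    intro U U' Y Z h1 h2 m hm h3 h4
    have e : nlForm f U' Y - nlForm f U Z
        = (nlForm f U' - nlForm f U) Y - nlForm f U (Z - Y) := by
      rw [sub_apply, map_sub]; abel
    rw [e]
    have b1 : ‖(nlForm f U' - nlForm f U) Y‖ ≤ η * (m * (‖z‖ + 1)) :=
      (ContinuousLinearMap.le_opNorm _ _).trans (by
        gcongr
        · exact H _ _ h1 h2
        · exact h3.trans (by gcongr))
    have b2 : ‖nlForm f U (Z - Y)‖ ≤ C * (m * η) :=
      (ContinuousLinearMap.le_opNorm _ _).trans (by
        gcongr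
        · exact HC _ h1
        · exact h4.trans (by gcongr))
    refine (norm_sub_le _ _).trans ((add_le_add b1 b2).trans_eq (by ring))
  refine ⟨max ρ σ + max ρ σ, fun b hb => ?_⟩
  have e := h.nlForm_bumps_of_suppIn (hv.mono (le_max_left _ _)) (hy.mono (le_max_right _ _)) hb
  have h1 : ‖nlForm f (bumps b v) (bumps b y) - nlForm f (bumps b u) (bumps b z)‖
      ≤ n * (η * (‖z‖ + 1 + C)) := by
    refine key _ _ _ _ (norm_bumps_le b u) ?_ n hn0.le (norm_bumps_le b y) ?_
    · rw [← bumps_sub]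
      refine (norm_bumps_le b _).trans ?_
      rw [norm_sub_rev]
      calc n * ‖u - v‖ ≤ n * (δ / n) := by gcongr
        _ = δ := by field_simp
    · rw [← bumps_sub]; exact norm_bumps_le b _
  have h2 : ∀ i, ‖nlForm f (v.translate (b i)) (y.translate (b i))
      - nlForm f (u.translate (b i)) (z.translate (b i))‖ ≤ 1 * (η * (‖z‖ + 1 + C)) := by
    intro i
    refine key _ _ _ _ ?_ ?_ 1 zero_le_one ?_ ?_
    · rw [norm_translate]; nlinarith [norm_nonneg u]
    · rw [← translate_sub, norm_translate, norm_sub_rev]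
      exact huv.trans (div_le_self hδ.le hn1)
    · rw [norm_translate, one_mul]
    · rw [← translate_sub, norm_translate, one_mul]
  have h3 : ‖∑ i, (nlForm f (v.translate (b i)) (y.translate (b i))
      - nlForm f (u.translate (b i)) (z.translate (b i)))‖ ≤ n * (1 * (η * (‖z‖ + 1 + C))) := by
    refine (norm_sum_le _ _).trans ((Finset.sum_le_sum fun i _ => h2 i).trans ?_)
    simp [hn]
  calc _ = ‖∑ i, (nlForm f (v.translate (b i)) (y.translate (b i))
      - nlForm f (u.translate (b i)) (z.translate (b i)))
        - (nlForm f (bumps b v) (bumps b y) - nlForm f (bumps b u) (bumps b z))‖ := by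
        rw [e, Finset.sum_sub_distrib]; congr 1; abel
    _ ≤ n * (1 * (η * (‖z‖ + 1 + C))) + n * (η * (‖z‖ + 1 + C)) :=
        (norm_sub_le _ _).trans (add_le_add h3 h1)
    _ = ε := by rw [hη]; field_simp; ring

end HasGrowth

theorem l2Form_bumps_of_suppIn [Nonempty ι] {u z : HOne N} {ρ : ℝ} (hu : SuppIn u ρ)
    (hz : SuppIn z ρ) {b : ι → Space N} (hb : Separated b (ρ + ρ)) :
    l2Form N (bumps b u) (bumps b z) = Fintype.card ι * l2Form N u z := by
  have h1 : ∀ i, l2Form N (u.translate (b i)) (z.translate (b i)) = l2Form N u z := fun i =>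
    l2Form_translate _ _ _
  calc l2Form N (bumps b u) (bumps b z)
      = ∑ i, l2Form N (u.translate (b i)) (z.translate (b i)) := by
        simp only [l2Form_apply]
        rw [← integral_finsetSum _ fun i _ => integrable_fn_mul _ _]
        refine integral_congr_ae ?_
        filter_upwards [bumps_fn_ae b u, bumps_fn_ae b z, hu.ae_exists_forall_ne hz hb]
          with x h1 h2 ⟨i, hi⟩
        rw [h1, h2, Finset.sum_eq_single i (fun j _ hj => (hi j hj).1) (by simp),
          Finset.sum_eq_single i (fun j _ hj => (hi j hj).2) (by simp),
          Finset.sum_eq_single i (fun j _ hj => by rw [(hi j hj).2, mul_zero]) (by simp)]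
    _ = _ := by simp [h1]

/-- The cross terms vanish for truncated functions and are small in general. With `z = u` this says
that the mass is nearly right; with `z` the solution of the linearized equation, that the Schur
complement persists. -/
theorem exists_l2Form_bumps_sub_le [Nonempty ι] (u z : HOne N) {ε : ℝ} (hε : 0 < ε) :
    ∃ R : ℝ, ∀ b : ι → Space N, Separated b R →
      |l2Form N (bumps b u) (bumps b z) - Fintype.card ι * l2Form N u z| ≤ ε := by
  set n : ℝ := (Fintype.card ι : ℝ) with hn
  have hn1 : 1 ≤ n := by rw [hn]; exact_mod_cast Fintype.card_pos
  have hn0 : 0 < n := by linarith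
  have hu0 := norm_nonneg u
  have hz0 := norm_nonneg z
  set K : ℝ := ‖u‖ + ‖z‖ + 1 with hK
  set η : ℝ := min 1 (ε / (2 * n ^ 2 * K)) with hη
  have hη0 : 0 < η := by positivity
  obtain ⟨ρ, hρ, v, hv, huv⟩ := exists_suppIn u hη0
  obtain ⟨σ, hσ, y, hy, hzy⟩ := exists_suppIn z hη0
  have hy1 : ‖y‖ ≤ ‖z‖ + 1 := by
    have := norm_le_norm_add_norm_sub' y z
    rw [norm_sub_rev] at this
    linarith [hzy.trans (min_le_left _ _)]
  have key : ∀ U V Y Z : HOne N, ∀ m : ℝ, 0 ≤ m → ‖U‖ ≤ m * ‖u‖ → ‖U - V‖ ≤ m * ‖u - v‖ →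
      ‖Y‖ ≤ m * ‖y‖ → ‖Z - Y‖ ≤ m * ‖z - y‖ → |l2Form N V Y - l2Form N U Z| ≤ m ^ 2 * (η * K) := by
    intro U V Y Z m hm h1 h2 h3 h4
    have e : l2Form N V Y - l2Form N U Z = -(l2Form N (U - V) Y + l2Form N U (Z - Y)) := by
      simp only [map_sub, sub_apply]; ring
    rw [e, abs_neg]
    have b1 : |l2Form N (U - V) Y| ≤ (m * η) * (m * (‖z‖ + 1)) :=
      (abs_l2Form_le _ _).trans (by
        gcongr
        · exact h2.trans (by gcongr)
        · exact h3.trans (by gcongr))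
    have b2 : |l2Form N U (Z - Y)| ≤ (m * ‖u‖) * (m * η) :=
      (abs_l2Form_le _ _).trans (by
        gcongr
        exact h4.trans (by gcongr))
    refine (abs_add_le _ _).trans ((add_le_add b1 b2).trans_eq (by rw [hK]; ring))
  refine ⟨max ρ σ + max ρ σ, fun b hb => ?_⟩
  have e := l2Form_bumps_of_suppIn (hv.mono (le_max_left _ _)) (hy.mono (le_max_right _ _)) hb
  have h1 := key (bumps b u) (bumps b v) (bumps b y) (bumps b z) n hn0.le (norm_bumps_le b u)
    (by rw [← bumps_sub]; exact norm_bumps_le b _) (norm_bumps_le b y)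
    (by rw [← bumps_sub]; exact norm_bumps_le b _)
  have h2 := key u v y z 1 zero_le_one (by simp) (by simp) (by simp) (by simp)
  rw [e] at h1
  have h3 : η * K ≤ ε / (2 * n ^ 2) := by
    calc η * K ≤ ε / (2 * n ^ 2 * K) * K := by gcongr; exact min_le_right _ _
      _ = ε / (2 * n ^ 2) := by
        have hK0 : K ≠ 0 := by positivity
        field_simp
  have h4 : n ^ 2 * (η * K) ≤ ε / 2 :=
    (mul_le_mul_of_nonneg_left h3 (by positivity)).trans_eq (by field_simp)
  have h5 : n * (1 ^ 2 * (η * K)) ≤ ε / 2 := by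
    refine le_trans ?_ h4
    have h7 : 0 ≤ η * K := by positivity
    have h8 : n ≤ n ^ 2 := by nlinarith
    rw [one_pow, one_mul]
    exact mul_le_mul_of_nonneg_right h8 h7
  have h6 : |n * (l2Form N v y - l2Form N u z)| ≤ ε / 2 := by
    rw [abs_mul, abs_of_pos hn0]
    exact (mul_le_mul_of_nonneg_left h2 hn0.le).trans h5
  calc _ = |n * (l2Form N v y - l2Form N u z)
        - (n * l2Form N v y - l2Form N (bumps b u) (bumps b z))| := by congr 1; ring
    _ ≤ ε / 2 + ε / 2 := (abs_sub _ _).trans (add_le_add h6 (h1.trans h4))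
    _ = ε := by ring

end

/-! ### Uniform lower bound for the linearization at a multibump. -/

section

open HOne

variable {N : ℕ}

/-- Translation is a bijective isometry, so testing with translates exhausts the unit ball of `H¹`.
-/
theorem norm_form_translate {B B' : HOne N →L[ℝ] HOne N →L[ℝ] ℝ} {b : Space N}
    (h : ∀ v w, B' (v.translate b) (w.translate b) = B v w) (v : HOne N) :
    ‖B' (v.translate b)‖ = ‖B v‖ := by
  refine le_antisymm (ContinuousLinearMap.opNorm_le_bound _ (norm_nonneg _) fun w => ?_)
    (ContinuousLinearMap.opNorm_le_bound _ (norm_nonneg _) fun w => ?_)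
  · rw [← translate_neg_translate b w, h, norm_translate b]
    exact (B v).le_opNorm _
  · rw [← h, ← norm_translate b w]
    exact (B' (v.translate b)).le_opNorm _

theorem multForm_mulCutoff {c χ : Space N → ℝ} {κ B κ' : ℝ} (hc : IsMultiplier c κ)
    (hχ : IsCutoff χ B κ') (v w : HOne N) :
    multForm c (mulCutoff hχ v) w = multForm c v (mulCutoff hχ w) := by
  rw [hc.multForm_apply, hc.multForm_apply]
  refine integral_congr_ae ?_
  filter_upwards [mulCutoff_fn hχ v, mulCutoff_fn hχ w] with x h1 h2
  rw [h1, h2]; ring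

theorem l2Form_mulCutoff {χ : Space N → ℝ} {B κ' : ℝ}
    (hχ : IsCutoff χ B κ') (v w : HOne N) :
    l2Form N (mulCutoff hχ v) w = l2Form N v (mulCutoff hχ w) := by
  rw [l2Form_apply, l2Form_apply]
  refine integral_congr_ae ?_
  filter_upwards [mulCutoff_fn hχ v, mulCutoff_fn hχ w] with x h1 h2
  rw [h1, h2]; ring

/-- The terms `χ ∇v · ∇w` cancel. What is left contains `∇χ`, which is small for wide cutoffs. -/
theorem abs_gradForm_mulCutoff_sub_le {χ : Space N → ℝ} {B κ : ℝ} (hχ : IsCutoff χ B κ)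
    (v w : HOne N) :
    |gradForm N (mulCutoff hχ v) w - gradForm N v (mulCutoff hχ w)| ≤ 2 * κ * ‖v‖ * ‖w‖ := by
  have hk := hχ.nonneg_grad
  rw [gradForm_apply, gradForm_apply,
    ← integral_sub (integrable_inner_grad _ _) (integrable_inner_grad _ _)]
  refine abs_integral_le_integral_abs.trans ?_
  calc _ ≤ ∫ x, (κ * (|v.fn x| * ‖w.grad x‖) + κ * (|w.fn x| * ‖v.grad x‖)) := by
        refine integral_mono_ae
          ((integrable_inner_grad _ _).sub (integrable_inner_grad _ _)).abs
          (((integrable_fn_mul_grad v w).const_mul κ).add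
            ((integrable_fn_mul_grad w v).const_mul κ)) ?_
        filter_upwards [mulCutoff_grad hχ v, mulCutoff_grad hχ w] with x h1 h2
        have e : inner ℝ ((mulCutoff hχ v).grad x) (w.grad x)
            - inner ℝ (v.grad x) ((mulCutoff hχ w).grad x)
            = v.fn x * inner ℝ (gradient χ x) (w.grad x)
              - w.fn x * inner ℝ (v.grad x) (gradient χ x) := by
          rw [h1, h2, inner_add_left, inner_add_right, real_inner_smul_left,
            real_inner_smul_right, real_inner_smul_left, real_inner_smul_right]
          ring
        rw [e]
        refine (abs_sub _ _).trans (add_le_add ?_ ?_)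
        · rw [abs_mul]
          calc _ ≤ |v.fn x| * (‖gradient χ x‖ * ‖w.grad x‖) := by
                gcongr; exact abs_real_inner_le_norm _ _
            _ ≤ |v.fn x| * (κ * ‖w.grad x‖) := by gcongr; exact hχ.norm_gradient_le x
            _ = _ := by ring
        · rw [abs_mul]
          calc _ ≤ |w.fn x| * (‖v.grad x‖ * ‖gradient χ x‖) := by
                gcongr; exact abs_real_inner_le_norm _ _
            _ ≤ |w.fn x| * (‖v.grad x‖ * κ) := by gcongr; exact hχ.norm_gradient_le x
            _ = _ := by ring
    _ = κ * (∫ x, |v.fn x| * ‖w.grad x‖) + κ * ∫ x, |w.fn x| * ‖v.grad x‖ := by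
        rw [integral_add ((integrable_fn_mul_grad v w).const_mul κ)
          ((integrable_fn_mul_grad w v).const_mul κ), integral_const_mul, integral_const_mul]
    _ ≤ κ * (‖v‖ * ‖w‖) + κ * (‖w‖ * ‖v‖) := by
        gcongr
        · exact integral_fn_mul_grad_le v w
        · exact integral_fn_mul_grad_le w v
    _ = _ := by ring

/-- The commutator of a second order form with a cutoff function is controlled by the gradient of
the cutoff function. -/
theorem abs_form_mulCutoff_sub_le {V χ : Space N → ℝ} {A B κ : ℝ} (hV : IsMultiplier V A)
    (hχ : IsCutoff χ B κ) (lam : ℝ) (v w : HOne N) :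
    |(linForm V - lam • l2Form N) (mulCutoff hχ v) w
      - (linForm V - lam • l2Form N) v (mulCutoff hχ w)| ≤ 2 * κ * ‖v‖ * ‖w‖ := by
  refine le_trans (le_of_eq ?_) (abs_gradForm_mulCutoff_sub_le hχ v w)
  simp only [linForm, sub_apply, smul_apply, add_apply]
  rw [multForm_mulCutoff hV, l2Form_mulCutoff]
  congr 1; ring

theorem exists_le_norm_latticePt (hN : 1 ≤ N) (R : ℝ) : ∃ k : Fin N → ℤ, R ≤ ‖latticePt k‖ := by
  obtain ⟨m, hm⟩ := exists_nat_ge R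
  refine ⟨fun _ => m, hm.trans ?_⟩
  have := PiLp.norm_apply_le (latticePt (fun _ : Fin N => (m : ℤ))) ⟨0, hN⟩
  refine le_trans ?_ this
  simp [latticePt]

namespace HasGrowth

variable {q : ℝ} {f : ℝ → ℝ} (h : HasGrowth N q f) {V : Space N → ℝ} {A : ℝ}
  (hV : IsMultiplier V A) (hp : IsOnePeriodic V)

include h

/-- The potential `f'(u)` is localized up to a small error, and a far translate of `w` lives, up to
a small error, where it vanishes. The shift is taken in the lattice so that the linear form is
invariant under it. -/
theorem exists_norm_nlForm_translate_le (hN : 1 ≤ N) (u w : HOne N) {ε : ℝ} (hε : 0 < ε) :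
    ∃ k : Fin N → ℤ, ‖nlForm f u (w.translate (latticePt k))‖ ≤ ε := by
  obtain ⟨C, hC, HC⟩ := h.exists_nlForm_le (‖u‖ + 1)
  have hw := norm_nonneg w
  set η : ℝ := ε / (‖w‖ + C + 1) with hη
  have hη0 : 0 < η := by positivity
  obtain ⟨δ, hδ, H⟩ := h.exists_nlForm_sub_le ‖u‖ hη0
  obtain ⟨ρ, hρ, v, hv, huv⟩ := exists_suppIn u (ε := min 1 δ) (by positivity)
  obtain ⟨σ, hσ, y, hy, hwy⟩ := exists_suppIn w hη0
  obtain ⟨k, hk⟩ := exists_le_norm_latticePt hN (ρ + σ)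
  set b : Space N := latticePt k
  refine ⟨k, ?_⟩
  have h1 : ‖nlForm f v - nlForm f u‖ ≤ η :=
    H v u le_rfl (by rw [norm_sub_rev]; exact huv.trans (min_le_right _ _))
  have h2 : ‖nlForm f v‖ ≤ C := by
    refine HC v ?_
    have := norm_le_norm_add_norm_sub' v u
    rw [norm_sub_rev] at this
    linarith [huv.trans (min_le_left _ _)]
  have h3 : nlForm f v (y.translate b) = 0 := by
    ext z
    rw [h.nlForm_apply, zero_apply, ← integral_zero (Space N) ℝ]
    refine integral_congr_ae ?_
    filter_upwards [hv, hy.translate b] with x hx1 hx2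
    rcases le_or_gt ρ ‖x‖ with h4 | h4
    · rw [hx1 h4, h.deriv_zero, zero_mul, zero_mul]
    · rw [hx2, mul_zero, zero_mul]
      have := norm_sub_norm_le b x
      rw [norm_sub_rev] at this
      linarith
  have e : nlForm f u (w.translate b)
      = nlForm f v ((w - y).translate b) - (nlForm f v - nlForm f u) (w.translate b) := by
    rw [translate_sub, map_sub, h3, sub_apply]; abel
  rw [e]
  calc _ ≤ C * η + η * ‖w‖ := by
        refine (norm_sub_le _ _).trans (add_le_add
          ((ContinuousLinearMap.le_opNorm _ _).trans ?_)
          ((ContinuousLinearMap.le_opNorm _ _).trans ?_))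
        · rw [norm_translate]; gcongr
        · rw [norm_translate]; gcongr
    _ ≤ η * (‖w‖ + C + 1) := by nlinarith
    _ = ε := by rw [hη]; field_simp

include hV hp

theorem form_translate (k : Fin N → ℤ) (lam : ℝ) (u v w : HOne N) :
    (linForm V - nlForm f (u.translate (latticePt k)) - lam • l2Form N)
      (v.translate (latticePt k)) (w.translate (latticePt k))
      = (linForm V - nlForm f u - lam • l2Form N) v w := by
  simp only [sub_apply, smul_apply]
  rw [linForm_translate hV hp, h.nlForm_translate, l2Form_translate]

/-- A lower bound for the linearization yields the same bound for the operator at infinity. -/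
theorem le_norm_linForm_sub (hN : 1 ≤ N) {u : HOne N} {lam c : ℝ}
    (hc : ∀ v, c * ‖v‖ ≤ ‖(linForm V - nlForm f u - lam • l2Form N) v‖) (v : HOne N) :
    c * ‖v‖ ≤ ‖(linForm V - lam • l2Form N) v‖ := by
  refine le_of_forall_pos_le_add fun ε hε => ?_
  -- The bound is applied to a far lattice translate of `v`: the linear part does not notice the
  -- translation, while the contribution of `f'(u)` drops below `ε`.
  obtain ⟨k, hk⟩ := h.exists_norm_nlForm_translate_le hN u v hε
  have h1 : ‖(linForm V - lam • l2Form N) (v.translate (latticePt k))‖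
      = ‖(linForm V - lam • l2Form N) v‖ := by
    refine norm_form_translate (fun v w => ?_) v
    simp only [sub_apply, smul_apply]
    rw [linForm_translate hV hp, l2Form_translate]
  have h2 := hc (v.translate (latticePt k))
  rw [norm_translate] at h2
  have e : (linForm V - nlForm f u - lam • l2Form N) (v.translate (latticePt k))
      = (linForm V - lam • l2Form N) (v.translate (latticePt k))
        - nlForm f u (v.translate (latticePt k)) := by
    simp only [sub_apply, smul_apply]; abel
  rw [e] at h2
  have h3 := norm_sub_le ((linForm V - lam • l2Form N) (v.translate (latticePt k)))
    (nlForm f u (v.translate (latticePt k)))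
  linarith

omit hp in
-- Localization. The piece of `v` near `b i` sees only the `i`-th bump and is controlled by `h1`;
-- the remainder sees no bump and is controlled by `h0`. Moving the cutoffs across the forms costs
-- commutators of size `2 bumpConst N / r` each. The separation `4 r` makes the supports of the
-- cutoffs, of radius `2 r`, essentially disjoint. Since `bumpConst N / r ≤ 1`, each cutoff has norm
-- at most `3`; this gives the factor `6 n + 1` for `n` bumps.
theorem le_norm_form_bumps_of_suppIn {ι : Type*} [Fintype ι] {u : HOne N} {ρ r lam c : ℝ}
    (hu : SuppIn u ρ) (hr : 0 < r) (hρ : ρ ≤ r) (hκ : bumpConst N / r ≤ 1) {b : ι → Space N}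
    (hb : Separated b (4 * r)) (h0 : ∀ v, c * ‖v‖ ≤ ‖(linForm V - lam • l2Form N) v‖)
    (h1 : ∀ i v, c * ‖v‖
      ≤ ‖(linForm V - nlForm f (u.translate (b i)) - lam • l2Form N) v‖) (hc : 0 ≤ c) (v : HOne N) :
    (c - 4 * Fintype.card ι * (bumpConst N / r)) * ‖v‖
      ≤ (6 * Fintype.card ι + 1) * ‖(linForm V - nlForm f (bumps b u) - lam • l2Form N) v‖ := by
  classical
  set n : ℝ := (Fintype.card ι : ℝ) with hn
  set κ : ℝ := bumpConst N / r with hκd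
  have hn0 : 0 ≤ n := by positivity
  let X : ι → HOne N → HOne N := fun i => mulCutoff (isCutoff_ballCutoff (b i) hr)
  have hκ0 : 0 ≤ κ := (isCutoff_ballCutoff (0 : Space N) hr).nonneg_grad
  set Λ := linForm V - lam • l2Form N with hΛ
  have hX : ∀ i w, ‖X i w‖ ≤ 3 * ‖w‖ := fun i w =>
    (norm_mulCutoff_le _ w).trans (by gcongr; linarith)
  have hXfn : ∀ i w, ∀ᵐ x, (X i w).fn x = ballCutoff (b i) r x * w.fn x := fun i w =>
    mulCutoff_fn _ w
  have hcomm : ∀ i w, |Λ (X i v) w - Λ v (X i w)| ≤ 2 * κ * ‖v‖ * ‖w‖ := fun i w =>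
    abs_form_mulCutoff_sub_le hV _ lam v w
  set g := (linForm V - nlForm f (bumps b u) - lam • l2Form N) v with hg
  have hgw : ∀ w, g w = Λ v w - nlForm f (bumps b u) v w := by
    intro w
    simp only [hg, hΛ, sub_apply, smul_apply]; ring
  have hgn : ∀ w, |g w| ≤ ‖g‖ * ‖w‖ := fun w => g.le_opNorm w
  have hv0 := norm_nonneg v
  -- On the support of the `i`-th cutoff all other bumps vanish, so the potential of the sum is that
  -- of a single bump, and a multiplication operator commutes with the cutoff.
  have loc : ∀ i w, nlForm f (bumps b u) v (X i w) = nlForm f (u.translate (b i)) (X i v) w := by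
    intro i w
    rw [h.nlForm_apply, h.nlForm_apply]
    refine integral_congr_ae ?_
    filter_upwards [hXfn i w, hXfn i v, bumps_fn_ae b u,
      ae_all_iff.2 fun j => hu.translate (b j)] with x h2 h3 h4 h5
    rcases le_or_gt (2 * r) ‖x - b i‖ with h6 | h6
    · rw [h2, h3, ballCutoff_eq_zero hr h6]; ring
    · have h7 : (bumps b u).fn x = (u.translate (b i)).fn x := by
        rw [h4]
        refine Finset.sum_eq_single i (fun j _ hj => h5 j ?_) (by simp)
        have := Separated.le_of_lt (ρ := 2 * r) (σ := 2 * r) (hb.mono (by linarith)) hj h6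
        linarith
      rw [h2, h3, h7]; ring
  have b1 : ∀ i, c * ‖X i v‖ ≤ 2 * κ * ‖v‖ + 3 * ‖g‖ := by
    intro i
    refine (h1 i _).trans (ContinuousLinearMap.opNorm_le_bound _ (by positivity) fun w => ?_)
    have e : (linForm V - nlForm f (u.translate (b i)) - lam • l2Form N) (X i v) w
        = (Λ (X i v) w - Λ v (X i w)) + g (X i w) := by
      rw [hgw, loc i w]
      simp only [hΛ, sub_apply, smul_apply]; ring
    rw [e]
    calc _ ≤ 2 * κ * ‖v‖ * ‖w‖ + ‖g‖ * (3 * ‖w‖) := by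
          refine (abs_add_le _ _).trans (add_le_add (hcomm i w) ((hgn _).trans ?_))
          gcongr; exact hX i w
      _ = _ := by ring
  have hsum : ∀ w, ∀ᵐ x, (w - ∑ i, X i w).fn x = (1 - ∑ i, ballCutoff (b i) r x) * w.fn x := by
    intro w
    filter_upwards [fn_sub_ae w (∑ i, X i w), fn_sum_ae Finset.univ fun i => X i w,
      ae_all_iff.2 fun i => hXfn i w] with x h2 h3 h4
    rw [h2, h3, sub_mul, one_mul, Finset.sum_mul]
    congr 1
    exact Finset.sum_congr rfl fun i _ => h4 i
  -- Within `r` of some `b i` the cutoffs add up to one, and farther than `r` from all of them every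
  -- bump vanishes, where `f'(0) = 0`.
  have hout : ∀ w, nlForm f (bumps b u) v (w - ∑ i, X i w) = 0 := by
    intro w
    rw [h.nlForm_apply, ← integral_zero (Space N) ℝ]
    refine integral_congr_ae ?_
    filter_upwards [hsum w, bumps_fn_ae b u, ae_all_iff.2 fun j => hu.translate (b j)]
      with x h2 h3 h4
    by_cases h5 : ∃ i, ‖x - b i‖ < r
    · obtain ⟨i, hi⟩ := h5
      have h6 : ∑ j, ballCutoff (b j) r x = 1 := by
        rw [Finset.sum_eq_single i (fun j _ hj => ?_) (by simp), ballCutoff_eq_one hr hi.le]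
        refine ballCutoff_eq_zero hr ?_
        exact Separated.le_of_lt (ρ := 2 * r) (σ := r) (hb.mono (by linarith)) hj hi
      rw [h2, h6]; ring
    · push Not at h5
      have h6 : (bumps b u).fn x = 0 := by
        rw [h3]
        exact Finset.sum_eq_zero fun j _ => h4 j (hρ.trans (h5 j))
      rw [h6, h.deriv_zero]; ring
  have b2 : c * ‖v - ∑ i, X i v‖ ≤ (3 * n + 1) * ‖g‖ + 2 * n * κ * ‖v‖ := by
    refine (h0 _).trans (ContinuousLinearMap.opNorm_le_bound _ (by positivity) fun w => ?_)
    -- The remainder of `v` is tested by moving the partition onto `w`; there the potential no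
    -- longer contributes.
    have e : Λ (v - ∑ i, X i v) w = g (w - ∑ i, X i w) - ∑ i, (Λ (X i v) w - Λ v (X i w)) := by
      rw [hgw, hout w, sub_zero]
      simp only [map_sub, map_sum, sub_apply, sum_apply, Finset.sum_sub_distrib]
      ring
    have b3 : ‖w - ∑ i, X i w‖ ≤ (3 * n + 1) * ‖w‖ := by
      have := (norm_sum_le Finset.univ fun i => X i w).trans (Finset.sum_le_sum fun i _ => hX i w)
      have h6 := norm_sub_le w (∑ i, X i w)
      simp only [Finset.sum_const, Finset.card_univ, nsmul_eq_mul] at this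
      nlinarith
    have b4 : |∑ i, (Λ (X i v) w - Λ v (X i w))| ≤ n * (2 * κ * ‖v‖ * ‖w‖) := by
      refine (Finset.abs_sum_le_sum_abs _ _).trans ((Finset.sum_le_sum fun i _ => hcomm i w).trans ?_)
      simp [hn]
    rw [e]
    calc _ ≤ ‖g‖ * ((3 * n + 1) * ‖w‖) + n * (2 * κ * ‖v‖ * ‖w‖) := by
          refine (abs_sub _ _).trans (add_le_add ((hgn _).trans ?_) b4)
          gcongr
      _ = _ := by ring
  have b5 : ‖v‖ ≤ ‖v - ∑ i, X i v‖ + ∑ i, ‖X i v‖ := by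
    have h2 := norm_add_le (v - ∑ i, X i v) (∑ i, X i v)
    rw [sub_add_cancel] at h2
    linarith [norm_sum_le Finset.univ fun i => X i v]
  have b6 : c * ∑ i, ‖X i v‖ ≤ n * (2 * κ * ‖v‖ + 3 * ‖g‖) := by
    rw [Finset.mul_sum]
    refine (Finset.sum_le_sum fun i _ => b1 i).trans ?_
    simp [hn, mul_add]
  have b7 := mul_le_mul_of_nonneg_left b5 hc
  rw [mul_add] at b7
  have := norm_nonneg g
  linarith

/-- The linearization at a sum of distant translates is bounded below. -/
theorem exists_le_norm_form_bumps (hN : 1 ≤ N) {ι : Type*} [Fintype ι] [Nonempty ι] {u : HOne N}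
    {lam c : ℝ} (hc : 0 < c)
    (hu : ∀ v, c * ‖v‖ ≤ ‖(linForm V - nlForm f u - lam • l2Form N) v‖) :
    ∃ c' > 0, ∃ R : ℝ, ∀ a : ι → Fin N → ℤ, Separated (fun i => latticePt (a i)) R → ∀ v,
      c' * ‖v‖ ≤ ‖(linForm V - nlForm f (bumps (fun i => latticePt (a i)) u) - lam • l2Form N) v‖ := by
  set n : ℝ := (Fintype.card ι : ℝ) with hn
  have hn1 : 1 ≤ n := by rw [hn]; exact_mod_cast Fintype.card_pos
  have hn0 : 0 < n := by linarith
  -- Truncating the bump changes the operators by at most `η`. After multiplication by the factor `6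
  -- n + 1` of the localization estimate this costs `c / 4`, half of the remaining bound `c / 2`.
  set η : ℝ := c / (4 * (6 * n + 1)) with hη
  have hη0 : 0 < η := by positivity
  have hη1 : (6 * n + 1) * η = c / 4 := by rw [hη]; field_simp
  obtain ⟨δ, hδ, H⟩ := h.exists_nlForm_sub_le (n * ‖u‖) hη0
  obtain ⟨ρ, hρ, v, hv, huv⟩ := exists_suppIn u (ε := δ / n) (by positivity)
  obtain ⟨r, hr, hρr, hr1, hr2⟩ : ∃ r : ℝ, 0 < r ∧ ρ ≤ r ∧ bumpConst N / r ≤ 1 ∧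
      4 * n * (bumpConst N / r) ≤ c / 4 := by
    have h1 : Tendsto (fun r : ℝ => bumpConst N / r) atTop (𝓝 0) :=
      tendsto_const_nhds.div_atTop tendsto_id
    have h2 : Tendsto (fun r : ℝ => 4 * n * (bumpConst N / r)) atTop (𝓝 0) := by
      simpa using h1.const_mul (4 * n)
    have h3 := (h1.eventually_le_const one_pos).and
      ((h2.eventually_le_const (by positivity : (0 : ℝ) < c / 4)).and
        ((eventually_ge_atTop ρ).and (eventually_gt_atTop 0)))
    obtain ⟨r, h4, h5, h6, h7⟩ := h3.exists
    exact ⟨r, h7, h6, h4, h5⟩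
  refine ⟨c / (4 * (6 * n + 1)), by positivity, 4 * r, fun a ha w => ?_⟩
  set b : ι → Space N := fun i => latticePt (a i) with hb
  have hw := norm_nonneg w
  have d1 : ‖nlForm f (bumps b v) - nlForm f (bumps b u)‖ ≤ η := by
    refine H _ _ (norm_bumps_le b u) ?_
    rw [← bumps_sub]
    refine (norm_bumps_le b _).trans ?_
    rw [norm_sub_rev]
    calc n * ‖u - v‖ ≤ n * (δ / n) := by gcongr
      _ = δ := by field_simp
  have d2 : ∀ i, ‖nlForm f (v.translate (b i)) - nlForm f (u.translate (b i))‖ ≤ η := by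
    intro i
    refine H _ _ ?_ ?_
    · rw [norm_translate]; nlinarith [norm_nonneg u]
    · rw [← translate_sub, norm_translate, norm_sub_rev]
      exact huv.trans (div_le_self hδ.le hn1)
  have pert : ∀ (P Q : HOne N →L[ℝ] HOne N →L[ℝ] ℝ) (y : HOne N), ‖P - Q‖ ≤ η →
      ‖(linForm V - Q - lam • l2Form N) y‖
        ≤ ‖(linForm V - P - lam • l2Form N) y‖ + η * ‖y‖ := by
    intro P Q y hPQ
    have e : (linForm V - Q - lam • l2Form N) y
        = (linForm V - P - lam • l2Form N) y + (P - Q) y := by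
      simp only [sub_apply, smul_apply]; abel
    rw [e]
    refine (norm_add_le _ _).trans ?_
    gcongr
    exact (ContinuousLinearMap.le_opNorm _ _).trans (by gcongr)
  have h0 : ∀ y, (c - η) * ‖y‖ ≤ ‖(linForm V - lam • l2Form N) y‖ := fun y =>
    le_trans (by gcongr; linarith) (h.le_norm_linForm_sub hV hp hN hu y)
  have h1 : ∀ i y, (c - η) * ‖y‖
      ≤ ‖(linForm V - nlForm f (v.translate (b i)) - lam • l2Form N) y‖ := by
    intro i y
    have h2 := pert _ _ y (d2 i)
    -- The linearization at a single translated bump is conjugate, by a lattice translation, to the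
    -- one at `u`.
    have h3 := norm_form_translate (h.form_translate hV hp (a i) lam u) (y.translate (-b i))
    rw [translate_neg_translate] at h3
    have h4 := hu (y.translate (-b i))
    rw [norm_translate, ← h3] at h4
    linarith
  have hηc : η ≤ c / 4 := by nlinarith
  have h2 := h.le_norm_form_bumps_of_suppIn hV hv hr hρr hr1 ha h0 h1 (by linarith) w
  have h3 := pert _ _ w (norm_sub_rev (nlForm f (bumps b v)) _ ▸ d1)
  have h4 : (c - η - 4 * n * (bumpConst N / r)) * ‖w‖ ≥ (c / 2) * ‖w‖ := by
    gcongr; linarith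
  rw [div_mul_eq_mul_div, div_le_iff₀ (by positivity)]
  have h5 : (6 * n + 1) * ‖(linForm V - nlForm f (bumps b v) - lam • l2Form N) w‖
      ≤ (6 * n + 1) * (‖(linForm V - nlForm f (bumps b u) - lam • l2Form N) w‖ + η * ‖w‖) := by
    gcongr
  have h6 : (6 * n + 1) * (η * ‖w‖) = c / 4 * ‖w‖ := by rw [← mul_assoc, hη1]
  rw [mul_add, h6] at h5
  linarith

end HasGrowth

end

/-! ### Existence and local uniqueness of multibump solutions. -/

section

open HOne

variable {N : ℕ}

theorem norm_l2Form_apply_le (v : HOne N) : ‖l2Form N v‖ ≤ ‖v‖ :=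
  ContinuousLinearMap.opNorm_le_bound _ (norm_nonneg _) fun w => abs_l2Form_le v w

namespace HasGrowth

variable {q : ℝ} {f : ℝ → ℝ} (h : HasGrowth N q f) {V : Space N → ℝ} {A : ℝ}
  (hV : IsMultiplier V A) (hp : IsOnePeriodic V)

include h hV hp

theorem residual_translate {u : HOne N} {lam : ℝ}
    (hu : linForm V u - nlMap f u = lam • l2Form N u) (k : Fin N → ℤ) :
    linForm V (u.translate (latticePt k)) - nlMap f (u.translate (latticePt k))
      = lam • l2Form N (u.translate (latticePt k)) := by
  ext w
  rw [← translate_neg_translate (latticePt k) w]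
  have h1 := congrArg (fun g : StrongDual ℝ (HOne N) => g (w.translate (-latticePt k))) hu
  simp only [sub_apply, smul_apply] at h1 ⊢
  rw [linForm_translate hV hp, h.nlMap_translate, l2Form_translate, h1]

theorem linearized_translate {u z : HOne N} {lam : ℝ}
    (hz : (linForm V - nlForm f u - lam • l2Form N) z = l2Form N u) (k : Fin N → ℤ) :
    (linForm V - nlForm f (u.translate (latticePt k)) - lam • l2Form N) (z.translate (latticePt k))
      = l2Form N (u.translate (latticePt k)) := by
  ext w
  rw [← translate_neg_translate (latticePt k) w, h.form_translate hV hp, hz, l2Form_translate]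

omit hp in
theorem linForm_symm_sub (u : HOne N) (lam : ℝ) (v w : HOne N) :
    (linForm V - nlForm f u - lam • l2Form N) v w
      = (linForm V - nlForm f u - lam • l2Form N) w v := by
  simp only [sub_apply, smul_apply]
  rw [linForm_symm hV, h.nlForm_symm, l2Form_symm]

/-- Existence and local uniqueness of multibump solutions. -/
theorem exists_multibump (hN : 1 ≤ N) {ι : Type*} [Fintype ι] [Nonempty ι] {u z : HOne N}
    {lam c : ℝ} (hu : linForm V u - nlMap f u = lam • l2Form N u) (hc : 0 < c)
    (hlow : ∀ v, c * ‖v‖ ≤ ‖(linForm V - nlForm f u - lam • l2Form N) v‖)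
    (hz : (linForm V - nlForm f u - lam • l2Form N) z = l2Form N u) (huz : l2Form N u z ≠ 0) :
    ∃ ε₀ > 0, ∀ ε, 0 < ε → ε ≤ ε₀ → ∃ R : ℝ, ∀ a : ι → Fin N → ℤ,
      Separated (fun i => latticePt (a i)) R →
      (∀ v μ v' μ', ‖v - bumps (fun i => latticePt (a i)) u‖ ≤ ε₀ → |μ - lam| ≤ ε₀ →
        ‖v' - bumps (fun i => latticePt (a i)) u‖ ≤ ε₀ → |μ' - lam| ≤ ε₀ →
        linForm V v - nlMap f v = μ • l2Form N v → l2Form N v v = Fintype.card ι * l2Form N u u →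
        linForm V v' - nlMap f v' = μ' • l2Form N v' →
        l2Form N v' v' = Fintype.card ι * l2Form N u u → v = v' ∧ μ = μ') ∧
      ∃ v μ, ‖v - bumps (fun i => latticePt (a i)) u‖ ≤ ε ∧ |μ - lam| ≤ ε ∧
        linForm V v - nlMap f v = μ • l2Form N v ∧
        l2Form N v v = Fintype.card ι * l2Form N u u := by
  set n : ℝ := (Fintype.card ι : ℝ) with hn
  have hn1 : 1 ≤ n := by rw [hn]; exact_mod_cast Fintype.card_pos
  have hn0 : 0 < n := by linarith
  have hu0 := norm_nonneg u
  have hz0 := norm_nonneg z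
  have huz0 : 0 < |l2Form N u z| := abs_pos.2 huz
  obtain ⟨c₁, hc₁, R₁, H₁⟩ := h.exists_le_norm_form_bumps hV hp hN (ι := ι) hc hlow
  obtain ⟨c₂, hc₂, η, hη, H₂⟩ := exists_le_norm_bordered (E := HOne N) (c := c₁)
    (U := n * ‖u‖ + 1) (M := n * ‖z‖ + 1) (t := n * |l2Form N u z| / 2) hc₁ (by positivity)
    (by positivity) (by positivity)
  obtain ⟨R₂, H₃⟩ := h.exists_nlForm_bumps_sub_le (ι := ι) u z hη
  obtain ⟨R₃, H₄⟩ := exists_l2Form_bumps_sub_le (ι := ι) u z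
    (ε := n * |l2Form N u z| / 2) (by positivity)
  obtain ⟨δ, hδ, H₅⟩ := h.exists_nlMap_sub_sub_le (n * ‖u‖) (ε := c₂ / 4) (by positivity)
  -- The radius of uniqueness is fixed before `ε`; the bound `c₂ / 8` is what the bilinear coupling
  -- of `u` and `λ` requires. Only the smallness of the residual and of the mass defect makes the
  -- separation depend on `ε`.
  refine ⟨min δ (c₂ / 8), by positivity, fun ε hε hε₀ => ?_⟩
  obtain ⟨R₄, H₆⟩ := h.exists_nlMap_bumps_sub_le (ι := ι) u (ε := c₂ / 2 * ε) (by positivity)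
  obtain ⟨R₅, H₇⟩ := exists_l2Form_bumps_sub_le (ι := ι) u u (ε := c₂ / 2 * ε) (by positivity)
  refine ⟨max R₁ (max R₂ (max R₃ (max R₄ R₅))), fun a ha => ?_⟩
  set b : ι → Space N := fun i => latticePt (a i) with hb
  have ha₁ : Separated b R₁ := ha.mono (by simp)
  have ha₂ : Separated b R₂ := ha.mono (by simp)
  have ha₃ : Separated b R₃ := ha.mono (by simp)
  have ha₄ : Separated b R₄ := ha.mono (by simp)
  have ha₅ : Separated b R₅ := ha.mono (by simp)
  have hs := h.linForm_symm_sub hV (bumps b u) lam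
  have hL := H₁ a ha₁
  have hZ : ‖(linForm V - nlForm f (bumps b u) - lam • l2Form N) (bumps b z)
      - l2Form N (bumps b u)‖ ≤ η := by
    -- Each translate of `z` solves its own linearized equation exactly. In the sum the linear terms
    -- match, and only the interaction in `f'` remains.
    have e : (linForm V - nlForm f (bumps b u) - lam • l2Form N) (bumps b z)
        - l2Form N (bumps b u) = -(nlForm f (bumps b u) (bumps b z)
          - ∑ i, nlForm f (u.translate (b i)) (z.translate (b i))) := by
      have h1 : l2Form N (bumps b u) = ∑ i, (linForm V (z.translate (b i))
          - nlForm f (u.translate (b i)) (z.translate (b i))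
          - lam • l2Form N (z.translate (b i))) := by
        rw [bumps, map_sum]
        exact Finset.sum_congr rfl fun i _ => (h.linearized_translate hV hp hz (a i)).symm
      have h2 : linForm V (bumps b z) = ∑ i, linForm V (z.translate (b i)) := map_sum _ _ _
      have h3 : l2Form N (bumps b z) = ∑ i, l2Form N (z.translate (b i)) := map_sum _ _ _
      rw [h1, sub_apply, sub_apply, smul_apply, h2, h3]
      simp only [Finset.sum_sub_distrib, Finset.smul_sum]
      abel
    rw [e, norm_neg]
    exact H₃ b ha₂
  have ht : n * |l2Form N u z| / 2 ≤ |l2Form N (bumps b u) (bumps b z)| := by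
    have h1 := H₄ b ha₃
    have h2 := abs_sub_abs_le_abs_sub (n * l2Form N u z) (l2Form N (bumps b u) (bumps b z))
    rw [abs_sub_comm, abs_mul, abs_of_pos hn0] at h2
    linarith
  have hD := H₂ _ (l2Form N (bumps b u)) (bumps b z) hs hL
    ((norm_l2Form_apply_le _).trans ((norm_bumps_le b u).trans (by linarith)))
    ((norm_bumps_le b z).trans (by linarith)) ht hZ
  have hsurj := bordered_surjective hs hc₁ hL hc₂ hD
  obtain ⟨K₁, K₂⟩ := exists_unique_constrained (A := linForm V) (ℓ := l2Form N) l2Form_symm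
    abs_l2Form_le (ν := nlMap f) (K := nlForm f (bumps b u)) (u₀ := bumps b u) (lam₀ := lam)
    (α := n * l2Form N u u) (δ := min δ (c₂ / 8)) hc₂
    (by linarith [min_le_right δ (c₂ / 8)]) hD hsurj
    (fun v w h1 h2 => H₅ v w (bumps b u) (norm_bumps_le b u) (h1.trans (min_le_left _ _))
      (h2.trans (min_le_left _ _)))
  refine ⟨K₁, K₂ ε hε.le hε₀ ?_ (H₇ b ha₅)⟩
  -- The residual of the sum is the interaction error of `f`, since each translate is an exact
  -- solution.
  have e : linForm V (bumps b u) - nlMap f (bumps b u) - lam • l2Form N (bumps b u)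
      = -(nlMap f (bumps b u) - ∑ i, nlMap f (u.translate (b i))) := by
    have h1 : lam • l2Form N (bumps b u)
        = ∑ i, (linForm V (u.translate (b i)) - nlMap f (u.translate (b i))) := by
      rw [bumps, map_sum, Finset.smul_sum]
      exact Finset.sum_congr rfl fun i _ => (h.residual_translate hV hp hu (a i)).symm
    have h2 : linForm V (bumps b u) = ∑ i, linForm V (u.translate (b i)) := map_sum _ _ _
    rw [h1, h2, Finset.sum_sub_distrib]
    abel
  rw [e, norm_neg]
  exact H₆ b ha₄

end HasGrowth

end

/-! ### Chain rule and absolute values in `H¹`. -/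

section

variable {N : ℕ}

theorem tendsto_integral_mul_of_eLpNorm {α : Type*} [MeasurableSpace α] {μ : Measure α}
    {u : ℕ → α → ℝ} {v ψ : α → ℝ} (hu : ∀ k, MemLp (u k) 2 μ) (hv : MemLp v 2 μ)
    (hψ : MemLp ψ 2 μ) (h : Tendsto (fun k => eLpNorm (u k - v) 2 μ) atTop (𝓝 0)) :
    Tendsto (fun k => ∫ x, u k x * ψ x ∂μ) atTop (𝓝 (∫ x, v x * ψ x ∂μ)) := by
  have h1 : Tendsto (fun k => (hu k).toLp (u k)) atTop (𝓝 (hv.toLp v)) := by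
    rw [Lp.tendsto_Lp_iff_tendsto_eLpNorm'']
    exact h
  have e : ∀ {w : α → ℝ} (hw : MemLp w 2 μ),
      inner ℝ (hψ.toLp ψ) (hw.toLp w) = ∫ x, w x * ψ x ∂μ := by
    intro w hw
    rw [L2.inner_def]
    refine integral_congr_ae ?_
    filter_upwards [hw.coeFn_toLp, hψ.coeFn_toLp] with x h2 h3
    rw [h2, h3]; rfl
  have h2 := (tendsto_const_nhds (x := hψ.toLp ψ)).inner (𝕜 := ℝ) h1
  simp only [e] at h2
  exact h2

/-- Both sides of the defining identity pass to the `L²` limit against a fixed test function. -/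
theorem HasWeakGradient.of_tendsto {u : ℕ → Space N → ℝ} {g : ℕ → Space N → Space N}
    {v : Space N → ℝ} {k : Space N → Space N} (hu : ∀ j, MemLp (u j) 2) (hg : ∀ j, MemLp (g j) 2)
    (hv : MemLp v 2) (hk : MemLp k 2) (h : ∀ j, HasWeakGradient (u j) (g j))
    (h1 : Tendsto (fun j => eLpNorm (u j - v) 2 volume) atTop (𝓝 0))
    (h2 : Tendsto (fun j => eLpNorm (g j - k) 2 volume) atTop (𝓝 0)) : HasWeakGradient v k := by
  intro φ hφ hs i
  obtain ⟨c, s⟩ := test_partial hφ hs i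
  have hc : ∀ {w : Space N → Space N}, MemLp w 2 → MemLp (fun x => w x i) 2 := fun hw =>
    (EuclideanSpace.proj (𝕜 := ℝ) i).comp_memLp' hw
  have h3 := tendsto_integral_mul_of_eLpNorm hu hv (c.memLp_of_hasCompactSupport s) h1
  have h4 := tendsto_integral_mul_of_eLpNorm (fun j => hc (hg j)) (hc hk)
    (hφ.continuous.memLp_of_hasCompactSupport hs)
    (tendsto_of_tendsto_of_tendsto_of_le_of_le tendsto_const_nhds h2 (fun _ => zero_le)
      fun j => eLpNorm_mono fun x => by
        simpa using PiLp.norm_apply_le (g j x - k x) i)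
  refine tendsto_nhds_unique h3 ?_
  simp only [h _ φ hφ hs i]
  exact h4.neg

/-- The chain rule in `H¹`. -/
theorem HOne.exists_comp (u : HOne N) {g g' : ℝ → ℝ} (hd : ∀ s, HasDerivAt g (g' s) s)
    (hc : Continuous g') {K : ℝ} (hK : ∀ s, |g' s| ≤ K) (h0 : g 0 = 0) :
    ∃ w : HOne N, (∀ᵐ x, w.fn x = g (u.fn x)) ∧ ∀ᵐ x, w.grad x = g' (u.fn x) • u.grad x := by
  have hK0 : 0 ≤ K := (abs_nonneg _).trans (hK 0)
  have hg1 : ContDiff ℝ 1 g := by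
    rw [contDiff_one_iff_deriv]
    refine ⟨fun s => (hd s).differentiableAt, ?_⟩
    rwa [funext fun s => (hd s).deriv]
  have hlip : ∀ s t, |g s - g t| ≤ K * |s - t| := by
    intro s t
    have := Convex.norm_image_sub_le_of_norm_hasDerivWithin_le (f := g) (f' := g') (s := Set.univ)
      (C := K) (fun x _ => (hd x).hasDerivWithinAt) (fun x _ => hK x) convex_univ
      (Set.mem_univ t) (Set.mem_univ s)
    simpa using this
  have hv : MemLp (fun x => g (u.fn x)) 2 := by
    refine u.memLp_fn.of_le_mul (c := K) (hg1.continuous.comp_aestronglyMeasurable u.aesm_fn)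
      (Eventually.of_forall fun x => ?_)
    have := hlip (u.fn x) 0
    simpa [h0] using this
  have hk : MemLp (fun x => g' (u.fn x) • u.grad x) 2 := by
    refine u.memLp_grad.of_le_mul (c := K)
      ((hc.comp_aestronglyMeasurable u.aesm_fn).smul u.aesm_grad) (Eventually.of_forall fun x => ?_)
    rw [norm_smul]
    gcongr
    exact hK _
  obtain ⟨φ, h1, h2, h3, h4⟩ := u.exists_seq_ofTest
  have t1 : Tendsto (fun k => eLpNorm (φ k - u.fn) 2 volume) atTop (𝓝 0) := by
    refine (HOne.tendsto_eLpNorm_fn h3).congr fun k => eLpNorm_congr_ae ?_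
    filter_upwards [HOne.ofTest_fn (φ k) (h1 k) (h2 k)] with x hx
    rw [hx, Pi.sub_apply]
  have t2 : Tendsto (fun k => eLpNorm (gradient (φ k) - u.grad) 2 volume) atTop (𝓝 0) := by
    refine (HOne.tendsto_eLpNorm_grad h3).congr fun k => eLpNorm_congr_ae ?_
    filter_upwards [HOne.ofTest_grad (φ k) (h1 k) (h2 k)] with x hx
    rw [hx, Pi.sub_apply]
  have hφ1 : ∀ k, ContDiff ℝ 1 (φ k) := fun k => (h1 k).of_le (by simp)
  have hgrad : ∀ k x, gradient (fun y => g (φ k y)) x = g' (φ k x) • gradient (φ k) x := by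
    intro k x
    have e1 : HasFDerivAt (fun y => g (φ k y)) (g' (φ k x) • fderiv ℝ (φ k) x) x :=
      (hd (φ k x)).comp_hasFDerivAt x ((hφ1 k).differentiable (by simp) x).hasFDerivAt
    rw [gradient, gradient, e1.fderiv, map_smul]
  have hcs : ∀ k, HasCompactSupport (fun y => g (φ k y)) := fun k => (h2 k).comp_left h0
  have hwg : ∀ k, HasWeakGradient (fun y => g (φ k y)) (fun x => g' (φ k x) • gradient (φ k) x) := by
    intro k
    exact (hg1.comp (hφ1 k)).hasWeakGradient.congr_ae (Eventually.of_forall fun x => rfl)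
      (Eventually.of_forall (hgrad k))
  have hm1 : ∀ k, MemLp (fun y => g (φ k y)) 2 (volume : Measure (Space N)) := fun k =>
    (hg1.comp (hφ1 k)).continuous.memLp_of_hasCompactSupport (hcs k)
  have hm2 : ∀ k, MemLp (fun x => g' (φ k x) • gradient (φ k) x) 2 (volume : Measure (Space N)) :=
    fun k => Continuous.memLp_of_hasCompactSupport
      ((hc.comp (hφ1 k).continuous).smul (continuous_gradient (hφ1 k)))
      ((hasCompactSupport_gradient (h2 k)).mono fun x hx h => hx (by simp only [h, smul_zero]))
  have hcl : HasWeakGradient (fun x => g (u.fn x)) (fun x => g' (u.fn x) • u.grad x) := by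
    refine HasWeakGradient.of_tendsto hm1 hm2 hv hk hwg ?_ ?_
    · have := ENNReal.Tendsto.const_mul t1 (Or.inr (ENNReal.ofReal_ne_top (r := K)))
      rw [mul_zero] at this
      refine tendsto_of_tendsto_of_tendsto_of_le_of_le tendsto_const_nhds this
        (fun _ => zero_le) fun k => ?_
      exact eLpNorm_le_mul_eLpNorm_of_ae_le_mul (Eventually.of_forall fun x => hlip _ _) 2
    -- The gradient error splits as `g'(φ)(∇φ - ∇u) + (g'(φ) - g'(u)) ∇u`. The first term is small
    -- because `g'` is bounded, the second by dominated convergence.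
    · have t3 : Tendsto (fun k => eLpNorm (fun x => (g' (φ k x) - g' (u.fn x)) • u.grad x) 2 volume)
          atTop (𝓝 0) := by
        refine tendsto_eLpNorm_two_of_dominated (G := fun x => (2 * K) * ‖u.grad x‖) (fun k => ?_)
          (u.memLp_grad.norm.const_mul _) (fun k => Eventually.of_forall fun x => ?_) ?_
        · exact ((hc.comp (hφ1 k).continuous).aestronglyMeasurable.sub
            (hc.comp_aestronglyMeasurable u.aesm_fn)).smul u.aesm_grad
        · rw [norm_smul]
          gcongr
          refine (abs_sub _ _).trans ?_
          linarith [hK (φ k x), hK (u.fn x)]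
        · filter_upwards [h4] with x hx
          have h5 := (((hc.tendsto _).comp hx).sub_const (g' (u.fn x))).smul_const (u.grad x)
          simpa using h5
      have t4 := ENNReal.Tendsto.const_mul t2 (Or.inr (ENNReal.ofReal_ne_top (r := K)))
      rw [mul_zero] at t4
      have t5 := t4.add t3
      rw [add_zero] at t5
      refine tendsto_of_tendsto_of_tendsto_of_le_of_le tendsto_const_nhds t5
        (fun _ => zero_le) fun k => ?_
      have e : ((fun x => g' (φ k x) • gradient (φ k) x) - fun x => g' (u.fn x) • u.grad x)
          = (fun x => g' (φ k x) • (gradient (φ k) x - u.grad x))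
            + fun x => (g' (φ k x) - g' (u.fn x)) • u.grad x := by
        ext1 x
        simp only [Pi.sub_apply, Pi.add_apply]
        module
      rw [e]
      refine (eLpNorm_add_le (((hc.comp (hφ1 k).continuous).aestronglyMeasurable).smul
        ((continuous_gradient (hφ1 k)).aestronglyMeasurable.sub u.aesm_grad))
        (((hc.comp (hφ1 k).continuous).aestronglyMeasurable.sub
            (hc.comp_aestronglyMeasurable u.aesm_fn)).smul u.aesm_grad) (by norm_num)).trans ?_
      refine add_le_add ?_ le_rfl
      refine eLpNorm_le_mul_eLpNorm_of_ae_le_mul (Eventually.of_forall fun x => ?_) 2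
      change ‖g' (φ k x) • (gradient (φ k) x - u.grad x)‖ ≤ K * ‖gradient (φ k) x - u.grad x‖
      rw [norm_smul]
      gcongr
      exact hK _
  exact ⟨HOne.ofFun _ _ hv hk hcl, HOne.ofFun_fn hv hk hcl, HOne.ofFun_grad hv hk hcl⟩

theorem hasDerivAt_sqrt_sq_add {ε : ℝ} (hε : 0 < ε) (s : ℝ) :
    HasDerivAt (fun s : ℝ => √(s ^ 2 + ε ^ 2) - ε) (s / √(s ^ 2 + ε ^ 2)) s := by
  have h1 : HasDerivAt (fun s : ℝ => s ^ 2 + ε ^ 2) (2 * s) s := by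
    simpa using (hasDerivAt_pow 2 s).add_const (ε ^ 2)
  have h2 := (h1.sqrt (by positivity)).sub_const ε
  rwa [mul_div_mul_left _ _ two_ne_zero] at h2

/-- The absolute value of a function in `H¹` is in `H¹`. -/
theorem HOne.exists_abs (u : HOne N) :
    ∃ w : HOne N, (∀ᵐ x, w.fn x = |u.fn x|) ∧
      ∀ᵐ x, w.grad x = (SignType.sign (u.fn x) : ℝ) • u.grad x := by
  -- The absolute value is approximated by `√(s² + ε²) - ε`, which vanishes at zero and has
  -- derivative bounded by one. These derivatives converge pointwise to the sign, with value `0` at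
  -- `0`.
  let ε : ℕ → ℝ := fun k => 1 / ((k : ℝ) + 1)
  have hε : ∀ k, 0 < ε k := fun k => by positivity
  have hε0 : Tendsto ε atTop (𝓝 0) := tendsto_one_div_add_atTop_nhds_zero_nat
  have hle : ∀ k s, |s| ≤ √(s ^ 2 + ε k ^ 2) := fun k s => by
    rw [← Real.sqrt_sq_eq_abs]; exact Real.sqrt_le_sqrt (by nlinarith [sq_nonneg (ε k)])
  have hle2 : ∀ k s, √(s ^ 2 + ε k ^ 2) ≤ |s| + ε k := fun k s => by
    rw [Real.sqrt_le_left (by have := hε k; positivity)]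
    nlinarith [sq_abs s, abs_nonneg s, hε k, mul_nonneg (abs_nonneg s) (hε k).le]
  have hpos : ∀ k s, 0 < √(s ^ 2 + ε k ^ 2) := fun k s =>
    Real.sqrt_pos.2 (by have := hε k; positivity)
  have hb : ∀ k s, |s / √(s ^ 2 + ε k ^ 2)| ≤ 1 := fun k s => by
    rw [abs_div, abs_of_pos (hpos k s), div_le_one (hpos k s)]
    exact hle k s
  have hsign : ∀ s : ℝ, |(SignType.sign s : ℝ)| ≤ 1 := by
    intro s
    rcases lt_trichotomy s 0 with h | h | h <;> simp [h]
  have hlim : ∀ s : ℝ, Tendsto (fun k => s / √(s ^ 2 + ε k ^ 2)) atTop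
      (𝓝 (SignType.sign s : ℝ)) := by
    intro s
    rcases eq_or_ne s 0 with h | h
    · simp [h]
    · have h1 : Tendsto (fun k => √(s ^ 2 + ε k ^ 2)) atTop (𝓝 (√(s ^ 2 + 0 ^ 2))) :=
        (Real.continuous_sqrt.tendsto _).comp (tendsto_const_nhds.add (hε0.pow 2))
      rw [zero_pow two_ne_zero, add_zero, Real.sqrt_sq_eq_abs] at h1
      have h2 := (tendsto_const_nhds (x := s)).div h1 (abs_ne_zero.2 h)
      rw [show s / |s| = (SignType.sign s : ℝ) by
        rw [div_eq_iff (abs_ne_zero.2 h), sign_mul_abs]] at h2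
      exact h2
  have H : ∀ k, ∃ w : HOne N, (∀ᵐ x, w.fn x = √(u.fn x ^ 2 + ε k ^ 2) - ε k) ∧
      ∀ᵐ x, w.grad x = (u.fn x / √(u.fn x ^ 2 + ε k ^ 2)) • u.grad x := by
    intro k
    refine u.exists_comp (hasDerivAt_sqrt_sq_add (hε k)) ?_ (hb k) ?_
    · exact continuous_id.div (by fun_prop) fun s => (hpos k s).ne'
    · simp [Real.sqrt_sq (hε k).le]
  choose w hw hwg using H
  have hv : MemLp (fun x => |u.fn x|) 2 := u.memLp_fn.norm
  have hsm : AEStronglyMeasurable (fun x => (SignType.sign (u.fn x) : ℝ)) volume := by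
    refine aestronglyMeasurable_of_tendsto_ae atTop
      (f := fun k x => u.fn x / √(u.fn x ^ 2 + ε k ^ 2)) (fun k => ?_)
      (Eventually.of_forall fun x => hlim _)
    have : Continuous fun s : ℝ => s / √(s ^ 2 + ε k ^ 2) :=
      continuous_id.div (by fun_prop) fun s => (hpos k s).ne'
    exact this.comp_aestronglyMeasurable u.aesm_fn
  have hk : MemLp (fun x => (SignType.sign (u.fn x) : ℝ) • u.grad x) 2 := by
    refine u.memLp_grad.of_le (hsm.smul u.aesm_grad) (Eventually.of_forall fun x => ?_)
    rw [norm_smul]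
    exact mul_le_of_le_one_left (norm_nonneg _) (hsign _)
  have hcl : HasWeakGradient (fun x => |u.fn x|)
      (fun x => (SignType.sign (u.fn x) : ℝ) • u.grad x) := by
    refine HasWeakGradient.of_tendsto (fun k => (w k).memLp_fn) (fun k => (w k).memLp_grad) hv hk
      (fun k => (w k).hasWeakGradient) ?_ ?_
    · refine tendsto_eLpNorm_two_of_dominated (G := fun x => 2 * |u.fn x|)
        (fun k => (w k).aesm_fn.sub hv.1) (hv.const_mul 2) (fun k => ?_) ?_
      · filter_upwards [hw k] with x hx
        have h1 := hle k (u.fn x)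
        have h2 := hle2 k (u.fn x)
        have h3 : ε k ≤ √(u.fn x ^ 2 + ε k ^ 2) := Real.le_sqrt_of_sq_le (by nlinarith [sq_nonneg (u.fn x)])
        rw [Pi.sub_apply, hx, Real.norm_eq_abs, abs_le]
        constructor <;> linarith [abs_nonneg (u.fn x)]
      · filter_upwards [ae_all_iff.2 hw] with x hx
        refine squeeze_zero_norm (a := ε) (fun k => ?_) hε0
        have h1 := hle k (u.fn x)
        have h2 := hle2 k (u.fn x)
        rw [Pi.sub_apply, hx, Real.norm_eq_abs, abs_le]
        constructor <;> linarith [hε k]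
    · refine tendsto_eLpNorm_two_of_dominated (G := fun x => 2 * ‖u.grad x‖)
        (fun k => (w k).aesm_grad.sub hk.1) (u.memLp_grad.norm.const_mul 2) (fun k => ?_) ?_
      · filter_upwards [hwg k] with x hx
        rw [Pi.sub_apply, hx, ← sub_smul, norm_smul]
        gcongr
        refine (abs_sub _ _).trans ?_
        linarith [hb k (u.fn x), hsign (u.fn x)]
      · filter_upwards [ae_all_iff.2 hwg] with x hx
        have h5 := ((hlim (u.fn x)).sub_const (SignType.sign (u.fn x) : ℝ)).smul_const (u.grad x)
        rw [sub_self, zero_smul] at h5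
        refine h5.congr fun k => ?_
        rw [Pi.sub_apply, hx, sub_smul]
  exact ⟨HOne.ofFun _ _ hv hk hcl, HOne.ofFun_fn hv hk hcl, HOne.ofFun_grad hv hk hcl⟩

end

/-! ### Supersolutions, coercivity and nonnegativity. -/

section

open HOne

variable {N : ℕ}

/-- The chain rule for nonnegative functions in `H¹`. -/
theorem HOne.exists_comp_of_nonneg {u : HOne N} (hu : ∀ᵐ x, 0 ≤ u.fn x) {F F' : ℝ → ℝ}
    (hF : ∀ s, 0 ≤ s → HasDerivAt F (F' s) s) (hc : ContinuousOn F' (Set.Ici 0)) {K : ℝ}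
    (hK : ∀ s, 0 ≤ s → |F' s| ≤ K) (h0 : F 0 = 0) :
    ∃ w : HOne N, (∀ᵐ x, w.fn x = F (u.fn x)) ∧ ∀ᵐ x, w.grad x = F' (u.fn x) • u.grad x := by
  have hc' : Continuous fun t : ℝ => F' |t| :=
    hc.comp_continuous continuous_abs fun t => abs_nonneg t
  -- Since `F` is controlled only on the half line, it is replaced by the primitive of `F'(|t|)`,
  -- which agrees with it there and is defined everywhere.
  have hd : ∀ s : ℝ, HasDerivAt (fun s => ∫ t in (0 : ℝ)..s, F' |t|) (F' |s|) s := fun s =>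
    intervalIntegral.integral_hasDerivAt_right (hc'.intervalIntegrable _ _)
      (hc'.stronglyMeasurableAtFilter _ _) hc'.continuousAt
  obtain ⟨w, h1, h2⟩ := u.exists_comp hd hc' (K := K) (fun s => hK _ (abs_nonneg s)) (by simp)
  refine ⟨w, ?_, ?_⟩
  · filter_upwards [h1, hu] with x h3 h4
    have h5 : ∫ t in (0 : ℝ)..(u.fn x), F' |t| = F (u.fn x) - F 0 := by
      refine intervalIntegral.integral_eq_sub_of_hasDerivAt (fun t ht => ?_)
        (hc'.intervalIntegrable _ _)
      rw [Set.uIcc_of_le h4] at ht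
      rw [abs_of_nonneg ht.1]
      exact hF t ht.1
    rw [h3, h5, h0, sub_zero]
  · filter_upwards [h2, hu] with x h3 h4
    rw [h3, abs_of_nonneg h4]

theorem exists_isCutoff {φ : Space N → ℝ} (h1 : ContDiff ℝ ∞ φ) (h2 : HasCompactSupport φ) :
    ∃ B κ, IsCutoff φ B κ := by
  obtain ⟨B, hB⟩ := h1.continuous.bounded_above_of_compact_support h2
  obtain ⟨κ, hκ⟩ := (continuous_gradient (h1.of_le (by simp))).bounded_above_of_compact_support
    (hasCompactSupport_gradient h2)
  exact ⟨B, κ, h1, hB, hκ⟩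

theorem gradient_sq {φ : Space N → ℝ} (h1 : ContDiff ℝ ∞ φ) (x : Space N) :
    gradient (fun y => φ y ^ 2) x = (2 * φ x) • gradient φ x := by
  have h := ((h1.differentiable (by simp)) x).hasFDerivAt.pow 2
  rw [gradient, gradient, h.fderiv]
  simp

/-- The test function `φ² / (v + δ)`. -/
theorem HOne.exists_sq_div {v : HOne N} (hv : ∀ᵐ x, 0 ≤ v.fn x) {φ : Space N → ℝ}
    (h1 : ContDiff ℝ ∞ φ) (h2 : HasCompactSupport φ) {δ : ℝ} (hδ : 0 < δ) :
    ∃ w : HOne N, (∀ᵐ x, w.fn x = φ x ^ 2 / (v.fn x + δ)) ∧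
      ∀ᵐ x, w.grad x = (2 * φ x / (v.fn x + δ)) • gradient φ x
        - (φ x / (v.fn x + δ)) ^ 2 • v.grad x := by
  have hpos : ∀ s : ℝ, 0 ≤ s → 0 < s + δ := fun s hs => by linarith
  -- The function `1 / (v + δ)` need not be square integrable, but subtracting its value at `v = 0`
  -- makes the chain rule applicable. Multiplied by `φ²`, the subtracted constant returns as a test
  -- function.
  obtain ⟨y, hy1, hy2⟩ := HOne.exists_comp_of_nonneg hv (F := fun s => (s + δ)⁻¹ - δ⁻¹)
    (F' := fun s => -1 / (s + δ) ^ 2) (K := 1 / δ ^ 2)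
    (fun s hs => (((hasDerivAt_id s).add_const δ).inv (hpos s hs).ne').sub_const _)
    (by
      refine continuousOn_const.div (by fun_prop) fun s hs => ?_
      have := hpos s hs
      positivity)
    (fun s hs => by
      have := hpos s hs
      rw [abs_div, abs_neg, abs_one, abs_of_pos (by positivity)]
      gcongr
      linarith)
    (by simp)
  have h3 : ContDiff ℝ ∞ fun x => φ x ^ 2 := h1.pow 2
  have h4 : HasCompactSupport fun x => φ x ^ 2 := h2.comp_left (g := fun s : ℝ => s ^ 2) (by simp)
  obtain ⟨B, κ, hχ⟩ := exists_isCutoff h3 h4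
  refine ⟨δ⁻¹ • ofTest _ h3 h4 + mulCutoff hχ y, ?_, ?_⟩
  · filter_upwards [fn_add_ae (δ⁻¹ • ofTest _ h3 h4) (mulCutoff hχ y),
      fn_smul_ae δ⁻¹ (ofTest _ h3 h4), ofTest_fn _ h3 h4, mulCutoff_fn hχ y, hy1, hv]
      with x e1 e2 e3 e4 e5 e6
    rw [e1, e2, e3, e4, e5]
    have := hpos _ e6
    field_simp
    ring
  · filter_upwards [grad_add_ae (δ⁻¹ • ofTest _ h3 h4) (mulCutoff hχ y),
      grad_smul_ae δ⁻¹ (ofTest _ h3 h4), ofTest_grad _ h3 h4, mulCutoff_grad hχ y, hy1, hy2, hv]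
      with x e1 e2 e3 e4 e5 e6 e7
    rw [e1, e2, e3, e4, e5, e6, gradient_sq h1, smul_smul, smul_smul, smul_smul]
    have := hpos _ e7
    have c1 : φ x ^ 2 * (-1 / (v.fn x + δ) ^ 2) = -(φ x / (v.fn x + δ)) ^ 2 := by
      rw [div_pow]; ring
    have c2 : 2 * φ x / (v.fn x + δ)
        = δ⁻¹ * (2 * φ x) + ((v.fn x + δ)⁻¹ - δ⁻¹) * (2 * φ x) := by
      field_simp; ring
    rw [c1, c2]
    module

/-- A nonnegative symmetric form which is bounded below is coercive. -/
theorem exists_coercive {E : Type*} [NormedAddCommGroup E] [InnerProductSpace ℝ E]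
    {B : E →L[ℝ] E →L[ℝ] ℝ} (hs : ∀ v w, B v w = B w v) (h0 : ∀ v, 0 ≤ B v v) {c : ℝ}
    (hc : 0 < c) (hB : ∀ v, c * ‖v‖ ≤ ‖B v‖) : ∃ m > 0, ∀ v, m * ‖v‖ ^ 2 ≤ B v v := by
  refine ⟨c ^ 2 / (‖B‖ + 1), by positivity, fun v => ?_⟩
  -- Cauchy–Schwarz for the semidefinite form gives `‖B v‖² ≤ (‖B‖ + 1) B v v`, so the lower bound
  -- on `‖B v‖` becomes one on `B v v`.
  have hcs : ∀ w, B v w ^ 2 ≤ B v v * B w w := by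
    intro w
    have h1 : ∀ t : ℝ, 0 ≤ B w w * (t * t) + 2 * B v w * t + B v v := by
      intro t
      have h2 := h0 (v + t • w)
      simp only [map_add, map_smul, add_apply, smul_apply, smul_eq_mul] at h2
      rw [hs w v] at h2
      linarith
    have h3 := discrim_le_zero h1
    rw [discrim] at h3
    linarith
  have h1 : ‖B v‖ ≤ √(B v v * (‖B‖ + 1)) := by
    refine ContinuousLinearMap.opNorm_le_bound _ (Real.sqrt_nonneg _) fun w => ?_
    refine abs_le_of_sq_le_sq ?_ (by positivity)
    rw [mul_pow, Real.sq_sqrt (mul_nonneg (h0 v) (by positivity))]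
    refine (hcs w).trans ?_
    rw [mul_assoc]
    refine mul_le_mul_of_nonneg_left ?_ (h0 v)
    have h2 := (le_abs_self _).trans (B.le_opNorm₂ w w)
    nlinarith [sq_nonneg ‖w‖]
  have h2 : (c * ‖v‖) ^ 2 ≤ B v v * (‖B‖ + 1) := by
    refine (pow_le_pow_left₀ (by positivity) ((hB v).trans h1) 2).trans_eq ?_
    rw [Real.sq_sqrt (mul_nonneg (h0 v) (by positivity))]
  rw [div_mul_eq_mul_div, div_le_iff₀ (by positivity)]
  linarith [mul_pow c ‖v‖ 2]

theorem integrable_inner_gradient_self {φ : Space N → ℝ} (h1 : ContDiff ℝ ∞ φ)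
    (h2 : HasCompactSupport φ) :
    Integrable (fun x => ‖gradient φ x‖ ^ 2) (volume : Measure (Space N)) := by
  refine (Continuous.integrable_of_hasCompactSupport
    ((continuous_gradient (h1.of_le (by simp))).norm.pow 2) ?_)
  exact (hasCompactSupport_gradient h2).comp_left (g := fun y => ‖y‖ ^ 2) (by simp)

/-- The existence of a positive supersolution makes the quadratic form nonnegative. -/
theorem form_nonneg_of_supersolution {V : Space N → ℝ} {A lam : ℝ} (hV : IsMultiplier V A)
    {v : HOne N} (hv : ∀ᵐ x, 0 < v.fn x)
    (hsup : ∀ w : HOne N, (∀ᵐ x, 0 ≤ w.fn x) → 0 ≤ (linForm V - lam • l2Form N) v w) (w : HOne N) :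
    0 ≤ (linForm V - lam • l2Form N) w w := by
  have hform : ∀ y z : HOne N, (linForm V - lam • l2Form N) y z
      = (∫ x, inner ℝ (y.grad x) (z.grad x))
        + ∫ x, (V x * y.fn x * z.fn x - lam * (y.fn x * z.fn x)) := by
    intro y z
    simp only [linForm, sub_apply, smul_apply, add_apply]
    rw [gradForm_apply, hV.multForm_apply, l2Form_apply,
      integral_sub (hV.integrable y z) ((integrable_fn_mul y z).const_mul lam), integral_const_mul,
      smul_eq_mul]
    ring
  have htest : ∀ (φ : Space N → ℝ) (h1 : ContDiff ℝ ∞ φ) (h2 : HasCompactSupport φ),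
      0 ≤ (linForm V - lam • l2Form N) (ofTest φ h1 h2) (ofTest φ h1 h2) := by
    intro φ h1 h2
    set p := ofTest φ h1 h2 with hp
    have hpfn := ofTest_fn φ h1 h2
    have hpgrad := ofTest_grad φ h1 h2
    let δ : ℕ → ℝ := fun k => 1 / ((k : ℝ) + 1)
    have hδ : ∀ k, 0 < δ k := fun k => by positivity
    have hδ0 : Tendsto δ atTop (𝓝 0) := tendsto_one_div_add_atTop_nhds_zero_nat
    have hv' : ∀ᵐ x, 0 ≤ v.fn x := hv.mono fun x => le_of_lt
    have hint := (hV.integrable p p).sub ((integrable_fn_mul p p).const_mul lam)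
    set Q : Space N → ℝ := fun x => V x * p.fn x * p.fn x - lam * (p.fn x * p.fn x) with hQ
    have hQi : Integrable Q := hint
    have hlim : Tendsto (fun k => ∫ x, Q x * (v.fn x / (v.fn x + δ k))) atTop (𝓝 (∫ x, Q x)) := by
      refine tendsto_integral_of_dominated_convergence (fun x => ‖Q x‖) (fun k => ?_) hQi.norm
        (fun k => ?_) ?_
      · exact hQi.1.mul ((v.aesm_fn.aemeasurable.div
          (v.aesm_fn.aemeasurable.add_const _)).aestronglyMeasurable)
      · filter_upwards [hv] with x hx
        rw [norm_mul]
        refine mul_le_of_le_one_right (norm_nonneg _) ?_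
        have := hδ k
        rw [Real.norm_of_nonneg (by positivity), div_le_one (by positivity)]
        linarith
      · filter_upwards [hv] with x hx
        have h3 : Tendsto (fun k => v.fn x / (v.fn x + δ k)) atTop
            (𝓝 (v.fn x / (v.fn x + 0))) := tendsto_const_nhds.div (tendsto_const_nhds.add hδ0)
          (by rw [add_zero]; exact hx.ne')
        rw [add_zero, div_self hx.ne'] at h3
        simpa using h3.const_mul (Q x)
    -- Picone's inequality: testing the supersolution with `φ² / (v + δ)` and completing a square
    -- gives `∇v · ∇(φ² / (v + δ)) ≤ |∇φ|²`. The zeroth order terms acquire the factor `v / (v +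
    -- δ)`, which tends to one because `v > 0`.
    have hk : ∀ k, 0 ≤ (∫ x, ‖gradient φ x‖ ^ 2) + ∫ x, Q x * (v.fn x / (v.fn x + δ k)) := by
      intro k
      obtain ⟨y, hy1, hy2⟩ := HOne.exists_sq_div hv' h1 h2 (hδ k)
      have h3 := hsup y (by
        filter_upwards [hy1, hv] with x h4 h5
        have := hδ k
        rw [h4]; positivity)
      rw [hform] at h3
      refine h3.trans (add_le_add (integral_mono_ae (integrable_inner_grad v y)
        (integrable_inner_gradient_self h1 h2) ?_) (le_of_eq (integral_congr_ae ?_)))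
      · filter_upwards [hy2] with x h4
        rw [h4, inner_sub_right, real_inner_smul_right, real_inner_smul_right,
          real_inner_self_eq_norm_sq]
        set r := φ x / (v.fn x + δ k)
        have h5 : 0 ≤ ‖gradient φ x - r • v.grad x‖ ^ 2 := sq_nonneg _
        rw [norm_sub_sq_real, real_inner_smul_right, norm_smul, mul_pow, Real.norm_eq_abs, sq_abs,
          real_inner_comm] at h5
        have h6 : 2 * φ x / (v.fn x + δ k) = 2 * r := by rw [mul_div_assoc]
        rw [h6]
        linarith
      · filter_upwards [hy1, hpfn] with x h4 h5
        rw [h4, hQ]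
        simp only
        rw [h5]
        ring
    have h3 := ge_of_tendsto' (hlim.const_add _) hk
    rw [hform]
    refine h3.trans_eq (congrArg (· + _) (integral_congr_ae ?_))
    filter_upwards [hpgrad] with x h4
    rw [h4, real_inner_self_eq_norm_sq]
  obtain ⟨φ, h1, h2, h3, -⟩ := w.exists_seq_ofTest
  have hcont : Continuous fun y : HOne N => (linForm V - lam • l2Form N) y y :=
    (linForm V - lam • l2Form N).continuous.clm_apply continuous_id
  exact ge_of_tendsto' ((hcont.tendsto w).comp h3) fun k => htest _ _ _

/-- Solutions close to a nonnegative function are nonnegative. -/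
theorem HasGrowth.exists_nonneg_of_near {q : ℝ} {f : ℝ → ℝ} (h : HasGrowth N q f)
    {V : Space N → ℝ} {A lam m : ℝ} (hV : IsMultiplier V A) (hm : 0 < m)
    (hco : ∀ w, m * ‖w‖ ^ 2 ≤ (linForm V - lam • l2Form N) w w) :
    ∃ δ > 0, ∀ (u v : HOne N) (μ : ℝ), (∀ᵐ x, 0 ≤ u.fn x) → ‖v - u‖ ≤ δ → |μ - lam| ≤ δ →
      linForm V v - nlMap f v = μ • l2Form N v → ∀ᵐ x, 0 ≤ v.fn x := by
  obtain ⟨S, hS, HS⟩ := h.exists_isMultiplier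
  obtain ⟨C, hC, H⟩ := h.exists_abs_le (ε := m / 4) (by positivity)
  obtain ⟨δ, hδ, Hδ⟩ := exists_pos_forall_mul_rpow_le h.exponent_pos (C * S) (ε := m / 4)
    (by positivity)
  refine ⟨min δ (m / 4), by positivity, fun u v μ hu huv hμ heq => ?_⟩
  obtain ⟨y, hy1, hy2⟩ := v.exists_abs
  -- This is the negative part of `v`; the equation for `v` will be tested with it.
  set w : HOne N := (1 / 2 : ℝ) • (y - v) with hw
  have hwfn : ∀ᵐ x, w.fn x = (|v.fn x| - v.fn x) / 2 := by
    filter_upwards [fn_smul_ae (1 / 2) (y - v), fn_sub_ae y v, hy1] with x e1 e2 e3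
    rw [e1, e2, e3]; ring
  have hwgrad : ∀ᵐ x, w.grad x = (((SignType.sign (v.fn x) : ℝ) - 1) / 2) • v.grad x := by
    filter_upwards [grad_smul_ae (1 / 2) (y - v), grad_sub_ae y v, hy2] with x e1 e2 e3
    rw [e1, e2, e3]; module
  have hvw : ∀ᵐ x, v.fn x * w.fn x = -(w.fn x * w.fn x) := by
    filter_upwards [hwfn] with x hx
    rw [hx]
    rcases abs_cases (v.fn x) with ⟨e, -⟩ | ⟨e, -⟩ <;> rw [e] <;> ring
  -- An inequality suffices. On `{v = 0}` the formula gives `∇w = -∇v / 2`, and it need not be known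
  -- that `∇v` vanishes there.
  have e1 : gradForm N w w ≤ -gradForm N v w := by
    rw [gradForm_apply, gradForm_apply, ← integral_neg]
    refine integral_mono_ae (integrable_inner_grad w w) (integrable_inner_grad v w).neg ?_
    filter_upwards [hwgrad] with x hx
    rw [hx, real_inner_smul_right, real_inner_smul_right, real_inner_smul_left,
      real_inner_self_eq_norm_sq]
    have hs : (SignType.sign (v.fn x) : ℝ) = -1 ∨ (SignType.sign (v.fn x) : ℝ) = 0 ∨
        (SignType.sign (v.fn x) : ℝ) = 1 := by
      rcases lt_trichotomy (v.fn x) 0 with h1 | h1 | h1 <;> simp [h1]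
    rcases hs with hs | hs | hs <;> rw [hs] <;> nlinarith [sq_nonneg ‖v.grad x‖]
  have e2 : multForm V w w = -multForm V v w := by
    rw [hV.multForm_apply, hV.multForm_apply, ← integral_neg]
    refine integral_congr_ae ?_
    filter_upwards [hvw] with x hx
    rw [mul_assoc, mul_assoc, hx]; ring
  have e3 : l2Form N w w = -l2Form N v w := by
    rw [l2Form_apply, l2Form_apply, ← integral_neg]
    refine integral_congr_ae ?_
    filter_upwards [hvw] with x hx
    rw [hx]; ring
  have e4 : linForm V v w - nlMap f v w = μ * l2Form N v w := by
    have := congrArg (fun g : StrongDual ℝ (HOne N) => g w) heq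
    simpa using this
  -- Where `v < 0 ≤ u` one has `|v| ≤ |v - u|`, so `|f(v)| ≤ (m/4 + C |v - u|^(q-2)) |v|`, and the
  -- last power is a multiplier of small norm.
  have b1 : |nlMap f v w| ≤ (m / 4 + m / 4) * ‖w‖ * ‖w‖ := by
    have h1 : IsMultiplier (fun x => m / 4 + C * |(v - u).fn x| ^ (q - 2))
        (m / 4 + C * (S * ‖v - u‖ ^ (q - 2))) :=
      (IsMultiplier.of_bounded (by positivity) aestronglyMeasurable_const
        (Eventually.of_forall fun _ => (abs_of_pos (by positivity)).le)).add ((HS (v - u)).const_mul hC)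
    have h2 := h1.mono_bound (η := m / 4 + m / 4) (by
      have := Hδ ‖v - u‖ (norm_nonneg _) (huv.trans (min_le_left _ _))
      linarith)
    obtain ⟨_, Hv⟩ := h.isSource_comp v
    rw [h.nlMap_apply]
    refine abs_integral_le_integral_abs.trans (le_trans ?_ (h2.bound w w))
    refine integral_mono_ae (Hv.integrable w).abs (h2.integrable w w).abs ?_
    filter_upwards [hwfn, fn_sub_ae v u, hu] with x h3 h4 h5
    rcases le_or_gt 0 (v.fn x) with h6 | h6
    · rw [h3, abs_of_nonneg h6]; simp
    · have h7 : w.fn x = |v.fn x| := by rw [h3, abs_of_neg h6]; ring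
      have h8 : |v.fn x| ≤ |(v - u).fn x| := by
        rw [h4, abs_of_neg h6, abs_of_nonpos (by linarith)]; linarith
      have hexp := h.exponent_pos.le
      rw [h7, abs_mul, abs_mul, abs_mul, abs_abs]
      refine mul_le_mul_of_nonneg_right ((H _).trans ?_) (abs_nonneg _)
      refine mul_le_mul_of_nonneg_right (le_trans ?_ (le_abs_self _)) (abs_nonneg _)
      gcongr
  have hco' := hco w
  simp only [linForm, sub_apply, smul_apply, add_apply, smul_eq_mul] at hco' e4
  have hww : 0 ≤ l2Form N w w ∧ l2Form N w w ≤ ‖w‖ * ‖w‖ := by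
    refine ⟨?_, (le_abs_self _).trans (abs_l2Form_le w w)⟩
    rw [l2Form_apply]
    exact integral_nonneg fun x => mul_self_nonneg _
  have hμ' : (μ - lam) * l2Form N w w ≤ m / 4 * (‖w‖ * ‖w‖) :=
    mul_le_mul ((le_abs_self _).trans (hμ.trans (min_le_right _ _))) hww.2 hww.1 (by positivity)
  have hn : -nlMap f v w ≤ (m / 4 + m / 4) * ‖w‖ * ‖w‖ := (neg_le_abs _).trans b1
  -- Three quarters are spent: the linear part of the bound on `f`, the power of `v - u`, and `μ -
  -- lam`. The last quarter of coercivity forces `w = 0`.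
  have hfin : m * ‖w‖ ^ 2 ≤ 3 * m / 4 * ‖w‖ ^ 2 := by
    have h9 : l2Form N v w = -l2Form N w w := by linarith
    rw [h9] at e4
    nlinarith
  have hw0 : w = 0 := by
    have : ‖w‖ ^ 2 ≤ 0 := by
      by_contra! hcon
      have := mul_pos hm hcon
      linarith
    exact norm_eq_zero.1 (pow_eq_zero_iff two_ne_zero |>.1 (le_antisymm this (sq_nonneg _)))
  filter_upwards [hwfn, fn_zero_ae (N := N)] with x h1 h2
  rw [hw0, h2] at h1
  have : |v.fn x| = v.fn x := by linarith
  exact this ▸ abs_nonneg _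

end

/-! ### Strict positivity through a logarithmic estimate. -/

section

open HOne

variable {N : ℕ}

/-- A function with vanishing weak gradient is almost everywhere constant. -/
theorem HasWeakGradient.exists_ae_eq_const {u : Space N → ℝ} (hu : LocallyIntegrable u volume)
    (h : HasWeakGradient u fun _ => 0) : ∃ c, ∀ᵐ x, u x = c := by
  let ρ : ℕ → ContDiffBump (0 : Space N) := fun k =>
    ⟨1 / ((k : ℝ) + 1), 2 * (1 / ((k : ℝ) + 1)), by positivity, by
      have : 0 < 1 / ((k : ℝ) + 1) := by positivity
      linarith⟩
  have hρ : Tendsto (fun k => (ρ k).rOut) atTop (𝓝 0) := by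
    have := (tendsto_one_div_add_atTop_nhds_zero_nat (𝕜 := ℝ)).const_mul 2
    rwa [mul_zero] at this
  have hlim := ContDiffBump.ae_convolution_tendsto_right_of_locallyIntegrable (φ := ρ)
    (μ := (volume : Measure (Space N))) (K := 2) hρ (Eventually.of_forall fun k => le_rfl) hu
  -- The gradient of a mollification is the mollified weak gradient, here zero. Constants can only
  -- converge to a constant.
  have hconst : ∀ k x, mollify (ρ k) u x = mollify (ρ k) u 0 := by
    intro k x
    refine is_const_of_fderiv_eq_zero (𝕜 := ℝ)
      ((contDiff_mollify (ρ k) hu).differentiable (by simp)) (fun y => ?_) x 0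
    have h1 := gradient_mollify (ρ k) hu (locallyIntegrable_zero) h y
    rw [mollify_apply] at h1
    simp only [smul_zero, integral_zero] at h1
    rw [gradient] at h1
    simpa using h1
  have hlim' : ∀ᵐ x, Tendsto (fun k => mollify (ρ k) u 0) atTop (𝓝 (u x)) := by
    filter_upwards [hlim] with x hx
    refine hx.congr fun k => hconst k x
  obtain ⟨y, hy⟩ := hlim'.exists
  exact ⟨u y, hlim'.mono fun x hx => tendsto_nhds_unique hx hy⟩

/-- Logarithmic gradient estimate for nonnegative solutions. -/
theorem HasGrowth.exists_integral_log_le {q : ℝ} {f : ℝ → ℝ} (h : HasGrowth N q f)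
    {V : Space N → ℝ} {A μ : ℝ} (hV : IsMultiplier V A) (hA : 0 ≤ A) (hVA : ∀ᵐ x, |V x| ≤ A)
    {v : HOne N} (hv : ∀ᵐ x, 0 ≤ v.fn x)
    (heq : linForm V v - nlMap f v = μ • l2Form N v) {φ : Space N → ℝ} (h1 : ContDiff ℝ ∞ φ)
    (h2 : HasCompactSupport φ) :
    ∃ C : ℝ, ∀ δ : ℝ, 0 < δ →
      Integrable (fun x => ‖(φ x / (v.fn x + δ)) • v.grad x‖ ^ 2) ∧
      ∫ x, ‖(φ x / (v.fn x + δ)) • v.grad x‖ ^ 2 ≤ C := by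
  obtain ⟨S, hS, HS⟩ := h.exists_isMultiplier
  obtain ⟨C, hC, H⟩ := h.exists_abs_le one_pos
  obtain ⟨B, κ, hχ⟩ := exists_isCutoff h1 h2
  have hB := hχ.nonneg_bound
  set p := ofTest φ h1 h2
  have hpfn := ofTest_fn φ h1 h2
  set D : Space N → ℝ := fun x => (1 + A + |μ|) + C * |v.fn x| ^ (q - 2) with hD
  have hDm : IsMultiplier D ((1 + A + |μ|) + C * (S * ‖v‖ ^ (q - 2))) :=
    (IsMultiplier.of_bounded (by positivity) aestronglyMeasurable_const
      (Eventually.of_forall fun _ => (abs_of_nonneg (by positivity)).le)).add ((HS v).const_mul hC)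
  refine ⟨2 * (2 * (∫ x, ‖gradient φ x‖ ^ 2) + ∫ x, D x * p.fn x * p.fn x), fun δ hδ => ?_⟩
  have hint : Integrable (fun x => ‖(φ x / (v.fn x + δ)) • v.grad x‖ ^ 2) := by
    have hm : MemLp (fun x => (φ x / (v.fn x + δ)) • v.grad x) 2 := by
      refine v.memLp_grad.of_le_mul (c := B / δ) (((h1.continuous.aemeasurable.div
        (v.aesm_fn.aemeasurable.add_const δ)).aestronglyMeasurable).smul v.aesm_grad) ?_
      filter_upwards [hv] with x hx
      rw [norm_smul, Real.norm_eq_abs, abs_div, abs_of_pos (a := v.fn x + δ) (by positivity)]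
      gcongr
      · exact hχ.abs_le x
      · linarith
    exact hm.integrable_norm_pow two_ne_zero
  refine ⟨hint, ?_⟩
  obtain ⟨w, hw1, hw2⟩ := HOne.exists_sq_div hv h1 h2 hδ
  obtain ⟨_, Hv⟩ := h.isSource_comp v
  have e1 : gradForm N v w + multForm V v w - nlMap f v w = μ * l2Form N v w := by
    have := congrArg (fun g : StrongDual ℝ (HOne N) => g w) heq
    simpa [linForm] using this
  -- The test function is `φ² / (v + δ)`. With `r = φ / (v + δ)`, Young's inequality `2 r ∇φ · ∇v ≤
  -- 2 |∇φ|² + r² |∇v|² / 2` leaves half of the negative term `-r² |∇v|²`.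
  have b1 : gradForm N v w ≤ 2 * (∫ x, ‖gradient φ x‖ ^ 2)
      - 1 / 2 * ∫ x, ‖(φ x / (v.fn x + δ)) • v.grad x‖ ^ 2 := by
    have hg := integrable_inner_gradient_self h1 h2
    rw [gradForm_apply, ← integral_const_mul, ← integral_const_mul,
      ← integral_sub (hg.const_mul _) (hint.const_mul _)]
    refine integral_mono_ae (integrable_inner_grad v w)
      ((hg.const_mul _).sub (hint.const_mul _)) ?_
    filter_upwards [hw2] with x h4
    set r := φ x / (v.fn x + δ) with hr
    have h5 : 0 ≤ ‖(2 : ℝ) • gradient φ x - r • v.grad x‖ ^ 2 := sq_nonneg _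
    rw [norm_sub_sq_real, real_inner_smul_right, real_inner_smul_left, norm_smul, mul_pow,
      Real.norm_of_nonneg zero_le_two, real_inner_comm] at h5
    have h6 : 2 * φ x / (v.fn x + δ) = 2 * r := by rw [mul_div_assoc]
    have h7 : ‖r • v.grad x‖ ^ 2 = r ^ 2 * ‖v.grad x‖ ^ 2 := by
      rw [norm_smul, mul_pow, Real.norm_eq_abs, sq_abs]
    rw [h4, inner_sub_right, real_inner_smul_right, real_inner_smul_right,
      real_inner_self_eq_norm_sq, h6, h7]
    rw [h7] at h5
    linarith
  have e2 : multForm V v w - nlMap f v w - μ * l2Form N v w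
      = ∫ x, (V x * v.fn x * w.fn x - f (v.fn x) * w.fn x - μ * (v.fn x * w.fn x)) := by
    have i1 := integral_sub ((hV.integrable v w).sub (Hv.integrable w))
      ((integrable_fn_mul v w).const_mul μ)
    simp only [Pi.sub_apply] at i1
    rw [i1, integral_sub (hV.integrable v w) (Hv.integrable w), integral_const_mul,
      hV.multForm_apply, h.nlMap_apply, l2Form_apply]
  -- Each zeroth order term is at most a weight times `v w = φ² v / (v + δ) ≤ φ²`, so the bound does
  -- not depend on `δ`.
  have b2 : multForm V v w - nlMap f v w - μ * l2Form N v w ≤ ∫ x, D x * p.fn x * p.fn x := by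
    rw [e2]
    refine integral_mono_ae (((hV.integrable v w).sub (Hv.integrable w)).sub
      ((integrable_fn_mul v w).const_mul μ)) (hDm.integrable p p) ?_
    filter_upwards [hw1, hv, hVA, hpfn] with x h4 h5 h6 h7
    have hw0 : 0 ≤ w.fn x := by rw [h4]; positivity
    have hvw : v.fn x * w.fn x ≤ p.fn x * p.fn x := by
      rw [h4, h7, mul_div_assoc', div_le_iff₀ (by positivity)]
      nlinarith [mul_nonneg (sq_nonneg (φ x)) hδ.le]
    have hf := H (v.fn x)
    rw [abs_of_nonneg h5] at hf
    have hf1 : -(f (v.fn x) * w.fn x) ≤ (1 + C * |v.fn x| ^ (q - 2)) * (v.fn x * w.fn x) := by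
      rw [← mul_assoc, ← neg_mul]
      rw [abs_of_nonneg h5]
      exact mul_le_mul_of_nonneg_right ((neg_le_abs _).trans hf) hw0
    have hvw0 : 0 ≤ v.fn x * w.fn x := mul_nonneg h5 hw0
    have hV1 : V x * (v.fn x * w.fn x) ≤ A * (v.fn x * w.fn x) :=
      mul_le_mul_of_nonneg_right ((le_abs_self _).trans h6) hvw0
    have hμ1 : -μ * (v.fn x * w.fn x) ≤ |μ| * (v.fn x * w.fn x) :=
      mul_le_mul_of_nonneg_right (neg_le_abs _) hvw0
    have hD0 : 0 ≤ D x := by rw [hD]; positivity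
    have hlast : D x * (v.fn x * w.fn x) ≤ D x * (p.fn x * p.fn x) :=
      mul_le_mul_of_nonneg_left hvw hD0
    have hDx : D x = (1 + A + |μ|) + C * |v.fn x| ^ (q - 2) := rfl
    rw [mul_assoc (D x)]
    refine le_trans ?_ hlast
    rw [hDx]
    linarith
  linarith

/-- Nontrivial nonnegative solutions are positive. -/
theorem HasGrowth.pos_of_nonneg {q : ℝ} {f : ℝ → ℝ} (h : HasGrowth N q f)
    {V : Space N → ℝ} {A μ : ℝ} (hV : IsMultiplier V A) (hA : 0 ≤ A) (hVA : ∀ᵐ x, |V x| ≤ A)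
    {v : HOne N} (hv : ∀ᵐ x, 0 ≤ v.fn x)
    (heq : linForm V v - nlMap f v = μ • l2Form N v) (h0 : l2Form N v v ≠ 0) :
    ∀ᵐ x, 0 < v.fn x := by
  -- This choice makes `1 + log (s + δ k) / (k + 1)` vanish at `s = 0`, as the chain rule requires.
  -- For `s > 0` the expression tends to `1`, so these functions of `v` converge to the indicator of
  -- `{v > 0}`.
  let δ : ℕ → ℝ := fun k => Real.exp (-((k : ℝ) + 1))
  have hδ : ∀ k, 0 < δ k := fun k => Real.exp_pos _
  have hδ1 : ∀ k, δ k ≤ 1 := fun k => Real.exp_le_one_iff.2 (by linarith [Nat.cast_nonneg (α := ℝ) k])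
  have hk1 : ∀ k : ℕ, 0 < (k : ℝ) + 1 := fun k => by positivity
  have hk2 : ∀ k : ℕ, 1 ≤ (k : ℝ) + 1 := fun k => by linarith [Nat.cast_nonneg (α := ℝ) k]
  have hδ0 : Tendsto δ atTop (𝓝 0) :=
    Real.tendsto_exp_neg_atTop_nhds_zero.comp
      (tendsto_atTop_add_const_right _ _ tendsto_natCast_atTop_atTop)
  let F : ℕ → ℝ → ℝ := fun k s => 1 + Real.log (s + δ k) / ((k : ℝ) + 1)
  have Hy : ∀ k, ∃ y : HOne N, (∀ᵐ x, y.fn x = F k (v.fn x)) ∧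
      ∀ᵐ x, y.grad x = (1 / (v.fn x + δ k) / ((k : ℝ) + 1)) • v.grad x := by
    intro k
    refine HOne.exists_comp_of_nonneg hv (F' := fun s => 1 / (s + δ k) / ((k : ℝ) + 1))
      (K := 1 / δ k) (fun s hs => ?_) ?_ (fun s hs => ?_) ?_
    · have := hδ k
      exact ((((hasDerivAt_id s).add_const (δ k)).log (by simp only [id]; positivity)).div_const
        _).const_add 1
    · refine (continuousOn_const.div (by fun_prop) fun s hs => ?_).div_const _
      have := hδ k
      have h3 : (0 : ℝ) ≤ s := hs
      positivity
    · have h3 := hδ k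
      have h4 := hk1 k
      rw [abs_of_nonneg (by positivity)]
      refine (div_le_self (by positivity) (hk2 k)).trans ?_
      gcongr
      linarith
    · simp only [F, δ, zero_add, Real.log_exp, neg_div, div_self (hk1 k).ne']
      ring
  choose y hy1 hy2 using Hy
  let I : Space N → ℝ := fun x => if 0 < v.fn x then 1 else 0
  have hlim : ∀ᵐ x, Tendsto (fun k => (y k).fn x) atTop (𝓝 (I x)) := by
    filter_upwards [ae_all_iff.2 hy1, hv] with x h3 h4
    simp only [h3]
    rcases h4.eq_or_lt with h5 | h5
    · simp only [I, ← h5, lt_irrefl, if_false]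
      refine tendsto_const_nhds.congr fun k => ?_
      simp only [F, δ, zero_add, Real.log_exp, neg_div, div_self (hk1 k).ne']
      ring
    · simp only [I, h5, if_true]
      have h6 : Tendsto (fun k => Real.log (v.fn x + δ k)) atTop (𝓝 (Real.log (v.fn x + 0))) :=
        (Real.continuousAt_log (by rw [add_zero]; exact h5.ne')).tendsto.comp
          (tendsto_const_nhds.add hδ0)
      have h7 := h6.div_atTop (tendsto_atTop_add_const_right atTop (1 : ℝ)
        tendsto_natCast_atTop_atTop)
      simpa [F] using h7.const_add 1
  have hbd : ∀ k, ∀ᵐ x, |(y k).fn x| ≤ 1 + |v.fn x| := by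
    intro k
    filter_upwards [hy1 k, hv] with x h3 h4
    have h5 := hδ k
    have h6 := hk1 k
    have h7 : -((k : ℝ) + 1) ≤ Real.log (v.fn x + δ k) := by
      rw [Real.le_log_iff_exp_le (by positivity)]
      change δ k ≤ _
      linarith
    have h8 : Real.log (v.fn x + δ k) ≤ v.fn x := by
      have := Real.log_le_sub_one_of_pos (x := v.fn x + δ k) (by positivity)
      linarith [hδ1 k]
    have h9 : -1 ≤ Real.log (v.fn x + δ k) / ((k : ℝ) + 1) := by
      rw [le_div_iff₀ h6]; linarith
    have h10 : Real.log (v.fn x + δ k) / ((k : ℝ) + 1) ≤ v.fn x := by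
      rw [div_le_iff₀ h6]
      nlinarith [hk2 k]
    rw [h3, abs_of_nonneg h4, abs_le]
    simp only [F]
    constructor <;> linarith
  have hIm : AEStronglyMeasurable I volume :=
    aestronglyMeasurable_of_tendsto_ae atTop (fun k => (y k).aesm_fn) hlim
  have hIl : LocallyIntegrable I volume := by
    refine (memLp_top_of_bound hIm 1 (Eventually.of_forall fun x => ?_)).locallyIntegrable le_top
    simp only [I]
    split_ifs <;> simp
  have hIw : HasWeakGradient I fun _ => 0 := by
    intro φ h1 h2 i
    obtain ⟨c, s⟩ := test_partial h1 h2 i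
    obtain ⟨C, hC⟩ := h.exists_integral_log_le hV hA hVA hv heq h1 h2
    have t1 : Tendsto (fun k => ∫ x, (y k).fn x * fderiv ℝ φ x (EuclideanSpace.single i 1)) atTop
        (𝓝 (∫ x, I x * fderiv ℝ φ x (EuclideanSpace.single i 1))) := by
      refine tendsto_integral_of_dominated_convergence
        (fun x => (1 + |v.fn x|) * |fderiv ℝ φ x (EuclideanSpace.single i 1)|)
        (fun k => (y k).aesm_fn.mul c.aestronglyMeasurable) ?_ (fun k => ?_) ?_
      · have i1 := (c.integrable_of_hasCompactSupport s (μ := (volume : Measure (Space N)))).abs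
        have i2 : Integrable (fun x => v.fn x * fderiv ℝ φ x (EuclideanSpace.single i 1)) :=
          v.memLp_fn.integrable_mul (q := 2) (c.memLp_of_hasCompactSupport s)
        refine (i1.add i2.abs).congr (Eventually.of_forall fun x => ?_)
        simp only [Pi.add_apply, abs_mul]; ring
      · filter_upwards [hbd k] with x hx
        rw [norm_mul]
        exact mul_le_mul_of_nonneg_right hx (abs_nonneg _)
      · filter_upwards [hlim] with x hx
        exact hx.mul_const _
    -- The gradient of `y k` is `∇v / (v + δ k)` divided by `k + 1`. On the support of `φ` the
    -- logarithmic estimate controls the product with `φ` uniformly in `k`, so the integrals are of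
    -- order `1 / (k + 1)`.
    have t2 : Tendsto (fun k => ∫ x, (y k).fn x * fderiv ℝ φ x (EuclideanSpace.single i 1)) atTop
        (𝓝 0) := by
      have hK : Integrable ((tsupport φ).indicator fun _ => (1 : ℝ))
          (volume : Measure (Space N)) :=
        (integrable_indicator_iff h2.measurableSet).2
          (integrableOn_const (h2.measure_lt_top.ne))
      set M := ∫ x, (tsupport φ).indicator (fun _ => (1 : ℝ)) x
      have hle : ∀ k : ℕ, ‖∫ x, (y k).fn x * fderiv ℝ φ x (EuclideanSpace.single i 1)‖
          ≤ (M + C) / ((k : ℝ) + 1) := by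
        intro k
        obtain ⟨j1, j2⟩ := hC (δ k) (hδ k)
        rw [(y k).hasWeakGradient φ h1 h2 i, norm_neg]
        refine (norm_integral_le_of_norm_le ((hK.add j1).div_const ((k : ℝ) + 1)) ?_).trans ?_
        · filter_upwards [hy2 k, hv] with x h3 h4
          have h5 : ‖(y k).grad x i * φ x‖ ≤ ‖(φ x / (v.fn x + δ k)) • v.grad x‖ / ((k : ℝ) + 1) := by
            rw [norm_mul]
            have h6 := PiLp.norm_apply_le ((y k).grad x) i
            have h7 := hδ k
            have h8 := hk1 k
            refine (mul_le_mul_of_nonneg_right h6 (norm_nonneg _)).trans (le_of_eq ?_)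
            rw [h3, norm_smul, norm_smul, norm_div, norm_div, norm_div, norm_one,
              Real.norm_of_nonneg h8.le]
            ring
          refine h5.trans (div_le_div_of_nonneg_right ?_ (hk1 k).le)
          rw [Pi.add_apply]
          by_cases h6 : x ∈ tsupport φ
          · rw [Set.indicator_of_mem h6]
            -- The estimate is for the square, so `t ≤ 1 + t²` is used on the support of `φ`.
            nlinarith [sq_nonneg (‖(φ x / (v.fn x + δ k)) • v.grad x‖ - 1)]
          · rw [Set.indicator_of_notMem h6, image_eq_zero_of_notMem_tsupport h6]
            simp
        · rw [integral_div]
          refine div_le_div_of_nonneg_right ?_ (hk1 k).le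
          simp only [Pi.add_apply]
          rw [integral_add hK j1]
          exact add_le_add le_rfl j2
      exact squeeze_zero_norm hle (tendsto_const_nhds.div_atTop
        (tendsto_atTop_add_const_right atTop (1 : ℝ) tendsto_natCast_atTop_atTop))
    rw [tendsto_nhds_unique t1 t2]
    simp
  obtain ⟨c, hc⟩ := hIw.exists_ae_eq_const hIl
  -- The indicator is constant. Either it equals one and `v > 0`, or `v = 0` almost everywhere,
  -- against `h0`.
  by_cases hc1 : c = 1
  · filter_upwards [hc] with x hx
    by_contra hcon
    simp only [I, hcon, if_false, hc1] at hx
    norm_num at hx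
  · refine absurd ?_ h0
    rw [l2Form_apply, ← integral_zero (Space N) ℝ]
    refine integral_congr_ae ?_
    filter_upwards [hc, hv] with x h3 h4
    have h5 : ¬ 0 < v.fn x := fun h5 => hc1 (by simpa [I, h5] using h3.symm)
    rw [le_antisymm (not_lt.1 h5) h4, zero_mul]

end

/-! ### Weak linearized equation and positivity near multibumps. -/

section

open HOne

variable {N : ℕ}

theorem HOne.bumps_nonneg {ι : Type*} [Fintype ι] {u : HOne N} (hu : ∀ᵐ x, 0 ≤ u.fn x)
    (b : ι → Space N) : ∀ᵐ x, 0 ≤ (bumps b u).fn x := by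
  have h1 : ∀ i, ∀ᵐ x, 0 ≤ (u.translate (b i)).fn x := fun i => by
    filter_upwards [translate_fn_ae (b i) u, H1.ae_sub hu (b i)] with x h2 h3
    rw [h2]; exact h3
  filter_upwards [bumps_fn_ae b u, ae_all_iff.2 h1] with x h2 h3
  rw [h2]
  exact Finset.sum_nonneg fun i _ => h3 i

theorem separated_of_le_minDist {n : ℕ} {a : Fin n → Fin N → ℤ} {R : ℝ} (h : R ≤ minDist a) :
    Separated (fun i => latticePt (a i)) R := fun i j hij =>
  h.trans (ciInf_le (f := fun p : {p : Fin n × Fin n // p.1 ≠ p.2} =>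
    ‖latticePt (a p.1.1) - latticePt (a p.1.2)‖)
    ⟨0, by rintro _ ⟨p, rfl⟩; exact norm_nonneg _⟩ ⟨(i, j), hij⟩)

namespace HasGrowth

variable {q : ℝ} {f : ℝ → ℝ} (h : HasGrowth N q f) {V : Space N → ℝ} {A : ℝ}
  (hV : IsMultiplier V A)

include h hV

/-- The weak form of the linearized equation. -/
theorem isLinearizedSol_iff {u z : HOne N} {lam : ℝ} {g : StrongDual ℝ (HOne N)} :
    IsLinearizedSol (N := N) V f u lam g z
      ↔ (linForm V - nlForm f u - lam • l2Form N) z = g := by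
  obtain ⟨_, Hu⟩ := h.isMultiplier_deriv u
  have e : ∀ w : HOne N, ∫ x, (inner ℝ (z.grad x) (w.grad x) + (V x - lam) * z.fn x * w.fn x
      - deriv f (u.fn x) * z.fn x * w.fn x)
      = (linForm V - nlForm f u - lam • l2Form N) z w := by
    intro w
    have i0 := (integrable_inner_grad z w).add (hV.integrable z w)
    have i1 := integral_sub (i0.sub (Hu.integrable z w)) ((integrable_fn_mul z w).const_mul lam)
    have i2 := integral_sub i0 (Hu.integrable z w)
    simp only [Pi.sub_apply, Pi.add_apply] at i1 i2
    simp only [sub_apply, smul_apply]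
    rw [linForm_apply hV, h.nlForm_apply, l2Form_apply, smul_eq_mul, ← integral_const_mul, ← i2,
      ← i1]
    refine integral_congr_ae (Eventually.of_forall fun x => ?_)
    simp only; ring
  constructor
  · intro H
    ext w
    rw [← e]
    exact H w
  · intro H w
    exact (e w).trans (congrArg (fun g : StrongDual ℝ (HOne N) => g w) H)

/-- Positivity of solutions close to sums of translates of a positive solution. -/
theorem exists_pos_of_near (hp : IsOnePeriodic V) (hA : 0 ≤ A) (hVA : ∀ᵐ x, |V x| ≤ A)
    (hN : 1 ≤ N) {u : HOne N} {lam c : ℝ} (hu : linForm V u - nlMap f u = lam • l2Form N u)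
    (hc : 0 < c) (hlow : ∀ v, c * ‖v‖ ≤ ‖(linForm V - nlForm f u - lam • l2Form N) v‖)
    (hpos : ∀ᵐ x, 0 < u.fn x) (hf : ∀ᵐ x, 0 ≤ f (u.fn x)) :
    ∃ δ > 0, ∀ {ι : Type} [Fintype ι] (b : ι → Space N) (v : HOne N) (μ : ℝ),
      ‖v - bumps b u‖ ≤ δ → |μ - lam| ≤ δ → linForm V v - nlMap f v = μ • l2Form N v →
      l2Form N v v ≠ 0 → ∀ᵐ x, 0 < v.fn x := by
  -- Since `f(u) ≥ 0`, the positive function `u` is a supersolution of the operator without the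
  -- nonlinear term.
  have h0 := form_nonneg_of_supersolution hV hpos (lam := lam) fun w hw => by
    have e : (linForm V - lam • l2Form N) u w = nlMap f u w := by
      have := congrArg (fun g : StrongDual ℝ (HOne N) => g w) hu
      simp only [sub_apply, smul_apply] at this ⊢
      linarith
    rw [e, h.nlMap_apply]
    refine integral_nonneg_of_ae ?_
    filter_upwards [hf, hw] with x h1 h2
    exact mul_nonneg h1 h2
  obtain ⟨m, hm, hco⟩ := exists_coercive (B := linForm V - lam • l2Form N) (fun v w => by
    simp only [sub_apply, smul_apply]
    rw [linForm_symm hV, l2Form_symm]) h0 hc (h.le_norm_linForm_sub hV hp hN hlow)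
  obtain ⟨δ, hδ, H⟩ := h.exists_nonneg_of_near hV hm hco
  refine ⟨δ, hδ, fun b v μ h1 h2 h3 h4 => ?_⟩
  exact h.pos_of_nonneg hV hA hVA
    (H _ v μ (bumps_nonneg (hpos.mono fun x => le_of_lt) b) h1 h2 h3) h3 h4

end HasGrowth

end

end

/-! ### The multibump theorem. -/

theorem mainTheorem1 (N : ℕ) (hN : 1 ≤ N)
    (V : Space N → ℝ) (hV : MemLp V ∞ volume) (hper : IsOnePeriodic V)
    (f : ℝ → ℝ) (hf : IsAdmissible N f)
    (α : ℝ) (hα : 0 < α) (n : ℕ) (hn : 2 ≤ n)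
    (ubar : H1 N) (lambar : ℝ)
    (hubar : IsFullyNondegenerate V f (α / n) ubar lambar) :
    ∃ ε₀ : ℝ, 0 < ε₀ ∧ ∀ ε : ℝ, 0 < ε → ∃ R : ℝ, 0 < R ∧
      ∀ a : Fin n → Fin N → ℤ, R ≤ minDist a →
        ∃ (u : H1 N) (lam : ℝ),
          IsCriticalWith V f α u lam ∧ ‖u - bumpSum a ubar‖ ≤ ε ∧ |lam - lambar| ≤ ε ∧
          (ε ≤ ε₀ → ∀ (u' : H1 N) (lam' : ℝ), IsCriticalWith V f α u' lam' →
            ‖u' - bumpSum a ubar‖ ≤ ε → |lam' - lambar| ≤ ε → u' = u ∧ lam' = lam) ∧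
          (IsPositive ubar → (∀ᵐ x, 0 ≤ f (ubar.fn x)) → ¬ (∀ᵐ x, f (ubar.fn x) = 0) →
            IsPositive u) := by
  obtain ⟨q, h⟩ := hf.exists_hasGrowth hN
  obtain ⟨A, hA, hVA, hVm⟩ := MemLp.isMultiplier hV
  let u₀ : HOne N := ubar
  have hn0 : (n : ℝ) ≠ 0 := by positivity
  have : Nonempty (Fin n) := ⟨⟨0, by omega⟩⟩
  obtain ⟨hl2, hcrit⟩ := (h.isCriticalWith_iff hVm (u := u₀)).1 hubar.critical
  have hαn : (Fintype.card (Fin n) : ℝ) * HOne.l2Form N u₀ u₀ = α := by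
    rw [hl2, Fintype.card_fin]; field_simp
  -- Unique solvability for all right-hand sides is bijectivity of the linearization, and the open
  -- mapping theorem turns it into a lower bound.
  have hbij : Function.Bijective (linForm V - nlForm f u₀ - lambar • HOne.l2Form N) := by
    refine ⟨fun z z' hzz' => ?_, fun g => ?_⟩
    · obtain ⟨_, _, hz⟩ := hubar.solvable
        ((linForm V - nlForm f u₀ - lambar • HOne.l2Form N) z : StrongDual ℝ (HOne N))
      exact (hz z ((h.isLinearizedSol_iff hVm (u := u₀)).2 rfl)).trans
        (hz z' ((h.isLinearizedSol_iff hVm (u := u₀)).2 hzz'.symm)).symm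
    · obtain ⟨z, hz, _⟩ := hubar.solvable g
      exact ⟨z, (h.isLinearizedSol_iff hVm (u := u₀)).1 hz⟩
  obtain ⟨c, hc, hlow⟩ := exists_le_norm_of_bijective _ hbij
  obtain ⟨z, hz⟩ := hbij.2 (HOne.l2Form N u₀)
  have huz : HOne.l2Form N u₀ z ≠ 0 := by
    refine hubar.transversal z ?_
    have e : (H1.l2Dual ubar : StrongDual ℝ (HOne N)) = HOne.l2Form N u₀ :=
      ContinuousLinearMap.ext fun w => H1.l2Dual_apply (N := N) ubar w
    exact (h.isLinearizedSol_iff hVm (u := u₀)).2 (hz.trans e.symm)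
  obtain ⟨ε₀, hε₀, H⟩ := h.exists_multibump hVm hper hN (ι := Fin n) hcrit hc hlow hz huz
  -- The radius for positivity must be available before the positivity hypotheses; when they fail,
  -- any radius serves, here `1`.
  obtain ⟨δ, hδ, Hpos⟩ : ∃ δ > 0, (∀ᵐ x, 0 < u₀.fn x) → (∀ᵐ x, 0 ≤ f (u₀.fn x)) →
      ∀ (b : Fin n → Space N) (v : HOne N) (μ : ℝ), ‖v - HOne.bumps b u₀‖ ≤ δ →
        |μ - lambar| ≤ δ → linForm V v - nlMap f v = μ • HOne.l2Form N v →
        HOne.l2Form N v v ≠ 0 → ∀ᵐ x, 0 < v.fn x := by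
    by_cases hh : (∀ᵐ x, 0 < u₀.fn x) ∧ (∀ᵐ x, 0 ≤ f (u₀.fn x))
    · obtain ⟨δ, hδ, K⟩ := h.exists_pos_of_near hVm hper hA hVA hN hcrit hc hlow hh.1 hh.2
      exact ⟨δ, hδ, fun _ _ b => K b⟩
    · exact ⟨1, one_pos, fun h1 h2 => absurd ⟨h1, h2⟩ hh⟩
  refine ⟨ε₀, hε₀, fun ε hε => ?_⟩
  -- The solution is built in the smallest of the three balls, so positivity holds for every `ε`,
  -- while uniqueness compares with any competitor in the ball of radius `ε ≤ ε₀`.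
  obtain ⟨R, HR⟩ := H (min ε (min ε₀ δ)) (by positivity) (by simp)
  refine ⟨max R 1, by positivity, fun a ha => ?_⟩
  obtain ⟨huniq, v, μ, hv, hμ, heq, hvα⟩ :=
    HR a (separated_of_le_minDist ((le_max_left _ _).trans ha))
  rw [hαn] at huniq hvα
  have m1 : min ε (min ε₀ δ) ≤ ε := min_le_left _ _
  have m2 : min ε (min ε₀ δ) ≤ ε₀ := (min_le_right _ _).trans (min_le_left _ _)
  have m3 : min ε (min ε₀ δ) ≤ δ := (min_le_right _ _).trans (min_le_right _ _)
  refine ⟨v, μ, (h.isCriticalWith_iff hVm (u := v)).2 ⟨hvα, heq⟩, hv.trans m1, hμ.trans m1,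
    fun hεε u' lam' hu' hd hl => ?_, fun h1 h2 _ => ?_⟩
  · obtain ⟨k1, k2⟩ := (h.isCriticalWith_iff hVm (u := u')).1 hu'
    exact huniq u' lam' v μ (hd.trans hεε) (hl.trans hεε) (hv.trans m2) (hμ.trans m2) k2 k1 heq hvα
  · exact Hpos h1 h2 _ v μ (hv.trans m3) (hμ.trans m3) heq (by rw [hvα]; exact hα.ne')
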